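/- All manifolds and maps are smooth. An open book decomposition of a closed 3-manifold $M$ is a pair $(B,\pi)$, where $B\subset M$ is a closed codimension-two submanifold with trivial normal bundle (the binding) and $\pi: M\setminus B\to S^1$ is a locally trivial fibration such that: for a suitable tubular neighbourhood $B\times D^2$ of $B=B\times\{0\}$, $\pi(b,z)=z/|z|$ for $z\neq 0$; and each fibre $\pi^{-1}(\theta)$ is the interior of an embedded compact surface $N_\theta\subset M$ (a page) with $\partial N_\theta=B$. The trivial open book of $S^5=\{(z,w)\in\mathbb C\times\mathbb R^4 : |z|^2+|w|^2=1\}$ has binding $B_0=\{z=0\}$ and projection $\pi_0(z,w)=z/|z|$; its pages are the hemispheres $\{(r\theta,w): r\ge 0\}\cong D^4$ and its monodromy is the identity of $D^4$. Proposition. Let $M$ be a closed oriented 3-manifold with an open book decomposition $(B,\pi)$ whose pages are diffeomorphic to the annulus $S^1\times[0,1]$; the monodromy may be any mapping class of the annulus. Then $(M,B,\pi)$ admits an open book embedding in the trivial open book $(S^5,B_0,\pi_0)$, that is, there is a smooth embedding $f:M\hookrightarrow S^5$ with $f(B)\subset B_0$, $f(M\setminus B)\subset S^5\setminus B_0$ and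 $\pi_0\circ f=\pi$ on $M\setminus B$. -/

import Mathlib

open scoped Manifold ContDiff

noncomputable section

/-- The angular coordinate `z ↦ z / ‖z‖ ∈ S¹` of the punctured plane
(with the irrelevant value `1` at `z = 0`). -/
def angle (z : ℂ) : Circle := Circle.exp (Complex.arg z)

theorem norm_mul_angle (z : ℂ) : (‖z‖ : ℂ) * (angle z : ℂ) = z := by
  simp [angle, Complex.norm_mul_exp_arg_mul_I]

theorem coe_angle {z : ℂ} (hz : z ≠ 0) : (angle z : ℂ) = z / (‖z‖ : ℂ) := by
  have h : (‖z‖ : ℂ) ≠ 0 := by simpa using hz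
  rw [eq_div_iff h, mul_comm, norm_mul_angle]

/-- A smooth `3`-manifold (without boundary) is orientable if it is covered by charts of its
smooth structure all of whose transition maps have positive Jacobian determinant. -/
def IsOrientable3 (M : Type*) [TopologicalSpace M]
    [ChartedSpace (EuclideanSpace ℝ (Fin 3)) M] : Prop :=
  ∃ A : Set (OpenPartialHomeomorph M (EuclideanSpace ℝ (Fin 3))),
    A ⊆ IsManifold.maximalAtlas (𝓡 3) ∞ M ∧
    (∀ x : M, ∃ e ∈ A, x ∈ e.source) ∧
    ∀ e ∈ A, ∀ e' ∈ A, ∀ y ∈ (e.symm.trans e').source,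
      0 < (fderiv ℝ (e.symm.trans e') y).det

/-- `B` has a tubular neighbourhood `L × ℂ` (the plane `ℂ` being diffeomorphic to the open disc
along rays), where `L` is a smooth `1`-manifold, `B` corresponds to `L × {0}`, and `π` is the
angular coordinate of the second factor. In particular `B` is a codimension two submanifold with
trivial normal bundle. The map `τ` is a diffeomorphism onto an open subset of `M`. -/
def HasAngularNeighbourhood {M : Type*} [TopologicalSpace M]
    [ChartedSpace (EuclideanSpace ℝ (Fin 3)) M] (B : Set M) (π : M → Circle) : Prop :=
  ∃ (L : Type) (_ : TopologicalSpace L) (_ : ChartedSpace (EuclideanSpace ℝ (Fin 1)) L)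
    (_ : IsManifold (𝓡 1) ∞ L) (τ : L × ℂ → M),
    IsLocalDiffeomorph ((𝓡 1).prod 𝓘(ℝ, ℂ)) (𝓡 3) ∞ τ ∧
    Function.Injective τ ∧
    τ '' {p | p.2 = 0} = B ∧
    ∀ (l : L) (z : ℂ), z ≠ 0 → π (τ (l, z)) = angle z

/-- `(B, π)` is an open book decomposition of the smooth `3`-manifold `M`, all of whose pages are
diffeomorphic to the manifold with boundary `P`. Only the values of `π` off the binding `B`
matter. -/
structure IsOpenBook3 {E H : Type*} [NormedAddCommGroup E] [NormedSpace ℝ E] [TopologicalSpace H]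
    (J : ModelWithCorners ℝ E H) (P : Type*) [TopologicalSpace P] [ChartedSpace H P]
    {M : Type*} [TopologicalSpace M] [ChartedSpace (EuclideanSpace ℝ (Fin 3)) M]
    (B : Set M) (π : M → Circle) : Prop where
  /-- the binding is a closed subset -/
  isClosed_binding : IsClosed B
  /-- the binding is a codimension two submanifold with trivial normal bundle, near which `π` is
  the normal angular coordinate -/
  angular : HasAngularNeighbourhood B π
  /-- the projection is smooth off the binding -/
  contMDiffOn_proj : ContMDiffOn (𝓡 3) (𝓡 1) ∞ π Bᶜ
  /-- `π : M \ B → S¹` is a smooth locally trivial fibration whose fibre is the interior of `P` -/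
  locally_trivial : ∀ θ : Circle, ∃ U : Set Circle, IsOpen U ∧ θ ∈ U ∧
    ∃ e : OpenPartialHomeomorph (Circle × P) M,
      e.source = U ×ˢ J.interior P ∧
      e.target = {x | x ∉ B ∧ π x ∈ U} ∧
      ContMDiffOn ((𝓡 1).prod J) (𝓡 3) ∞ e e.source ∧
      ContMDiffOn (𝓡 3) ((𝓡 1).prod J) ∞ e.symm e.target ∧
      ∀ p ∈ e.source, π (e p) = p.1
  /-- each fibre is the interior of a smoothly embedded copy of `P` with boundary `B` (a page) -/
  page : ∀ θ : Circle, ∃ j : P → M, Manifold.IsSmoothEmbedding J (𝓡 3) ∞ j ∧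
    j '' J.boundary P = B ∧ j '' J.interior P = {x | x ∉ B ∧ π x = θ}

/-- The (compact) annulus `S¹ × [0, 1]`. -/
abbrev Annulus : Type := Circle × Set.Icc (0 : ℝ) 1

/-- The model with corners of the annulus as a smooth surface with boundary. -/
abbrev annulusModel := (𝓡 1).prod (𝓡∂ 1)

/-- The unit sphere `S⁵` in `ℝ⁶`. -/
abbrev S5 : Type := Metric.sphere (0 : EuclideanSpace ℝ (Fin 6)) 1

/-- The first complex coordinate on `S⁵ ⊆ ℝ⁶ = ℂ × ℝ⁴`. -/
def S5.z (x : S5) : ℂ := ⟨x.1 0, x.1 1⟩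

/-- The binding `{z = 0} ≅ S³ = ∂D⁴` of the trivial open book of `S⁵`. -/
def trivialBinding : Set S5 := {x | x.z = 0}

/-- The projection `(z, w) ↦ z / ‖z‖` of the trivial open book of `S⁵`. The page over `θ` is the
hemisphere `{(r θ, w) | 0 ≤ r, r² + ‖w‖² = 1}`, a copy of `D⁴` via `w`. The rotations
`(z, w) ↦ (e^{it} z, w)` carry pages to pages fixing the coordinate `w`, so that the monodromy is
the identity of `D⁴`. -/
def trivialProj (x : S5) : Circle := angle x.z

/-- `f` is an open book embedding of `(M, B₁, π₁)` in `(N, B₂, π₂)`: a smooth embedding which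
maps binding into binding, complement of binding into complement of binding, and commutes with
the projections to `S¹`. -/
structure IsOpenBookEmbedding {E₁ H₁ E₂ H₂ : Type*}
    [NormedAddCommGroup E₁] [NormedSpace ℝ E₁] [TopologicalSpace H₁]
    [NormedAddCommGroup E₂] [NormedSpace ℝ E₂] [TopologicalSpace H₂]
    (I₁ : ModelWithCorners ℝ E₁ H₁) (I₂ : ModelWithCorners ℝ E₂ H₂)
    {M N : Type*} [TopologicalSpace M] [ChartedSpace H₁ M] [TopologicalSpace N]
    [ChartedSpace H₂ N] (B₁ : Set M) (π₁ : M → Circle) (B₂ : Set N) (π₂ : N → Circle)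
    (f : M → N) : Prop where
  isSmoothEmbedding : Manifold.IsSmoothEmbedding I₁ I₂ ∞ f
  mapsTo_binding : Set.MapsTo f B₁ B₂
  mapsTo_compl : Set.MapsTo f B₁ᶜ B₂ᶜ
  comm : ∀ x ∉ B₁, π₂ (f x) = π₁ x

end

/-! The open hemisphere of S⁵ over θ is identified with ℂ² by (z, w) ↦ w / ‖z‖. Off the binding, an
open book embedding therefore amounts to two complex functions `p true`, `p false` which together
embed every page in ℂ². The binding has two components, one for each end of the annulus, with
collars `T true`, `T false` in which the argument of the normal coordinate z is π. Each `p i` is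
required to equal exp(it) / ‖z‖ near component `i` and to vanish near the other one (`IsPageFun`),
so that the end `i` runs off to infinity in a standard way. If ζ is smooth with argument π and
equals z near the binding (`IsDefiningFun`), then ‖ζ‖ · `p i` extends smoothly over the binding, by
exp(it) on component `i` and by 0 on the other. The embedding is the radial projection to S⁵ of (ζ,
‖ζ‖ `p true`, ‖ζ‖ `p false`), that is, of `bookMap`.

It remains to embed the pages. A half-open annulus embeds in the plane as the outside of a point,
its closed-off end shrinking to 0. So on a single page `p i` can be chosen to be an embedding away
from its zeros, with all zeros in the unit collar of the other component (`IsGood`,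
`IsCollars.exists_isGood`). There the other function is standard, hence already injective and
immersive. So on each page it is enough that one of the two functions be good; this is what
`IsPagePair.eq_of_bookMap_eq_smul` and `IsPagePair.eq_zero_of_mfderiv_eq_zero` use.

For this reason the monodromy never enters. A good function can be altered near its zeros so as to
stay good on nearby pages (`IsGood.exists_eventually`), and its standard collar can be rescaled to
radius 1 (`IsPageFun.exists_radius_one`). The conditions in `IsPageFun` are convex, so functions
prescribed over disjoint closed arcs of the circle are glued by a partition of unity
(`IsPageFun.exists_glue`), with no control over what happens between the arcs. Two families of
disjoint small arcs together cover the circle (`exists_arcs`): `p true` is good over one family and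
`p false` over the other. -/

noncomputable section

open Set Filter Topology Function Module

/-! ### Inverse function theorem: local injectivity and local inverses -/

section

section VectorSpace

variable {V W : Type*} [NormedAddCommGroup V] [NormedSpace ℝ V] [NormedAddCommGroup W]
  [NormedSpace ℝ W]

/-- A map of class `C¹` on a convex set whose derivative at a point is injective is injective near
that point, and so are its derivatives. -/
theorem exists_nhdsWithin_injOn_of_injective_fderivWithin [FiniteDimensional ℝ V] {F : V → W}
    {s : Set V} (hs : Convex ℝ s) (hu : UniqueDiffOn ℝ s) {x : V} (hx : x ∈ s)
    (hF : ContDiffWithinAt ℝ 1 F s x) (hinj : Injective (fderivWithin ℝ F s x)) :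
    ∃ U ∈ 𝓝[s] x, InjOn F U ∧ ∀ y ∈ U, Injective (fderivWithin ℝ F s y) := by
  obtain ⟨K, hK, hL⟩ := LinearMap.exists_antilipschitzWith
    (fderivWithin ℝ F s x).toLinearMap (LinearMap.ker_eq_bot.2 hinj)
  have hL' : ∀ v, ‖v‖ ≤ K * ‖fderivWithin ℝ F s x v‖ := fun v => by
    simpa using hL.le_mul_dist v 0
  have hK' : (0 : ℝ) < K := hK
  have hc : ContinuousWithinAt (fderivWithin ℝ F s) s x := by
    have := hF.fderivWithin_right (m := 0) hu (by simp) hx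
    exact this.continuousWithinAt
  have hd : ∀ᶠ y in 𝓝[s] x, DifferentiableWithinAt ℝ F s y := by
    have := hF.eventually (by simp)
    rw [insert_eq_of_mem hx] at this
    filter_upwards [this] with y hy using hy.differentiableWithinAt one_ne_zero
  -- Perturbing the derivative by at most 1 / (2K) loses at most half of the lower bound ‖v‖ ≤ K
  -- ‖F'(x) v‖; the mean value inequality on the convex set then gives injectivity of F, and the
  -- same margin gives that of F'(y).
  have hb : ∀ᶠ y in 𝓝[s] x, ‖fderivWithin ℝ F s y - fderivWithin ℝ F s x‖ < 1 / (2 * K) := by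
    have := Metric.tendsto_nhds.1 hc (1 / (2 * K)) (by positivity)
    simpa [dist_eq_norm] using this
  obtain ⟨r, hr, hball⟩ := Metric.mem_nhdsWithin_iff.1 (hd.and hb)
  refine ⟨Metric.ball x r ∩ s, Metric.mem_nhdsWithin_iff.2 ⟨r, hr, Subset.rfl⟩, ?_, ?_⟩
  · intro y hy y' hy' h
    have := Convex.norm_image_sub_le_of_norm_hasFDerivWithin_le' (f := F)
      (s := Metric.ball x r ∩ s) (C := 1 / (2 * K)) (φ := fderivWithin ℝ F s x)
      (fun z hz => ((hball hz).1.hasFDerivWithinAt).mono inter_subset_right)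
      (fun z hz => (hball hz).2.le) ((convex_ball x r).inter hs) hy hy'
    rw [h, sub_self, zero_sub, norm_neg] at this
    have h2 := hL' (y' - y)
    have h3 : (K : ℝ) * ‖fderivWithin ℝ F s x (y' - y)‖ ≤ ‖y' - y‖ / 2 := by
      calc _ ≤ (K : ℝ) * (1 / (2 * K) * ‖y' - y‖) := by gcongr
        _ = _ := by field_simp
    have h4 : ‖y' - y‖ = 0 := le_antisymm (by linarith) (norm_nonneg _)
    exact (sub_eq_zero.1 (norm_eq_zero.1 h4)).symm
  · intro y hy
    refine (injective_iff_map_eq_zero _).2 fun v hv => ?_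
    have h1 := (fderivWithin ℝ F s y - fderivWithin ℝ F s x).le_opNorm v
    have h2 := hL' v
    rw [sub_apply, hv, zero_sub, norm_neg] at h1
    have h3 : (K : ℝ) * ‖fderivWithin ℝ F s x v‖ ≤ ‖v‖ / 2 := by
      calc _ ≤ (K : ℝ) * (1 / (2 * K) * ‖v‖) := by
            gcongr; exact h1.trans (by gcongr; exact (hball hy).2.le)
        _ = _ := by field_simp
    exact norm_eq_zero.1 (le_antisymm (by linarith) (norm_nonneg _))

theorem exists_nhds_injOn_of_injective_fderiv [FiniteDimensional ℝ V] {F : V → W} {x : V}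
    (hF : ContDiffAt ℝ 1 F x) (hinj : Injective (fderiv ℝ F x)) :
    ∃ U ∈ 𝓝 x, InjOn F U ∧ ∀ y ∈ U, Injective (fderiv ℝ F y) := by
  have := exists_nhdsWithin_injOn_of_injective_fderivWithin (F := F) convex_univ uniqueDiffOn_univ
    (mem_univ x) hF.contDiffWithinAt (by simpa using hinj)
  simpa using this

/-- The inverse function theorem for smooth maps between spaces of equal finite dimension. -/
theorem exists_openPartialHomeomorph_of_injective_fderiv [FiniteDimensional ℝ V]
    [FiniteDimensional ℝ W] (hd : finrank ℝ V = finrank ℝ W) {F : V → W} {U : Set V}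
    (hU : IsOpen U) {x : V} (hx : x ∈ U) (hF : ContDiffOn ℝ ∞ F U)
    (hinj : Injective (fderiv ℝ F x)) :
    ∃ G : OpenPartialHomeomorph V W, x ∈ G.source ∧ G.source ⊆ U ∧ (∀ y, G y = F y) ∧
      ContDiffOn ℝ ∞ G.symm G.target := by
  have hFx : ContDiffAt ℝ ∞ F x := hF.contDiffAt (hU.mem_nhds hx)
  have key : ∀ y ∈ U, Injective (fderiv ℝ F y) → ∃ f' : V ≃L[ℝ] W,
      HasFDerivAt F (f' : V →L[ℝ] W) y := by
    intro y hy hinj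
    refine ⟨(LinearMap.linearEquivOfInjective (fderiv ℝ F y).toLinearMap hinj
      hd).toContinuousLinearEquiv, ?_⟩
    have h := ((hF.contDiffAt (hU.mem_nhds hy)).differentiableAt (by simp)).hasFDerivAt
    convert h using 1
    ext v
    rfl
  obtain ⟨f', hf'⟩ := key x hx hinj
  obtain ⟨N, hN, -, hN'⟩ := exists_nhds_injOn_of_injective_fderiv
    (hFx.of_le (by exact_mod_cast le_top)) hinj
  let G₀ := hFx.toOpenPartialHomeomorph F hf' (by simp)
  have hN2 : interior (N ∩ U) ⊆ N ∩ U := interior_subset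
  refine ⟨G₀.restrOpen (interior (N ∩ U)) isOpen_interior, ?_, ?_, fun y => rfl, ?_⟩
  · exact ⟨hFx.mem_toOpenPartialHomeomorph_source hf' (by simp),
      mem_interior_iff_mem_nhds.2 (inter_mem hN (hU.mem_nhds hx))⟩
  · exact fun y hy => (hN2 hy.2).2
  · intro w hw
    set G := G₀.restrOpen (interior (N ∩ U)) isOpen_interior
    have hs : G.symm w ∈ G.source := G.map_target hw
    have hs2 := hN2 hs.2
    obtain ⟨g', hg'⟩ := key _ hs2.2 (hN' _ hs2.1)
    exact (G.contDiffAt_symm hw hg' (hF.contDiffAt (hU.mem_nhds hs2.2))).contDiffWithinAt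

end VectorSpace

section Manifolds

variable {V W : Type*} [NormedAddCommGroup V] [NormedSpace ℝ V] [NormedAddCommGroup W]
  [NormedSpace ℝ W] [FiniteDimensional ℝ V]
  {E H : Type*} [NormedAddCommGroup E] [NormedSpace ℝ E] [FiniteDimensional ℝ E]
  [TopologicalSpace H] {I : ModelWithCorners ℝ E H} [I.Boundaryless]
  {M : Type*} [TopologicalSpace M] [ChartedSpace H M] [IsManifold I ∞ M]

omit [FiniteDimensional ℝ E] [I.Boundaryless] in
theorem injective_mfderiv_extChartAt {x y : M} (hy : y ∈ (extChartAt I x).source) :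
    Injective (mfderiv I 𝓘(ℝ, E) (extChartAt I x) y) := by
  have : IsManifold I 1 M := IsManifold.of_le (n := ∞) (by exact_mod_cast le_top)
  obtain ⟨e, he⟩ := isInvertible_mfderiv_extChartAt (I := I) hy
  rw [← he]
  exact e.injective

omit [I.Boundaryless] in
/-- The inverse function theorem for a smooth map from an open subset of a vector space to a
manifold of the same dimension. -/
theorem exists_localInverse_of_injective_mfderiv (hd : finrank ℝ V = finrank ℝ E) {f : V → M}
    {U : Set V} (hU : IsOpen U) {x : V} (hx : x ∈ U) (hf : ContMDiffOn 𝓘(ℝ, V) I ∞ f U)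
    (hinj : Injective (mfderiv 𝓘(ℝ, V) I f x)) :
    ∃ (N : Set M) (g : M → V), IsOpen N ∧ f x ∈ N ∧ ContMDiffOn I 𝓘(ℝ, V) ∞ g N ∧ g (f x) = x ∧
      (∀ y ∈ N, g y ∈ U ∧ f (g y) = y) ∧ ∀ᶠ y in 𝓝 x, g (f y) = y := by
  set ψ := extChartAt I (f x) with hψ
  have hfx : f x ∈ ψ.source := mem_extChartAt_source (f x)
  let U' : Set V := U ∩ f ⁻¹' ψ.source
  have hU' : IsOpen U' := hf.continuousOn.isOpen_inter_preimage hU (isOpen_extChartAt_source _)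
  have hψs : ContMDiffOn I 𝓘(ℝ, E) ∞ ψ ψ.source := by
    rw [hψ, extChartAt_source]
    exact contMDiffOn_extChartAt
  have hF : ContDiffOn ℝ ∞ (ψ ∘ f) U' := by
    rw [← contMDiffOn_iff_contDiffOn]
    exact hψs.comp (hf.mono inter_subset_left) fun y hy => hy.2
  have hinj' : Injective (fderiv ℝ (ψ ∘ f) x) := by
    rw [← mfderiv_eq_fderiv, mfderiv_comp x
      ((contMDiffAt_extChartAt (n := ∞)).mdifferentiableAt (by simp))
      ((hf.contMDiffAt (hU.mem_nhds hx)).mdifferentiableAt (by simp))]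
    exact (injective_mfderiv_extChartAt hfx).comp hinj
  obtain ⟨G, hxG, hGU, hG, hGs⟩ := exists_openPartialHomeomorph_of_injective_fderiv hd hU'
    ⟨hx, hfx⟩ hF hinj'
  have hcψ : ContinuousOn ψ ψ.source := continuousOn_extChartAt (f x)
  refine ⟨ψ.source ∩ ψ ⁻¹' G.target, G.symm ∘ ψ,
    hcψ.isOpen_inter_preimage (isOpen_extChartAt_source _) G.open_target, ?_, ?_, ?_, ?_, ?_⟩
  · refine ⟨hfx, ?_⟩
    have := G.map_source hxG
    rwa [hG] at this
  · exact (contMDiffOn_iff_contDiffOn.2 hGs).comp (hψs.mono inter_subset_left) fun y hy => hy.2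
  · have := G.left_inv hxG
    rwa [hG] at this
  · rintro y ⟨hy, hy'⟩
    have h1 := G.map_target hy'
    refine ⟨(hGU h1).1, ψ.injOn (hGU h1).2 hy ?_⟩
    have := G.right_inv hy'
    rwa [hG] at this
  · filter_upwards [G.open_source.mem_nhds hxG] with y hy
    have := G.left_inv hy
    rwa [hG] at this

/-- A smooth map to a vector space with injective derivative at a point is injective nearby, and
its derivatives are injective nearby. -/
theorem exists_nhds_injOn_of_injective_mfderiv {f : M → W} {U : Set M} (hU : IsOpen U) {x : M}
    (hx : x ∈ U) (hf : ContMDiffOn I 𝓘(ℝ, W) ∞ f U)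
    (hinj : Injective (mfderiv I 𝓘(ℝ, W) f x)) :
    ∃ N ∈ 𝓝 x, InjOn f N ∧ ∀ y ∈ N, Injective (mfderiv I 𝓘(ℝ, W) f y) := by
  set ψ := extChartAt I x with hψ
  have hxs : x ∈ ψ.source := mem_extChartAt_source x
  have hψs : ContMDiffOn 𝓘(ℝ, E) I ∞ ψ.symm ψ.target := contMDiffOn_extChartAt_symm x
  have hto : IsOpen ψ.target := isOpen_extChartAt_target x
  have hF : ∀ y ∈ ψ.target, ψ.symm y ∈ U → ContDiffAt ℝ ∞ (f ∘ ψ.symm) y := by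
    intro y hy hyU
    rw [← contMDiffAt_iff_contDiffAt]
    exact (hf.contMDiffAt (hU.mem_nhds hyU)).comp y (hψs.contMDiffAt (hto.mem_nhds hy))
  have hd : ∀ y ∈ ψ.source, y ∈ U → mfderiv I 𝓘(ℝ, W) f y =
      (fderiv ℝ (f ∘ ψ.symm) (ψ y)).comp (mfderiv I 𝓘(ℝ, E) ψ y) := by
    intro y hy hyU
    have h1 : f =ᶠ[𝓝 y] (f ∘ ψ.symm) ∘ ψ := by
      filter_upwards [(isOpen_extChartAt_source (I := I) x).mem_nhds hy] with z hz
      simp only [comp_apply]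
      rw [ψ.left_inv hz]
    rw [h1.mfderiv_eq, ← mfderiv_eq_fderiv]
    refine mfderiv_comp y ?_ ?_
    · refine (contMDiffAt_iff_contDiffAt.2 (hF _ (ψ.map_source hy) ?_)).mdifferentiableAt
        (by simp)
      rwa [ψ.left_inv hy]
    · rw [extChartAt_source] at hy
      exact (contMDiffOn_extChartAt (n := ∞) |>.contMDiffAt
        ((chartAt H x).open_source.mem_nhds hy)).mdifferentiableAt (by simp)
  have hinj' : Injective (fderiv ℝ (f ∘ ψ.symm) (ψ x)) := by
    have : IsManifold I 1 M := IsManifold.of_le (n := ∞) (by exact_mod_cast le_top)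
    obtain ⟨e, he⟩ := isInvertible_mfderiv_extChartAt (I := I) hxs
    rw [hd x hxs hx, ← he] at hinj
    intro v w h
    have h1 : e (e.symm v) = v := e.apply_symm_apply v
    have h2 : e (e.symm w) = w := e.apply_symm_apply w
    exact e.symm.injective (@hinj (e.symm v) (e.symm w)
      ((congrArg (fderiv ℝ (f ∘ ψ.symm) (ψ x)) h1).trans
        (h.trans (congrArg (fderiv ℝ (f ∘ ψ.symm) (ψ x)) h2).symm)))
  obtain ⟨N, hN, hN1, hN2⟩ := exists_nhds_injOn_of_injective_fderiv
    ((hF (ψ x) (ψ.map_source hxs) (by rwa [ψ.left_inv hxs])).of_le (by exact_mod_cast le_top))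
    hinj'
  refine ⟨ψ.source ∩ U ∩ ψ ⁻¹' N, inter_mem (inter_mem
    ((isOpen_extChartAt_source (I := I) x).mem_nhds hxs) (hU.mem_nhds hx))
    ((continuousAt_extChartAt x).preimage_mem_nhds hN), ?_, ?_⟩
  · rintro y ⟨⟨hy, -⟩, hyN⟩ z ⟨⟨hz, -⟩, hzN⟩ h
    refine ψ.injOn hy hz (hN1 hyN hzN ?_)
    simp only [comp_apply]
    rw [ψ.left_inv hy, ψ.left_inv hz, h]
  · rintro y ⟨⟨hy, hyU⟩, hyN⟩
    rw [hd y hy hyU]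
    exact (hN2 _ hyN).comp (injective_mfderiv_extChartAt hy)

end Manifolds

end

/-! ### Injective derivative implies immersion, without boundary -/

section

section Immersion

variable {E E' F : Type*} [NormedAddCommGroup E] [NormedSpace ℝ E] [FiniteDimensional ℝ E]
  [NormedAddCommGroup E'] [NormedSpace ℝ E'] [FiniteDimensional ℝ E']
  [NormedAddCommGroup F] [NormedSpace ℝ F] [FiniteDimensional ℝ F]
  {M : Type*} [TopologicalSpace M] [ChartedSpace E M] [IsManifold 𝓘(ℝ, E) ∞ M]
  {N : Type*} [TopologicalSpace N] [ChartedSpace E' N] [IsManifold 𝓘(ℝ, E') ∞ N]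

omit [FiniteDimensional ℝ E] in
-- A complement of the range of `L` has the dimension of `F`, so `F` can be mapped isomorphically
-- onto it.
theorem exists_linearMap_injective_coprod
    (hd : finrank ℝ E + finrank ℝ F = finrank ℝ E') {L : E →L[ℝ] E'} (hL : Injective L) :
    ∃ C : F →L[ℝ] E', Injective (L.coprod C) := by
  obtain ⟨K, hK⟩ := Submodule.exists_isCompl L.toLinearMap.range
  have h1 : finrank ℝ L.toLinearMap.range = finrank ℝ E := LinearMap.finrank_range_of_inj hL
  have h2 := Submodule.finrank_add_eq_of_isCompl hK
  have h3 : finrank ℝ F = finrank ℝ K := by omega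
  let e : F ≃ₗ[ℝ] K := LinearEquiv.ofFinrankEq _ _ h3
  refine ⟨(K.subtype.comp e.toLinearMap).toContinuousLinearMap, ?_⟩
  refine (injective_iff_map_eq_zero _).2 ?_
  rintro ⟨v, k⟩ h
  have h' : L v + (e k : E') = 0 := by simpa using h
  have hmem : L v ∈ K := by
    rw [eq_neg_of_add_eq_zero_left h']
    exact K.neg_mem (e k).2
  have h0 : L v = 0 := (Submodule.disjoint_def.1 hK.disjoint) _ ⟨v, rfl⟩ hmem
  have hv : v = 0 := hL (by rw [h0, map_zero])
  have hk : (e k : E') = 0 := by simpa [h0] using h'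
  have hk' : k = 0 := by
    have : e k = 0 := by exact_mod_cast hk
    simpa using this
  simp [hv, hk']

/-- A smooth map between boundaryless manifolds with injective derivative at a point is an immersion
at that point. -/
theorem isImmersionAtOfComplement_of_injective_mfderiv
    (hd : finrank ℝ E + finrank ℝ F = finrank ℝ E') {f : M → N}
    (hf : ContMDiff 𝓘(ℝ, E) 𝓘(ℝ, E') ∞ f) {x : M}
    (hinj : Injective (mfderiv 𝓘(ℝ, E) 𝓘(ℝ, E') f x)) :
    Manifold.IsImmersionAtOfComplement F 𝓘(ℝ, E) 𝓘(ℝ, E') ∞ f x := by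
  set φ := chartAt E x with hφ
  set ψ := chartAt E' (f x) with hψ
  have hφa : φ ∈ IsManifold.maximalAtlas 𝓘(ℝ, E) ∞ M := IsManifold.chart_mem_maximalAtlas x
  have hψa : ψ ∈ IsManifold.maximalAtlas 𝓘(ℝ, E') ∞ N := IsManifold.chart_mem_maximalAtlas (f x)
  have hφs : ContMDiffOn 𝓘(ℝ, E) 𝓘(ℝ, E) ∞ φ.symm φ.target :=
    contMDiffOn_symm_of_mem_maximalAtlas hφa
  have hψ1 : ContMDiffOn 𝓘(ℝ, E') 𝓘(ℝ, E') ∞ ψ ψ.source := contMDiffOn_of_mem_maximalAtlas hψa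
  have hψ2 : ContMDiffOn 𝓘(ℝ, E') 𝓘(ℝ, E') ∞ ψ.symm ψ.target :=
    contMDiffOn_symm_of_mem_maximalAtlas hψa
  have hxφ : x ∈ φ.source := mem_chart_source E x
  have hxψ : f x ∈ ψ.source := mem_chart_source E' (f x)
  let U : Set E := φ.target ∩ φ.symm ⁻¹' (f ⁻¹' ψ.source)
  have hU : IsOpen U := φ.symm.isOpen_inter_preimage (ψ.open_source.preimage hf.continuous)
  have hF : ContDiffOn ℝ ∞ (ψ ∘ f ∘ φ.symm) U := by
    rw [← contMDiffOn_iff_contDiffOn]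
    exact hψ1.comp (hf.comp_contMDiffOn (hφs.mono inter_subset_left)) fun y hy => hy.2
  have hxU : φ x ∈ U := ⟨φ.map_source hxφ, by
    change f (φ.symm (φ x)) ∈ ψ.source
    rwa [φ.left_inv hxφ]⟩
  have hFinj : Injective (fderiv ℝ (ψ ∘ f ∘ φ.symm) (φ x)) := by
    have h1 : ψ ∘ f =ᶠ[𝓝 x] (ψ ∘ f ∘ φ.symm) ∘ φ := by
      filter_upwards [φ.open_source.mem_nhds hxφ] with z hz
      simp only [comp_apply]
      rw [φ.left_inv hz]
    have hψi : Injective (mfderiv 𝓘(ℝ, E') 𝓘(ℝ, E') ψ (f x)) := by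
      have := injective_mfderiv_extChartAt (I := 𝓘(ℝ, E')) (mem_extChartAt_source (f x))
      simpa [extChartAt, OpenPartialHomeomorph.extend] using! this
    have h2 : mfderiv 𝓘(ℝ, E) 𝓘(ℝ, E') (ψ ∘ f) x =
        (fderiv ℝ (ψ ∘ f ∘ φ.symm) (φ x)).comp (mfderiv 𝓘(ℝ, E) 𝓘(ℝ, E) φ x) := by
      rw [h1.mfderiv_eq, ← mfderiv_eq_fderiv]
      exact mfderiv_comp x
        ((contMDiffAt_iff_contDiffAt.2 (hF.contDiffAt (hU.mem_nhds hxU))).mdifferentiableAt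
          (by simp))
        (((contMDiffOn_of_mem_maximalAtlas hφa).contMDiffAt
          (φ.open_source.mem_nhds hxφ)).mdifferentiableAt (by simp))
    have h3 : Injective (mfderiv 𝓘(ℝ, E) 𝓘(ℝ, E') (ψ ∘ f) x) := by
      rw [mfderiv_comp x ((hψ1.contMDiffAt (ψ.open_source.mem_nhds hxψ)).mdifferentiableAt
        (by simp)) ((hf x).mdifferentiableAt (by simp))]
      exact hψi.comp hinj
    rw [h2] at h3
    have : IsManifold 𝓘(ℝ, E) 1 M := IsManifold.of_le (n := ∞) (by exact_mod_cast le_top)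
    obtain ⟨e, he⟩ := isInvertible_mfderiv_extChartAt (I := 𝓘(ℝ, E)) (mem_extChartAt_source x)
    have hsurj : ∀ v : E, ∃ v' : E, mfderiv 𝓘(ℝ, E) 𝓘(ℝ, E) φ x v' = v := fun v =>
      ⟨e.symm v, (DFunLike.congr_fun he.symm (e.symm v)).trans (e.apply_symm_apply v)⟩
    intro v w h
    obtain ⟨v', rfl⟩ := hsurj v
    obtain ⟨w', rfl⟩ := hsurj w
    exact congrArg _ (@h3 v' w' h)
  obtain ⟨C, hC⟩ := exists_linearMap_injective_coprod (F := F) hd hFinj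
  have hd' : finrank ℝ (E × F) = finrank ℝ E' := by rw [finrank_prod, hd]
  -- The map is thickened to (u, k) ↦ F(u) + C k, which is a local diffeomorphism; the inverse of
  -- the thickening, composed with the chart of `N`, is a chart in which f becomes u ↦ (u, 0).
  obtain ⟨G, hG1, hG2, hG3, hG4⟩ := exists_openPartialHomeomorph_of_injective_fderiv
    (F := fun p : E × F => (ψ ∘ f ∘ φ.symm) p.1 + C p.2) (x := (φ x, 0)) hd'
    (hU.prod isOpen_univ) ⟨hxU, mem_univ _⟩
    ((hF.comp contDiff_fst.contDiffOn fun p hp => hp.1).add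
      (C.contDiff.comp contDiff_snd).contDiffOn) (by
      have h1 : HasFDerivAt (ψ ∘ f ∘ φ.symm) (fderiv ℝ (ψ ∘ f ∘ φ.symm) (φ x))
        ((φ x, (0 : F)).1) :=
        ((hF.contDiffAt (hU.mem_nhds hxU)).differentiableAt (by simp)).hasFDerivAt
      have h2 := (h1.comp (φ x, (0 : F)) hasFDerivAt_fst).add
        (C.hasFDerivAt.comp (φ x, (0 : F)) hasFDerivAt_snd)
      have h3 : fderiv ℝ (fun p : E × F => (ψ ∘ f ∘ φ.symm) p.1 + C p.2) (φ x, 0) =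
          (fderiv ℝ (ψ ∘ f ∘ φ.symm) (φ x)).coprod C := by
        refine h2.fderiv.trans ?_
        ext v <;> simp
      rw [h3]
      exact hC)
  have hG5 : ContDiffOn ℝ ∞ G G.source := by
    have : ContDiffOn ℝ ∞ (fun p : E × F => (ψ ∘ f ∘ φ.symm) p.1 + C p.2) (U ×ˢ univ) :=
      (hF.comp contDiff_fst.contDiffOn fun p hp => hp.1).add
      (C.contDiff.comp contDiff_snd).contDiffOn
    exact (this.mono hG2).congr fun y _ => hG3 y
  let equiv : (E × F) ≃L[ℝ] E' := ContinuousLinearEquiv.ofFinrankEq hd'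
  let cod : OpenPartialHomeomorph N E' :=
    (ψ ≫ₕ G.symm) ≫ₕ equiv.toHomeomorph.toOpenPartialHomeomorph
  let A : Set M := φ.source ∩ φ ⁻¹' ((fun u => (u, (0 : F))) ⁻¹' G.source)
  have hA : IsOpen A := φ.isOpen_inter_preimage (G.open_source.preimage (by fun_prop))
  have hval : ψ (f x) = G (φ x, 0) := by
    rw [hG3]; simp [φ.left_inv hxφ]
  refine Manifold.IsImmersionAtOfComplement.mk_of_continuousAt hf.continuous.continuousAt equiv
    (φ.restr A) cod ?_ ?_ ?_ ?_ ?_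
  · rw [φ.restr_source' A hA]
    exact ⟨hxφ, hxφ, hG1⟩
  · refine ⟨⟨hxψ, ?_⟩, mem_univ _⟩
    change ψ (f x) ∈ G.target
    rw [hval]
    exact G.map_source hG1
  · exact restr_mem_maximalAtlas _ hφa hA
  · refine cod.mem_maximalAtlas_of_contMDiffOn ?_ ?_
    · refine (equiv.contDiff.contMDiff).comp_contMDiffOn ?_
      refine (contMDiffOn_iff_contDiffOn.2 hG4).comp (hψ1.mono fun y hy => hy.1.1) ?_
      exact fun y hy => hy.1.2
    · have h : ∀ y ∈ cod.target, equiv.symm y ∈ G.source ∧ G (equiv.symm y) ∈ ψ.target := by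
        intro y hy
        obtain ⟨z, ⟨⟨hz1, hz2⟩, -⟩, rfl⟩ : ∃ z ∈ cod.source, cod z = y :=
          ⟨cod.symm y, cod.map_target hy, cod.right_inv hy⟩
        have h1 : equiv.symm (cod z) = G.symm (ψ z) := equiv.symm_apply_apply _
        have h2 : ψ z ∈ G.target := hz2
        rw [h1]
        refine ⟨G.map_target h2, ?_⟩
        rw [G.right_inv h2]
        exact ψ.map_source hz1
      have h2 : ContMDiffOn 𝓘(ℝ, E') 𝓘(ℝ, E') ∞ (G ∘ equiv.symm) cod.target :=
        contMDiffOn_iff_contDiffOn.2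
          (hG5.comp equiv.symm.contDiff.contDiffOn fun y hy => (h y hy).1)
      exact hψ2.comp h2 fun y hy => (h y hy).2
  · intro u hu
    have hu' : u ∈ φ.target ∧ φ.symm u ∈ A := by
      simpa [OpenPartialHomeomorph.extend, OpenPartialHomeomorph.restr_target,
        hA.interior_eq] using! hu
    have h3 : (u, (0 : F)) ∈ G.source := by
      have := hu'.2.2
      change (φ (φ.symm u), (0 : F)) ∈ G.source at this
      rwa [φ.right_inv hu'.1] at this
    have h4 : ψ (f (φ.symm u)) = G (u, 0) := by
      rw [hG3]; simp
    change equiv (G.symm (ψ (f (φ.symm u)))) = equiv (u, 0)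
    rw [h4, G.left_inv h3]

end Immersion

end

/-! ### Derivatives of immersions of manifolds with boundary; coordinates on the annulus -/

section

section ImmersionDerivative

variable {V W : Type*} [NormedAddCommGroup V] [NormedSpace ℝ V] [NormedAddCommGroup W]
  [NormedSpace ℝ W]
  {E H : Type*} [NormedAddCommGroup E] [NormedSpace ℝ E] [TopologicalSpace H]
  {J : ModelWithCorners ℝ E H} {P : Type*} [TopologicalSpace P] [ChartedSpace H P]
  [IsManifold J ∞ P]
  {E' H' : Type*} [NormedAddCommGroup E'] [NormedSpace ℝ E'] [TopologicalSpace H']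
  {I : ModelWithCorners ℝ E' H'} {M : Type*} [TopologicalSpace M] [ChartedSpace H' M]
  [IsManifold I ∞ M]

omit [IsManifold J ∞ P] [IsManifold I ∞ M] in
/-- An immersion of a manifold with boundary has injective derivative, expressed in terms of a
parametrization `c` of its source which has a smooth left inverse up to an immersion. -/
theorem injective_mfderivWithin_of_isImmersionAt {j : P → M} {c : V → P} {κ : P → W} {S : Set V}
    {x : V} (hS : UniqueDiffWithinAt ℝ S x)
    (hj : Manifold.IsImmersionAt J I ∞ j (c x))
    (hc : ContMDiffWithinAt 𝓘(ℝ, V) J ∞ c S x) (hκ : ContMDiff J 𝓘(ℝ, W) ∞ κ)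
    (hinj : Injective (fderivWithin ℝ (κ ∘ c) S x)) :
    Injective (mfderivWithin 𝓘(ℝ, V) I (j ∘ c) S x) := by
  set φ := hj.domChart.extend J with hφ
  set ψ := hj.codChart.extend I with hψ
  have hjs : ContMDiffAt J I ∞ j (c x) := hj.contMDiffAt
  have hxφ : c x ∈ hj.domChart.source := hj.mem_domChart_source
  -- In immersion charts j reads u ↦ (u, 0), so the first component recovers the point of `P`. This
  -- yields a map g with κ ∘ c = g ∘ ψ ∘ j ∘ c near x, whence the kernel of d(j ∘ c) lies in that of
  -- d(κ ∘ c). At boundary points g is smooth only within `u`, hence the derivatives within sets.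
  have key : ∀ p ∈ hj.domChart.source, (hj.equiv.symm (ψ (j p))).1 = φ p := by
    intro p hp
    have hp' : p ∈ φ.source := by rwa [hφ, OpenPartialHomeomorph.extend_source]
    have := hj.writtenInCharts (φ.map_source hp')
    simp only [comp_apply] at this
    rw [φ.left_inv hp'] at this
    rw [this]
    simp
  let u : Set E' := {y | (hj.equiv.symm y).1 ∈ J '' hj.domChart.target}
  let g : E' → W := κ ∘ φ.symm ∘ fun y => (hj.equiv.symm y).1
  have hg : ContMDiffWithinAt 𝓘(ℝ, E') 𝓘(ℝ, W) ∞ g u (ψ (j (c x))) := by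
    have h1 : ContMDiffOn 𝓘(ℝ, E) J ∞ φ.symm (J '' hj.domChart.target) :=
      contMDiffOn_extend_symm hj.domChart_mem_maximalAtlas
    have h2 : ContMDiff 𝓘(ℝ, E') 𝓘(ℝ, E) ∞ (fun y => (hj.equiv.symm y).1) :=
      (contDiff_fst.comp hj.equiv.symm.contDiff).contMDiff
    refine ((hκ.comp_contMDiffOn h1).comp h2.contMDiffOn (s := u) fun y hy => hy) _ ?_
    change (hj.equiv.symm (ψ (j (c x)))).1 ∈ J '' hj.domChart.target
    rw [key _ hxφ]
    exact ⟨_, hj.domChart.map_source hxφ, rfl⟩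
  set S' : Set V := S ∩ c ⁻¹' hj.domChart.source
  have hnear : c ⁻¹' hj.domChart.source ∈ 𝓝[S] x :=
    hc.continuousWithinAt.preimage_mem_nhdsWithin (hj.domChart.open_source.mem_nhds hxφ)
  have hD : HasMFDerivWithinAt 𝓘(ℝ, V) I (j ∘ c) S x
      (mfderivWithin 𝓘(ℝ, V) I (j ∘ c) S x) :=
    ((hjs.comp_contMDiffWithinAt x hc).mdifferentiableWithinAt (by simp)).hasMFDerivWithinAt
  have hψd : MDifferentiableAt I 𝓘(ℝ, E') ψ (j (c x)) :=
    (OpenPartialHomeomorph.contMDiffAt_extend hj.codChart_mem_maximalAtlas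
      hj.mem_codChart_source).mdifferentiableAt (by simp)
  have h1 := (hψd.hasMFDerivAt.comp_hasMFDerivWithinAt x hD).mono (inter_subset_left :
    S ∩ c ⁻¹' hj.domChart.source ⊆ S)
  have h2 := HasMFDerivWithinAt.comp x
    (hg.mdifferentiableWithinAt (by simp)).hasMFDerivWithinAt h1 (by
      rintro y ⟨-, hy⟩
      change (hj.equiv.symm (ψ (j (c y)))).1 ∈ J '' hj.domChart.target
      rw [key _ hy]
      exact ⟨_, hj.domChart.map_source hy, rfl⟩)
  have h3 : HasMFDerivWithinAt 𝓘(ℝ, V) 𝓘(ℝ, W) (κ ∘ c) S' x _ :=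
    h2.congr_of_eventuallyEq (f₁ := κ ∘ c) (by
      filter_upwards [self_mem_nhdsWithin] with y hy
      change κ (c y) = κ (φ.symm (hj.equiv.symm (ψ (j (c y)))).1)
      rw [key _ hy.2, φ.left_inv (by rw [hφ, OpenPartialHomeomorph.extend_source]; exact hy.2)])
      (by
        change κ (c x) = κ (φ.symm (hj.equiv.symm (ψ (j (c x)))).1)
        rw [key _ hxφ, φ.left_inv (by rw [hφ, OpenPartialHomeomorph.extend_source]; exact hxφ)])
  have h4 : HasFDerivWithinAt (κ ∘ c) (fderivWithin ℝ (κ ∘ c) S x) S' x := by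
    refine HasFDerivWithinAt.mono ?_ inter_subset_left
    have : ContMDiffWithinAt 𝓘(ℝ, V) 𝓘(ℝ, W) ∞ (κ ∘ c) S x :=
      hκ.contMDiffAt.comp_contMDiffWithinAt x hc
    exact ((contMDiffWithinAt_iff_contDiffWithinAt.1 this).differentiableWithinAt
      (by simp)).hasFDerivWithinAt
  have h5 := (hS.inter' hnear).eq h4 h3.hasFDerivWithinAt
  intro v w hvw
  apply hinj
  rw [h5]
  exact congrArg (fun z => (mfderivWithin 𝓘(ℝ, E') 𝓘(ℝ, W) g u (ψ (j (c x))))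
    ((mfderiv I 𝓘(ℝ, E') ψ (j (c x))) z)) hvw

end ImmersionDerivative

/-- Parametrization of the annulus. -/
def annulusParam (x : ℝ × ℝ) : Annulus := (Circle.exp x.1, projIcc 0 1 zero_le_one x.2)

/-- The domain of `annulusParam`. -/
abbrev strip : Set (ℝ × ℝ) := univ ×ˢ Icc 0 1

theorem uniqueDiffOn_strip : UniqueDiffOn ℝ strip :=
  uniqueDiffOn_univ.prod (uniqueDiffOn_Icc one_pos)

theorem contMDiffOn_annulusParam : ContMDiffOn 𝓘(ℝ, ℝ × ℝ) annulusModel ∞ annulusParam strip := by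
  have h1 : ContMDiff 𝓘(ℝ, ℝ × ℝ) 𝓘(ℝ, ℝ) ∞ (Prod.fst : ℝ × ℝ → ℝ) := contDiff_fst.contMDiff
  have h2 : ContMDiff 𝓘(ℝ, ℝ × ℝ) 𝓘(ℝ, ℝ) ∞ (Prod.snd : ℝ × ℝ → ℝ) := contDiff_snd.contMDiff
  have : Fact ((0 : ℝ) < 1) := ⟨one_pos⟩
  exact (contMDiff_circleExp.comp h1).contMDiffOn.prodMk
    ((contMDiffOn_projIcc (x := (0 : ℝ)) (y := 1)).comp h2.contMDiffOn fun y hy => hy.2)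

theorem contMDiff_coe_circle : ContMDiff (𝓡 1) 𝓘(ℝ, ℂ) ∞ (fun z : Circle => (z : ℂ)) := by
  have : Fact (finrank ℝ ℂ = 1 + 1) := finrank_real_complex_fact'
  exact contMDiff_coe_sphere

/-- The standard immersion of the annulus in `ℂ × ℝ`. -/
def annulusCoord (p : Annulus) : ℂ × ℝ := (p.1, p.2)

theorem contMDiff_annulusCoord : ContMDiff annulusModel 𝓘(ℝ, ℂ × ℝ) ∞ annulusCoord := by
  have : Fact ((0 : ℝ) < 1) := ⟨one_pos⟩
  have h2 := contMDiff_subtypeVal_Icc (x := (0 : ℝ)) (y := 1) (n := ∞)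
  exact (contMDiff_coe_circle.comp contMDiff_fst).prodMk_space (h2.comp contMDiff_snd)

theorem injective_fderivWithin_annulusCoord {x : ℝ × ℝ} (hx : x ∈ strip) :
    Injective (fderivWithin ℝ (annulusCoord ∘ annulusParam) strip x) := by
  have h1 : HasFDerivAt (fun y : ℝ × ℝ => (Complex.exp (y.1 * Complex.I), y.2))
      ((((1 : ℝ →L[ℝ] ℝ).smulRight (Complex.exp (x.1 * Complex.I) * Complex.I)).comp
        (ContinuousLinearMap.fst ℝ ℝ ℝ)).prod (ContinuousLinearMap.snd ℝ ℝ ℝ)) x := by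
    have h0 : HasDerivAt (fun t : ℝ => Complex.exp (t * Complex.I))
        (Complex.exp (x.1 * Complex.I) * Complex.I) x.1 := by
      have := ((hasDerivAt_id (x.1 : ℝ)).ofReal_comp.mul_const Complex.I).cexp
      simpa using this
    exact (h0.hasFDerivAt.comp x hasFDerivAt_fst).prodMk hasFDerivAt_snd
  have h2 : HasFDerivWithinAt (annulusCoord ∘ annulusParam) _ strip x :=
    h1.hasFDerivWithinAt.congr (fun y hy => by
      have : (projIcc (0 : ℝ) 1 zero_le_one y.2 : ℝ) = y.2 := by
        rw [projIcc_of_mem zero_le_one hy.2]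
      simp [annulusCoord, annulusParam, Circle.coe_exp, this]) (by
      have : (projIcc (0 : ℝ) 1 zero_le_one x.2 : ℝ) = x.2 := by
        rw [projIcc_of_mem zero_le_one hx.2]
      simp [annulusCoord, annulusParam, Circle.coe_exp, this])
  rw [h2.fderivWithin (uniqueDiffOn_strip x hx)]
  refine (injective_iff_map_eq_zero _).2 ?_
  rintro ⟨a, b⟩ h
  simpa using h

end

/-! ### Parametrizations of the pages -/

section

variable {M : Type*} [TopologicalSpace M] [ChartedSpace (EuclideanSpace ℝ (Fin 3)) M]

/-- `J`, restricted to `ℝ × [0, 1]` and read modulo `2π` in the first variable, is a smooth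
parametrization of the closed page over `θ`, whose interior extends to local parametrizations of
`M` compatible with the projection. -/
structure IsPageParam (B : Set M) (π : M → Circle) (θ : Circle) (J : ℝ × ℝ → M) : Prop where
  contMDiffOn : ContMDiffOn 𝓘(ℝ, ℝ × ℝ) (𝓡 3) ∞ J strip
  injective_mfderivWithin : ∀ x ∈ strip,
    Injective (mfderivWithin 𝓘(ℝ, ℝ × ℝ) (𝓡 3) J strip x)
  eq_iff : ∀ t t', ∀ s ∈ Icc (0 : ℝ) 1, ∀ s' ∈ Icc (0 : ℝ) 1,
    J (t, s) = J (t', s') ↔ Circle.exp t = Circle.exp t' ∧ s = s'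
  mem_page : ∀ x, (x ∉ B ∧ π x = θ) ↔ ∃ t, ∃ s ∈ Ioo (0 : ℝ) 1, J (t, s) = x
  mem_binding : ∀ x, x ∈ B ↔ ∃ t s, (s = 0 ∨ s = 1) ∧ J (t, s) = x
  chart : ∀ t, ∀ s ∈ Ioo (0 : ℝ) 1, ∃ (E : ℝ × ℝ × ℝ → M) (U : Set (ℝ × ℝ × ℝ)), IsOpen U ∧
    (0, t, s) ∈ U ∧ ContMDiffOn 𝓘(ℝ, ℝ × ℝ × ℝ) (𝓡 3) ∞ E U ∧
    Injective (mfderiv 𝓘(ℝ, ℝ × ℝ × ℝ) (𝓡 3) E (0, t, s)) ∧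
    (∀ q, (0, q) ∈ U → q.2 ∈ Ioo (0 : ℝ) 1 ∧ E (0, q) = J q) ∧
    ∀ p ∈ U, E p ∉ B ∧ π (E p) = θ * Circle.exp p.1

theorem annulusParam_eq_iff {t t' s s' : ℝ} (hs : s ∈ Icc (0 : ℝ) 1) (hs' : s' ∈ Icc (0 : ℝ) 1) :
    annulusParam (t, s) = annulusParam (t', s') ↔ Circle.exp t = Circle.exp t' ∧ s = s' := by
  simp only [annulusParam, Prod.mk.injEq, projIcc_of_mem zero_le_one hs,
    projIcc_of_mem zero_le_one hs', Subtype.mk.injEq]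

theorem annulus_interior : annulusModel.interior Annulus = {p | (p.2 : ℝ) ∈ Ioo (0 : ℝ) 1} := by
  have h := boundary_product (x := (0 : ℝ)) (y := 1) (M := Circle) (𝓡 1)
  rw [← ModelWithCorners.compl_boundary, h]
  ext p
  have h1 := p.2.2.1
  have h2 := p.2.2.2
  have : p ∈ (univ : Set Circle).prod ({⊥, ⊤} : Set (Icc (0 : ℝ) 1)) ↔
      (p.2 = ⊥ ∨ p.2 = ⊤) := by
    change (p.1 ∈ univ ∧ p.2 ∈ ({⊥, ⊤} : Set (Icc (0 : ℝ) 1))) ↔ _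
    simp
  rw [mem_compl_iff, this, Subtype.ext_iff, Subtype.ext_iff]
  change ¬ ((p.2 : ℝ) = 0 ∨ (p.2 : ℝ) = 1) ↔ (0 < (p.2 : ℝ) ∧ (p.2 : ℝ) < 1)
  push Not
  exact ⟨fun h => ⟨lt_of_le_of_ne h1 h.1.symm, lt_of_le_of_ne h2 h.2⟩,
    fun h => ⟨h.1.ne', h.2.ne⟩⟩

theorem annulus_boundary :
    annulusModel.boundary Annulus = {p | (p.2 : ℝ) = 0 ∨ (p.2 : ℝ) = 1} := by
  have h := boundary_product (x := (0 : ℝ)) (y := 1) (M := Circle) (𝓡 1)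
  rw [h]
  ext p
  have : p ∈ (univ : Set Circle).prod ({⊥, ⊤} : Set (Icc (0 : ℝ) 1)) ↔
      (p.2 = ⊥ ∨ p.2 = ⊤) := by
    change (p.1 ∈ univ ∧ p.2 ∈ ({⊥, ⊤} : Set (Icc (0 : ℝ) 1))) ↔ _
    simp
  rw [this, Subtype.ext_iff, Subtype.ext_iff]
  rfl

theorem exists_annulusParam_eq (p : Annulus) : ∃ t, annulusParam (t, (p.2 : ℝ)) = p := by
  refine ⟨Complex.arg p.1, ?_⟩
  simp [annulusParam, Circle.exp_arg]

theorem strip_mem_nhds {t s : ℝ} (hs : s ∈ Ioo (0 : ℝ) 1) : strip ∈ 𝓝 (t, s) :=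
  prod_mem_nhds univ_mem (Icc_mem_nhds hs.1 hs.2)

variable [IsManifold (𝓡 3) ∞ M]

omit [IsManifold (𝓡 3) ∞ M] in
-- The embedding of a page does not say which end of the annulus goes to which component of the
-- binding; reversing the interval allows either choice.
theorem IsPageParam.flip {B : Set M} {π : M → Circle} {θ : Circle} {J : ℝ × ℝ → M}
    (h : IsPageParam B π θ J) : IsPageParam B π θ (fun x => J (x.1, 1 - x.2)) := by
  have hmap : ∀ x : ℝ × ℝ, x ∈ strip → (x.1, 1 - x.2) ∈ strip := by
    rintro ⟨t, s⟩ ⟨-, h1, h2⟩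
    exact ⟨mem_univ _, by simpa using h2, by simpa using h1⟩
  have hfl : ContDiff ℝ ∞ (fun x : ℝ × ℝ => (x.1, 1 - x.2)) := by fun_prop
  have hd : ∀ x : ℝ × ℝ, HasFDerivAt (fun x : ℝ × ℝ => (x.1, 1 - x.2))
      ((ContinuousLinearMap.fst ℝ ℝ ℝ).prod (-ContinuousLinearMap.snd ℝ ℝ ℝ)) x := fun x =>
    hasFDerivAt_fst.prodMk (hasFDerivAt_snd.const_sub 1)
  have hIoo : ∀ s : ℝ, s ∈ Ioo (0 : ℝ) 1 → 1 - s ∈ Ioo (0 : ℝ) 1 := fun s hs =>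
    ⟨by linarith [hs.2], by linarith [hs.1]⟩
  have hIcc : ∀ s : ℝ, s ∈ Icc (0 : ℝ) 1 → 1 - s ∈ Icc (0 : ℝ) 1 := fun s hs =>
    ⟨by linarith [hs.2], by linarith [hs.1]⟩
  refine ⟨h.contMDiffOn.comp hfl.contMDiff.contMDiffOn fun x hx => hmap x hx, ?_, ?_, ?_, ?_, ?_⟩
  · intro x hx
    have h1 := ((h.contMDiffOn _ (hmap x hx)).mdifferentiableWithinAt
      (by simp)).hasMFDerivWithinAt.comp x (hd x).hasFDerivWithinAt.hasMFDerivWithinAt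
      (fun y hy => hmap y hy)
    have h2 := h1.mfderivWithin (uniqueDiffOn_strip x hx).uniqueMDiffWithinAt
    change Injective (mfderivWithin 𝓘(ℝ, ℝ × ℝ) (𝓡 3) (J ∘ fun x => (x.1, 1 - x.2)) strip x)
    rw [h2]
    refine (h.injective_mfderivWithin _ (hmap x hx)).comp ?_
    rintro ⟨a, b⟩ ⟨a', b'⟩ hab
    have h3 : a = a' := congrArg Prod.fst hab
    have h4 : -b = -b' := congrArg Prod.snd hab
    rw [h3, neg_injective h4]
  · intro t t' s hs s' hs'
    rw [h.eq_iff t t' _ (hIcc s hs) _ (hIcc s' hs')]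
    simp
  · intro x
    rw [h.mem_page]
    constructor
    · rintro ⟨t, s, hs, rfl⟩
      exact ⟨t, 1 - s, hIoo s hs, by simp⟩
    · rintro ⟨t, s, hs, rfl⟩
      exact ⟨t, 1 - s, hIoo s hs, rfl⟩
  · intro x
    rw [h.mem_binding]
    constructor
    · rintro ⟨t, s, hs, rfl⟩
      refine ⟨t, 1 - s, ?_, by simp⟩
      rcases hs with rfl | rfl <;> simp
    · rintro ⟨t, s, hs, rfl⟩
      refine ⟨t, 1 - s, ?_, rfl⟩
      rcases hs with rfl | rfl <;> simp
  · intro t s hs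
    obtain ⟨E, U, hU, hmem, hE, hinj, h0, hpr⟩ := h.chart t (1 - s) (hIoo s hs)
    have hΦ : ContDiff ℝ ∞ (fun x : ℝ × ℝ × ℝ => (x.1, x.2.1, 1 - x.2.2)) := by fun_prop
    have hΦd : HasFDerivAt (fun x : ℝ × ℝ × ℝ => (x.1, x.2.1, 1 - x.2.2))
        ((ContinuousLinearMap.fst ℝ ℝ (ℝ × ℝ)).prod
          (((ContinuousLinearMap.fst ℝ ℝ ℝ).prod (-ContinuousLinearMap.snd ℝ ℝ ℝ)).comp
            (ContinuousLinearMap.snd ℝ ℝ (ℝ × ℝ)))) ((0 : ℝ), t, s) :=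
      hasFDerivAt_fst.prodMk (HasFDerivAt.comp (g := fun x : ℝ × ℝ => (x.1, 1 - x.2))
        (f := Prod.snd) ((0 : ℝ), t, s) (hd (t, s)) hasFDerivAt_snd)
    refine ⟨E ∘ fun x => (x.1, x.2.1, 1 - x.2.2), (fun x => (x.1, x.2.1, 1 - x.2.2)) ⁻¹' U,
      hU.preimage hΦ.continuous, hmem, hE.comp hΦ.contMDiff.contMDiffOn fun x hx => hx, ?_, ?_, ?_⟩
    · have h1 := ((hE.contMDiffAt (hU.mem_nhds hmem)).mdifferentiableAt
        (by simp)).hasMFDerivAt.comp ((0 : ℝ), t, s) hΦd.hasMFDerivAt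
      rw [h1.mfderiv]
      refine hinj.comp ?_
      rintro ⟨a, b, c⟩ ⟨a', b', c'⟩ hab
      have h3 : a = a' := congrArg Prod.fst hab
      have h4 : b = b' := congrArg (fun z : ℝ × ℝ × ℝ => z.2.1) hab
      have h5 : -c = -c' := congrArg (fun z : ℝ × ℝ × ℝ => z.2.2) hab
      rw [h3, h4, neg_injective h5]
    · rintro ⟨t', s'⟩ hq
      have := h0 _ hq
      refine ⟨?_, this.2⟩
      have h2 := hIoo _ this.1
      simpa using h2
    · exact fun p hp => hpr _ hp

omit [IsManifold (𝓡 3) ∞ M] in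
-- The parametrization is the page embedding composed with that of the annulus. The local charts of
-- `M` come from a local trivialization of π: the base point is rotated and the fibre coordinate of
-- the page point is kept.
theorem IsOpenBook3.exists_isPageParam {B : Set M} {π : M → Circle}
    (hπ : IsOpenBook3 annulusModel Annulus B π) (θ : Circle) :
    ∃ J : ℝ × ℝ → M, IsPageParam B π θ J := by
  have : Fact ((0 : ℝ) < 1) := ⟨one_pos⟩
  obtain ⟨j, hj, hjB, hjint⟩ := hπ.page θ
  rw [annulus_boundary] at hjB
  rw [annulus_interior] at hjint
  have hsm : ContMDiffOn 𝓘(ℝ, ℝ × ℝ) (𝓡 3) ∞ (j ∘ annulusParam) strip :=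
    hj.contMDiff.comp_contMDiffOn contMDiffOn_annulusParam
  have hinj : ∀ x ∈ strip,
      Injective (mfderivWithin 𝓘(ℝ, ℝ × ℝ) (𝓡 3) (j ∘ annulusParam) strip x) := fun x hx =>
    injective_mfderivWithin_of_isImmersionAt (uniqueDiffOn_strip x hx)
      (hj.isImmersion.isImmersionAt _) (contMDiffOn_annulusParam x hx) contMDiff_annulusCoord
      (injective_fderivWithin_annulusCoord hx)
  have hpage : ∀ x, (x ∉ B ∧ π x = θ) ↔ ∃ t, ∃ s ∈ Ioo (0 : ℝ) 1,
      (j ∘ annulusParam) (t, s) = x := by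
    intro x
    change x ∈ {x | x ∉ B ∧ π x = θ} ↔ _
    rw [← hjint]
    constructor
    · rintro ⟨p, hp, rfl⟩
      obtain ⟨t, ht⟩ := exists_annulusParam_eq p
      exact ⟨t, p.2, hp, by simp [ht]⟩
    · rintro ⟨t, s, hs, rfl⟩
      refine ⟨annulusParam (t, s), ?_, rfl⟩
      change (projIcc (0 : ℝ) 1 zero_le_one s : ℝ) ∈ Ioo (0 : ℝ) 1
      rwa [projIcc_of_mem zero_le_one (Ioo_subset_Icc_self hs)]
  refine ⟨j ∘ annulusParam, hsm, hinj, ?_, hpage, ?_, ?_⟩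
  · intro t t' s hs s' hs'
    rw [comp_apply, comp_apply, hj.isEmbedding.injective.eq_iff, annulusParam_eq_iff hs hs']
  · intro x
    rw [← hjB]
    constructor
    · rintro ⟨p, hp, rfl⟩
      obtain ⟨t, ht⟩ := exists_annulusParam_eq p
      exact ⟨t, p.2, hp, by simp [ht]⟩
    · rintro ⟨t, s, hs, rfl⟩
      refine ⟨annulusParam (t, s), ?_, rfl⟩
      rcases hs with rfl | rfl <;> simp [annulusParam]
  · intro t s hs
    obtain ⟨U, hU, hθU, e, hes, het, he1, he2, he3⟩ := hπ.locally_trivial θ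
    rw [annulus_interior] at hes
    set J := j ∘ annulusParam with hJ
    have hJt : ∀ q : ℝ × ℝ, q.2 ∈ Ioo (0 : ℝ) 1 → J q ∈ e.target := by
      intro q hq
      have := (hpage (J q)).2 ⟨q.1, q.2, hq, rfl⟩
      rw [het]
      exact ⟨this.1, by rw [this.2]; exact hθU⟩
    have hJ1 : ∀ q : ℝ × ℝ, q.2 ∈ Ioo (0 : ℝ) 1 → (e.symm (J q)).1 = θ := by
      intro q hq
      rw [← he3 _ (e.map_target (hJt q hq)), e.right_inv (hJt q hq)]
      exact ((hpage (J q)).2 ⟨q.1, q.2, hq, rfl⟩).2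
    let W : Set (ℝ × ℝ × ℝ) := {p | p.2.2 ∈ Ioo (0 : ℝ) 1 ∧ θ * Circle.exp p.1 ∈ U}
    have hW : IsOpen W := by
      refine (isOpen_Ioo.preimage (by fun_prop)).inter (hU.preimage ?_)
      fun_prop
    let c : ℝ × ℝ × ℝ → Circle × Annulus := fun p => (θ * Circle.exp p.1, (e.symm (J p.2)).2)
    have hcs : ∀ p ∈ W, c p ∈ e.source := by
      intro p hp
      have := e.map_target (hJt p.2 hp.1)
      rw [hes] at this ⊢
      exact ⟨hp.2, this.2⟩
    have hc : ContMDiffOn 𝓘(ℝ, ℝ × ℝ × ℝ) ((𝓡 1).prod annulusModel) ∞ c W := by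
      have h1 : ContMDiff 𝓘(ℝ, ℝ × ℝ × ℝ) 𝓘(ℝ, ℝ) ∞ (Prod.fst : ℝ × ℝ × ℝ → ℝ) :=
        contDiff_fst.contMDiff
      have h2 : ContMDiff 𝓘(ℝ, ℝ × ℝ × ℝ) 𝓘(ℝ, ℝ × ℝ) ∞ (Prod.snd : ℝ × ℝ × ℝ → ℝ × ℝ) :=
        contDiff_snd.contMDiff
      have h3 : ContMDiff (𝓡 1) (𝓡 1) ∞ (fun z : Circle => θ * z) := contMDiff_mul_left
      refine (h3.comp (contMDiff_circleExp.comp h1)).contMDiffOn.prodMk ?_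
      have h4 : ContMDiff ((𝓡 1).prod annulusModel) annulusModel ∞
        (Prod.snd : Circle × Annulus → Annulus) := contMDiff_snd
      refine h4.comp_contMDiffOn ?_
      refine he2.comp (hsm.comp h2.contMDiffOn (s := W) fun p hp => ⟨mem_univ _,
        Ioo_subset_Icc_self hp.1⟩) fun p hp => hJt p.2 hp.1
    have hEs : ContMDiffOn 𝓘(ℝ, ℝ × ℝ × ℝ) (𝓡 3) ∞ (e ∘ c) W := he1.comp hc hcs
    have h0W : ((0 : ℝ), t, s) ∈ W := ⟨hs, by simpa using hθU⟩
    have hE0 : ∀ q : ℝ × ℝ, q.2 ∈ Ioo (0 : ℝ) 1 → (e ∘ c) (0, q) = J q := by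
      intro q hq
      have : c (0, q) = e.symm (J q) := by
        refine Prod.ext ?_ rfl
        simp [c, hJ1 q hq]
      rw [comp_apply, this, e.right_inv (hJt q hq)]
    have hEp : ∀ p ∈ W, (e ∘ c) p ∉ B ∧ π ((e ∘ c) p) = θ * Circle.exp p.1 := by
      intro p hp
      refine ⟨?_, he3 _ (hcs p hp)⟩
      have := e.map_source (hcs p hp)
      rw [het] at this
      exact this.1
    refine ⟨e ∘ c, W, hW, h0W, hEs, ?_, fun q hq => ⟨hq.1, hE0 q hq.1⟩, hEp⟩
    -- A tangent vector (a, w) in the kernel has a = 0 because π ∘ E is θ exp(ia), which has nonzero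
    -- derivative in the first variable; then w = 0 because E restricted to {0} × ℝ² is the immersed
    -- page.
    refine (injective_iff_map_eq_zero _).2 ?_
    rintro ⟨a, w⟩ hv
    have hEd := ((hEs.contMDiffAt (hW.mem_nhds h0W)).mdifferentiableAt
      (by simp)).hasMFDerivAt
    have hB : IsOpen Bᶜ := hπ.isClosed_binding.isOpen_compl
    have hπs : ContMDiffOn (𝓡 3) 𝓘(ℝ, ℂ) ∞ (fun x => (π x : ℂ)) Bᶜ :=
      contMDiff_coe_circle.comp_contMDiffOn hπ.contMDiffOn_proj
    have hπd := ((hπs.contMDiffAt (hB.mem_nhds (hEp _ h0W).1)).mdifferentiableAt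
      (by simp)).hasMFDerivAt
    have ha : a = 0 := by
      have h1 := hπd.comp ((0 : ℝ), t, s) hEd
      have h2 : HasFDerivAt (fun p : ℝ × ℝ × ℝ => (θ : ℂ) * Complex.exp (p.1 * Complex.I))
          ((((1 : ℝ →L[ℝ] ℝ).smulRight ((θ : ℂ) * Complex.I))).comp
            (ContinuousLinearMap.fst ℝ ℝ (ℝ × ℝ))) ((0 : ℝ), t, s) := by
        have h0 : HasDerivAt (fun t : ℝ => (θ : ℂ) * Complex.exp (t * Complex.I))
            ((θ : ℂ) * Complex.I) (0 : ℝ) := by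
          have := (((hasDerivAt_id (0 : ℝ)).ofReal_comp.mul_const Complex.I).cexp).const_mul
            (θ : ℂ)
          simpa using this
        exact HasFDerivAt.comp (g := fun t : ℝ => (θ : ℂ) * Complex.exp (t * Complex.I))
          (f := Prod.fst) ((0 : ℝ), t, s) h0.hasFDerivAt hasFDerivAt_fst
      have h3 := h1.congr_of_eventuallyEq (f₁ := fun p : ℝ × ℝ × ℝ =>
        (θ : ℂ) * Complex.exp (p.1 * Complex.I)) (by
          filter_upwards [hW.mem_nhds h0W] with p hp
          rw [comp_apply, (hEp p hp).2, Circle.coe_mul, Circle.coe_exp])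
      have h4 := hasMFDerivAt_unique h3 h2.hasMFDerivAt
      have h5 : mfderiv (𝓡 3) 𝓘(ℝ, ℂ) (fun x => (π x : ℂ)) ((e ∘ c) (0, t, s))
          (mfderiv 𝓘(ℝ, ℝ × ℝ × ℝ) (𝓡 3) (e ∘ c) (0, t, s) (a, w)) = (a : ℂ) *
          ((θ : ℂ) * Complex.I) := by
        refine (DFunLike.congr_fun h4 (a, w)).trans ?_
        exact Complex.real_smul
      rw [hv, map_zero] at h5
      have h6 : (a : ℂ) * ((θ : ℂ) * Complex.I) = 0 := h5.symm
      exact_mod_cast (mul_eq_zero.1 h6).resolve_right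
        (mul_ne_zero (Circle.coe_ne_zero θ) Complex.I_ne_zero)
    subst ha
    have hi : HasFDerivAt (fun q : ℝ × ℝ => ((0 : ℝ), q))
        (ContinuousLinearMap.inr ℝ ℝ (ℝ × ℝ)) (t, s) := hasFDerivAt_prodMk_right _ _
    have h1 := hEd.comp (t, s) hi.hasMFDerivAt
    have hJd := (hsm (t, s) (mem_of_mem_nhds (strip_mem_nhds hs))).mdifferentiableWithinAt (by simp)
      |>.hasMFDerivWithinAt.hasMFDerivAt (strip_mem_nhds hs)
    have h2 := h1.congr_of_eventuallyEq (f₁ := J) (by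
      have : ∀ᶠ q : ℝ × ℝ in 𝓝 (t, s), q.2 ∈ Ioo (0 : ℝ) 1 :=
        (continuous_snd.tendsto _) (isOpen_Ioo.mem_nhds hs)
      filter_upwards [this] with q hq
      exact (hE0 q hq).symm)
    have h3 := hasMFDerivAt_unique hJd h2
    have h4 := hinj (t, s) (mem_of_mem_nhds (strip_mem_nhds hs))
    have h5 : w = 0 := by
      apply h4
      exact ((DFunLike.congr_fun h3 w).trans hv).trans
        (map_zero (mfderivWithin 𝓘(ℝ, ℝ × ℝ) (𝓡 3) J strip (t, s))).symm
    rw [h5]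
    rfl

end

/-! ### Collars of the two binding components -/

section

section Kernel

variable {E₁ H₁ M₁ E₂ H₂ M₂ E₃ H₃ M₃ : Type*}
  [NormedAddCommGroup E₁] [NormedSpace ℝ E₁] [TopologicalSpace H₁]
  {I₁ : ModelWithCorners ℝ E₁ H₁} [TopologicalSpace M₁] [ChartedSpace H₁ M₁]
  [NormedAddCommGroup E₂] [NormedSpace ℝ E₂] [TopologicalSpace H₂]
  {I₂ : ModelWithCorners ℝ E₂ H₂} [TopologicalSpace M₂] [ChartedSpace H₂ M₂]
  [NormedAddCommGroup E₃] [NormedSpace ℝ E₃] [TopologicalSpace H₃]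
  {I₃ : ModelWithCorners ℝ E₃ H₃} [TopologicalSpace M₃] [ChartedSpace H₃ M₃]

/-- A vector killed by the derivative of `f` is killed by the derivative of any `g ∘ f`. -/
theorem HasMFDerivAt.apply_eq_zero_of_comp {f : M₁ → M₂} {g : M₂ → M₃} {k : M₁ → M₃} {x : M₁}
    {f' : TangentSpace I₁ x →L[ℝ] TangentSpace I₂ (f x)}
    {k' : TangentSpace I₁ x →L[ℝ] TangentSpace I₃ (k x)}
    (hk : HasMFDerivAt I₁ I₃ k x k') (hf : HasMFDerivAt I₁ I₂ f x f')
    (hg : MDifferentiableAt I₂ I₃ g (f x)) (h : k =ᶠ[𝓝 x] g ∘ f) {v : TangentSpace I₁ x}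
    (hv : f' v = 0) : k' v = 0 := by
  have h1 := (hg.hasMFDerivAt.comp x hf).congr_of_eventuallyEq h
  have h2 := hasMFDerivAt_unique hk h1
  refine (DFunLike.congr_fun h2 v).trans ?_
  exact (congrArg (fun z => mfderiv I₂ I₃ g (f x) z) hv).trans (map_zero (mfderiv I₂ I₃ g (f x)))

end Kernel

variable {M : Type*} [TopologicalSpace M] [ChartedSpace (EuclideanSpace ℝ (Fin 3)) M]

/-- Two tubular neighbourhoods `T true`, `T false`, read modulo `2π` in the first variable, of the
two components of `B`, whose normal angular coordinate is `π`. -/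
structure IsCollars (B : Set M) (π : M → Circle) (T : Bool → ℝ × ℂ → M) : Prop where
  contMDiff : ∀ i, ContMDiff 𝓘(ℝ, ℝ × ℂ) (𝓡 3) ∞ (T i)
  injective_mfderiv : ∀ i p, Injective (mfderiv 𝓘(ℝ, ℝ × ℂ) (𝓡 3) (T i) p)
  eq_iff : ∀ i j t t' z z', T i (t, z) = T j (t', z') ↔
    i = j ∧ Circle.exp t = Circle.exp t' ∧ z = z'
  mem_binding : ∀ x, x ∈ B ↔ ∃ i t, T i (t, 0) = x
  proj : ∀ i t z, z ≠ 0 → π (T i (t, z)) = angle z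

/-- The parameter of an end of the interval. -/
def endParam (i : Bool) : ℝ := if i then 0 else 1

theorem endParam_mem (i : Bool) : endParam i ∈ Icc (0 : ℝ) 1 := by
  cases i <;> simp [endParam]

theorem endParam_inj {i j : Bool} : endParam i = endParam j ↔ i = j := by
  cases i <;> cases j <;> simp [endParam]

theorem IsPageParam.contMDiff_end {B : Set M} {π : M → Circle} {θ : Circle} {J : ℝ × ℝ → M}
    (h : IsPageParam B π θ J) {s : ℝ} (hs : s ∈ Icc (0 : ℝ) 1) :
    ContMDiff 𝓘(ℝ, ℝ) (𝓡 3) ∞ (fun t => J (t, s)) := by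
  have h1 : ContMDiff 𝓘(ℝ, ℝ) 𝓘(ℝ, ℝ × ℝ) ∞ (fun t : ℝ => (t, s)) :=
    (contDiff_prodMk_left s).contMDiff
  rw [← contMDiffOn_univ]
  exact h.contMDiffOn.comp h1.contMDiffOn fun t _ => ⟨mem_univ _, hs⟩

theorem IsPageParam.injective_mfderiv_end {B : Set M} {π : M → Circle} {θ : Circle}
    {J : ℝ × ℝ → M} (h : IsPageParam B π θ J) {s : ℝ} (hs : s ∈ Icc (0 : ℝ) 1) (t : ℝ) :
    Injective (mfderiv 𝓘(ℝ, ℝ) (𝓡 3) (fun t => J (t, s)) t) := by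
  have hx : (t, s) ∈ strip := ⟨mem_univ _, hs⟩
  have h1 := ((h.contMDiffOn _ hx).mdifferentiableWithinAt (by simp)).hasMFDerivWithinAt
  have hi : HasFDerivAt (fun t : ℝ => (t, s)) (ContinuousLinearMap.inl ℝ ℝ ℝ) t :=
    hasFDerivAt_prodMk_left _ _
  have hm : ∀ t' : ℝ, (t', s) ∈ strip := fun t' => ⟨mem_univ _, hs⟩
  have h2 := h1.comp t (hi.hasFDerivWithinAt (s := univ)).hasMFDerivWithinAt (fun t' _ => hm t')
  rw [hasMFDerivWithinAt_univ] at h2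
  have h3 : mfderiv 𝓘(ℝ, ℝ) (𝓡 3) (fun t => J (t, s)) t = _ := h2.mfderiv
  rw [h3]
  refine (h.injective_mfderivWithin _ hx).comp ?_
  intro a b hab
  exact congrArg Prod.fst hab

variable [IsManifold (𝓡 3) ∞ M]

omit [IsManifold (𝓡 3) ∞ M] in
-- The factor `L` of the tubular neighbourhood is an abstract 1-manifold, but one page suffices to
-- recognize it: its two boundary circles parametrize the binding, and lifting them through τ gives
-- the longitudinal coordinates γ. No classification of 1-manifolds is needed.
theorem IsPageParam.exists_isCollars {B : Set M} {π : M → Circle} {θ : Circle} {J : ℝ × ℝ → M}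
    (h : IsPageParam B π θ J) (hA : HasAngularNeighbourhood B π) : ∃ T, IsCollars B π T := by
  obtain ⟨L, _, _, _, τ, hτ, hinj, himg, hpr⟩ := hA
  have hex : ∀ i t, ∃ l, τ (l, 0) = J (t, endParam i) := by
    intro i t
    have : J (t, endParam i) ∈ τ '' {p | p.2 = 0} := by
      rw [himg, h.mem_binding]
      exact ⟨t, endParam i, by cases i <;> simp [endParam], rfl⟩
    obtain ⟨⟨l, z⟩, hz, hl⟩ := this
    obtain rfl : z = 0 := hz
    exact ⟨l, hl⟩
  choose γ hγ using hex
  have hτs : ContMDiff ((𝓡 1).prod 𝓘(ℝ, ℂ)) (𝓡 3) ∞ τ := hτ.contMDiff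
  have hinv : ∀ p : L × ℂ, ∃ (N : Set M) (g : M → L × ℂ), IsOpen N ∧ τ p ∈ N ∧
      ContMDiffOn (𝓡 3) ((𝓡 1).prod 𝓘(ℝ, ℂ)) ∞ g N ∧ ∀ q, τ q ∈ N → g (τ q) = q := by
    intro p
    obtain ⟨Φ, hp, hΦ⟩ := hτ p
    refine ⟨Φ.target, Φ.symm, Φ.open_target, ?_, Φ.contMDiffOn_invFun, ?_⟩
    · rw [hΦ hp]
      exact Φ.map_source hp
    · intro q hq
      apply hinj
      exact (hΦ (Φ.toPartialEquiv.map_target hq)).trans (Φ.toPartialEquiv.right_inv hq)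
  -- The lift γ is chosen pointwise; it is smooth because τ has smooth local inverses, through which
  -- γ is read off from the smooth curve in the page boundary.
  have hγs : ∀ i, ContMDiff 𝓘(ℝ, ℝ) (𝓡 1) ∞ (γ i) := by
    intro i t
    obtain ⟨N, g, hN, hmem, hg, hgτ⟩ := hinv (γ i t, 0)
    rw [hγ] at hmem
    have hJs := h.contMDiff_end (endParam_mem i)
    have h1 : ContMDiffAt 𝓘(ℝ, ℝ) ((𝓡 1).prod 𝓘(ℝ, ℂ)) ∞ (g ∘ fun t => J (t, endParam i)) t :=
      (hg.contMDiffAt (hN.mem_nhds hmem)).comp t (hJs t)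
    have h2 := (contMDiff_fst (I := 𝓡 1) (J := 𝓘(ℝ, ℂ)) (M := L) (N := ℂ)
      (n := ∞) _).comp t h1
    refine h2.congr_of_eventuallyEq ?_
    filter_upwards [hJs.continuous.continuousAt (hN.mem_nhds hmem)] with t' ht'
    have h3 : τ (γ i t', 0) ∈ N := by rw [hγ]; exact ht'
    have h4 := hgτ _ h3
    rw [hγ] at h4
    simp [h4]
  have hTs : ∀ i, ContMDiff 𝓘(ℝ, ℝ × ℂ) (𝓡 3) ∞ (fun p : ℝ × ℂ => τ (γ i p.1, p.2)) := by
    intro i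
    have h1 : ContMDiff 𝓘(ℝ, ℝ × ℂ) 𝓘(ℝ, ℝ) ∞ (Prod.fst : ℝ × ℂ → ℝ) := contDiff_fst.contMDiff
    have h2 : ContMDiff 𝓘(ℝ, ℝ × ℂ) 𝓘(ℝ, ℂ) ∞ (Prod.snd : ℝ × ℂ → ℂ) := contDiff_snd.contMDiff
    exact hτs.comp (((hγs i).comp h1).prodMk h2)
  refine ⟨fun i p => τ (γ i p.1, p.2), hTs, ?_, ?_, ?_, fun i t z hz => hpr _ _ hz⟩
  · rintro i ⟨t, z⟩
    obtain ⟨N, g, hN, hmem, hg, hgτ⟩ := hinv (γ i t, z)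
    have hTd := ((hTs i (t, z)).mdifferentiableAt (by simp)).hasMFDerivAt
    have hgN := hg.contMDiffAt (hN.mem_nhds hmem)
    have hev : ∀ᶠ p : ℝ × ℂ in 𝓝 (t, z), g (τ (γ i p.1, p.2)) = (γ i p.1, p.2) := by
      filter_upwards [(hTs i).continuous.continuousAt (hN.mem_nhds hmem)] with p hp
      exact hgτ _ hp
    refine (injective_iff_map_eq_zero _).2 ?_
    rintro ⟨a, w⟩ hv
    have hw : w = 0 := by
      have h1 : ContMDiffAt (𝓡 3) 𝓘(ℝ, ℂ) ∞ (fun x => (g x).2) (τ (γ i t, z)) :=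
        (contMDiff_snd (I := 𝓡 1) (J := 𝓘(ℝ, ℂ)) (M := L) (N := ℂ) (n := ∞) _).comp _ hgN
      exact (hasFDerivAt_snd (𝕜 := ℝ) (p := (t, z)) (E := ℝ) (F := ℂ)).hasMFDerivAt
        |>.apply_eq_zero_of_comp (g := fun x => (g x).2) hTd (h1.mdifferentiableAt (by simp)) (by
          filter_upwards [hev] with p hp
          simp [hp]) hv
    -- Forgetting z and applying τ again recovers the boundary curve of the page, whose velocity is
    -- nonzero.
    have ha : a = 0 := by
      have h0 : ContMDiff (𝓡 1) ((𝓡 1).prod 𝓘(ℝ, ℂ)) ∞ (fun l : L => (l, (0 : ℂ))) :=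
        contMDiff_id.prodMk contMDiff_const
      have h1 : ContMDiffAt (𝓡 3) (𝓡 3) ∞ (fun x => τ ((g x).1, 0)) (τ (γ i t, z)) :=
        (hτs.comp h0).contMDiffAt.comp _
          ((contMDiff_fst (I := 𝓡 1) (J := 𝓘(ℝ, ℂ)) (M := L) (N := ℂ) (n := ∞) _).comp _ hgN)
      have hJs := ((h.contMDiff_end (endParam_mem i) t).mdifferentiableAt (by simp)).hasMFDerivAt
      have hJ2 := HasMFDerivAt.comp (g := fun t => J (t, endParam i)) (f := (Prod.fst : ℝ × ℂ → ℝ))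
        (t, z) hJs (hasFDerivAt_fst (𝕜 := ℝ) (p := (t, z)) (E := ℝ) (F := ℂ)).hasMFDerivAt
      have h5 := hJ2.apply_eq_zero_of_comp hTd (h1.mdifferentiableAt (by simp)) (by
        filter_upwards [hev] with p hp
        simp [hp, hγ]) hv
      exact h.injective_mfderiv_end (endParam_mem i) t (h5.trans (map_zero _).symm)
    rw [hw, ha]
    rfl
  · intro i j t t' z z'
    have h1 := h.eq_iff t t' _ (endParam_mem i) _ (endParam_mem j)
    rw [endParam_inj, ← hγ, ← hγ, hinj.eq_iff] at h1
    simp only [Prod.mk.injEq, and_true] at h1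
    simp only [hinj.eq_iff, Prod.mk.injEq, h1]
    tauto
  · intro x
    simp only [hγ]
    rw [h.mem_binding]
    constructor
    · rintro ⟨t, s, rfl | rfl, hx⟩
      · exact ⟨true, t, by simpa [endParam] using hx⟩
      · exact ⟨false, t, by simpa [endParam] using hx⟩
    · rintro ⟨i, t, hx⟩
      exact ⟨t, endParam i, by cases i <;> simp [endParam], hx⟩

/-- Parametrizations are periodic in the first variable, and this reduces uniform statements to a
compact interval. -/
theorem exists_mem_Icc_circleExp_eq (t : ℝ) :
    ∃ t' ∈ Icc 0 (2 * Real.pi), Circle.exp t' = Circle.exp t := by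
  refine ⟨toIcoMod Real.two_pi_pos 0 t, ?_, ?_⟩
  · have := toIcoMod_mem_Ico Real.two_pi_pos 0 t
    rw [zero_add] at this
    exact Ico_subset_Icc_self this
  · rw [Circle.exp_eq_exp]
    refine ⟨-toIcoDiv Real.two_pi_pos 0 t, ?_⟩
    have := self_sub_toIcoDiv_zsmul Real.two_pi_pos 0 t
    rw [← this]
    push_cast [zsmul_eq_mul]
    ring

namespace IsCollars

variable {B : Set M} {π : M → Circle} {T : Bool → ℝ × ℂ → M}

omit [IsManifold (𝓡 3) ∞ M] in
theorem congr_exp (hT : IsCollars B π T) (i : Bool) {t t' : ℝ} (h : Circle.exp t = Circle.exp t')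
    (z : ℂ) : T i (t, z) = T i (t', z) := (hT.eq_iff _ _ _ _ _ _).2 ⟨rfl, h, rfl⟩

omit [IsManifold (𝓡 3) ∞ M] in
theorem image_eq (hT : IsCollars B π T) (i : Bool) (S : Set ℂ) :
    T i '' {p | p.2 ∈ S} = T i '' (Icc 0 (2 * Real.pi) ×ˢ S) := by
  apply subset_antisymm
  · rintro _ ⟨⟨t, z⟩, hz, rfl⟩
    obtain ⟨t', ht', he⟩ := exists_mem_Icc_circleExp_eq t
    exact ⟨(t', z), ⟨ht', hz⟩, hT.congr_exp i he z⟩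
  · rintro _ ⟨⟨t, z⟩, hz, rfl⟩
    exact ⟨(t, z), hz.2, rfl⟩

omit [IsManifold (𝓡 3) ∞ M] in
theorem isCompact_image (hT : IsCollars B π T) (i : Bool) {S : Set ℂ} (hS : IsCompact S) :
    IsCompact (T i '' {p | p.2 ∈ S}) := by
  rw [hT.image_eq]
  exact (isCompact_Icc.prod hS).image (hT.contMDiff i).continuous

omit [IsManifold (𝓡 3) ∞ M] in
/-- Every page has a parametrization starting at a given component of the binding. -/
theorem exists_isPageParam [T2Space M] (hT : IsCollars B π T)
    (hπ : IsOpenBook3 annulusModel Annulus B π) (θ : Circle) (i : Bool) :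
    ∃ J, IsPageParam B π θ J ∧ (∀ t, ∃ t', J (t, 0) = T i (t', 0)) ∧
      ∀ t, ∃ t', J (t, 1) = T (!i) (t', 0) := by
  obtain ⟨J, hJ⟩ := hπ.exists_isPageParam θ
  let Bc : Bool → Set M := fun i => T i '' {p | p.2 ∈ ({0} : Set ℂ)}
  have hBc : ∀ i, IsClosed (Bc i) := fun i => (hT.isCompact_image i isCompact_singleton).isClosed
  have hmem : ∀ i x, x ∈ Bc i ↔ ∃ t, x = T i (t, 0) := by
    intro i x
    constructor
    · rintro ⟨⟨t, z⟩, hz, rfl⟩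
      obtain rfl : z = 0 := hz
      exact ⟨t, rfl⟩
    · rintro ⟨t, rfl⟩
      exact ⟨(t, 0), rfl, rfl⟩
  have hdisj : ∀ i x, x ∈ Bc i → x ∉ Bc (!i) := by
    intro i x h1 h2
    obtain ⟨t, rfl⟩ := (hmem _ _).1 h1
    obtain ⟨t', h⟩ := (hmem _ _).1 h2
    have := ((hT.eq_iff _ _ _ _ _ _).1 h).1
    cases i <;> simp at this
  have hcov : ∀ e t, J (t, endParam e) ∈ Bc true ∪ Bc false := by
    intro e t
    have : J (t, endParam e) ∈ B := by
      rw [hJ.mem_binding]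
      exact ⟨t, endParam e, by cases e <;> simp [endParam], rfl⟩
    obtain ⟨i, t', h⟩ := (hT.mem_binding _).1 this
    cases i
    · exact Or.inr ((hmem _ _).2 ⟨t', h.symm⟩)
    · exact Or.inl ((hmem _ _).2 ⟨t', h.symm⟩)
  -- A boundary circle of the page is connected, and the two components of the binding are disjoint
  -- closed sets, so the circle lies in one of them.
  have hconn : ∀ e, ∃ i, ∀ t, J (t, endParam e) ∈ Bc i := by
    intro e
    have hp : IsPreconnected (range fun t => J (t, endParam e)) :=
      isPreconnected_range (hJ.contMDiff_end (endParam_mem e)).continuous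
    have := isPreconnected_iff_subset_of_disjoint_closed.1 hp _ _ (hBc true) (hBc false)
      (by rintro _ ⟨t, rfl⟩; exact hcov e t)
      (by
        apply eq_empty_of_forall_notMem
        rintro x ⟨-, h1, h2⟩
        exact hdisj _ _ h1 h2)
    rcases this with h | h
    · exact ⟨true, fun t => h ⟨t, rfl⟩⟩
    · exact ⟨false, fun t => h ⟨t, rfl⟩⟩
  obtain ⟨i₀, hi₀⟩ := hconn true
  obtain ⟨i₁, hi₁⟩ := hconn false
  simp only [endParam, if_true, Bool.false_eq_true, if_false] at hi₀ hi₁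
  -- If both ends lay in the same component, the other component, which is nonempty and contained in
  -- `B`, would not be covered by the ends of the page.
  have hne : i₁ = !i₀ := by
    by_contra hne
    have h01 : i₁ = i₀ := by cases i₀ <;> cases i₁ <;> simp_all
    subst h01
    have hB : T (!i₁) (0, 0) ∈ B := (hT.mem_binding _).2 ⟨_, _, rfl⟩
    have h1 : T (!i₁) (0, 0) ∈ Bc (!i₁) := (hmem _ _).2 ⟨0, rfl⟩
    obtain ⟨t, s, hs, h2⟩ := (hJ.mem_binding _).1 hB
    rw [← h2] at h1
    rcases hs with rfl | rfl
    · exact hdisj _ _ (hi₀ t) h1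
    · exact hdisj _ _ (hi₁ t) h1
  subst hne
  by_cases hi : i = i₀
  · subst hi
    exact ⟨J, hJ, fun t => (hmem _ _).1 (hi₀ t), fun t => (hmem _ _).1 (hi₁ t)⟩
  · have hi' : i = !i₀ := by cases i <;> cases i₀ <;> simp_all
    subst hi'
    refine ⟨_, hJ.flip, fun t => ?_, fun t => ?_⟩
    · simpa using (hmem _ _).1 (hi₁ t)
    · simpa using (hmem _ _).1 (hi₀ t)

omit [IsManifold (𝓡 3) ∞ M] in
theorem _root_.IsOpenBook3.exists_isCollars
    (hπ : IsOpenBook3 annulusModel Annulus B π) : ∃ T, IsCollars B π T := by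
  obtain ⟨J, hJ⟩ := hπ.exists_isPageParam 1
  exact hJ.exists_isCollars hπ.angular

end IsCollars

end

/-! ### Collar coordinates, the defining function, and gluing off the binding -/

section

variable {M : Type*} [TopologicalSpace M] [ChartedSpace (EuclideanSpace ℝ (Fin 3)) M]

/-- The coordinates `(exp (i t), z)` of the point `T (t, z)`. -/
def collarCoord (T : ℝ × ℂ → M) (x : M) : ℂ × ℂ :=
  open scoped Classical in
  if h : ∃ p, T p = x then (Circle.exp h.choose.1, h.choose.2) else 0

namespace IsCollars

variable {B : Set M} {π : M → Circle} {T : Bool → ℝ × ℂ → M}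

theorem coord_apply (hT : IsCollars B π T) (i : Bool) (t : ℝ) (z : ℂ) :
    collarCoord (T i) (T i (t, z)) = (↑(Circle.exp t), z) := by
  have h : ∃ p, T i p = T i (t, z) := ⟨_, rfl⟩
  rw [collarCoord, dif_pos h]
  have h1 := (hT.eq_iff i i h.choose.1 t h.choose.2 z).1 h.choose_spec
  rw [h1.2.1, h1.2.2]

theorem proj_eq (hT : IsCollars B π T) (i : Bool) (t : ℝ) (z : ℂ) (hz : z ≠ 0) :
    z = ‖z‖ * (π (T i (t, z)) : ℂ) := by
  rw [hT.proj i t z hz, norm_mul_angle]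

theorem not_mem_binding (hT : IsCollars B π T) {i : Bool} {t : ℝ} {z : ℂ} :
    T i (t, z) ∉ B ↔ z ≠ 0 := by
  rw [hT.mem_binding, not_iff_not]
  constructor
  · rintro ⟨j, t', h⟩
    exact ((hT.eq_iff _ _ _ _ _ _).1 h).2.2.symm
  · rintro rfl
    exact ⟨i, t, rfl⟩

theorem isClosed_image [T2Space M] (hT : IsCollars B π T) (i : Bool) (r : ℝ) :
    IsClosed (T i '' {p | ‖p.2‖ ≤ r}) := by
  have := (hT.isCompact_image i (isCompact_closedBall (0 : ℂ) r)).isClosed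
  simpa using this

variable [IsManifold (𝓡 3) ∞ M]

theorem exists_localInverse (hT : IsCollars B π T) (i : Bool) (p : ℝ × ℂ) :
    ∃ (N : Set M) (g : M → ℝ × ℂ), IsOpen N ∧ T i p ∈ N ∧
      ContMDiffOn (𝓡 3) 𝓘(ℝ, ℝ × ℂ) ∞ g N ∧ g (T i p) = p ∧ (∀ y ∈ N, T i (g y) = y) ∧
      ∀ᶠ q in 𝓝 p, g (T i q) = q := by
  have hd : finrank ℝ (ℝ × ℂ) = finrank ℝ (EuclideanSpace ℝ (Fin 3)) := by simp
  obtain ⟨N, g, hN, hmem, hg, hgp, h1, h2⟩ := exists_localInverse_of_injective_mfderiv hd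
    isOpen_univ (mem_univ p) (hT.contMDiff i).contMDiffOn (hT.injective_mfderiv i p)
  exact ⟨N, g, hN, hmem, hg, hgp, fun y hy => (h1 y hy).2, h2⟩

theorem isOpenMap (hT : IsCollars B π T) (i : Bool) : IsOpenMap (T i) := by
  rw [isOpenMap_iff_nhds_le]
  intro p S hS
  obtain ⟨N, g, hN, hmem, hg, hgp, h1, -⟩ := hT.exists_localInverse i p
  have hc := (hg.contMDiffAt (hN.mem_nhds hmem)).continuousAt
  rw [ContinuousAt, hgp] at hc
  filter_upwards [hc hS, hN.mem_nhds hmem] with y hy hyN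
  rw [← h1 y hyN]
  exact hy

theorem isOpen_image (hT : IsCollars B π T) (i : Bool) (r : ℝ) :
    IsOpen (T i '' {p | ‖p.2‖ < r}) :=
  hT.isOpenMap i _ (isOpen_lt (by fun_prop) (by fun_prop))

theorem contMDiffOn_coord (hT : IsCollars B π T) (i : Bool) :
    ContMDiffOn (𝓡 3) 𝓘(ℝ, ℂ × ℂ) ∞ (collarCoord (T i)) (range (T i)) := by
  rintro _ ⟨p, rfl⟩
  apply ContMDiffAt.contMDiffWithinAt
  obtain ⟨N, g, hN, hmem, hg, hgp, h1, -⟩ := hT.exists_localInverse i p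
  have hs : ContMDiff 𝓘(ℝ, ℝ × ℂ) 𝓘(ℝ, ℂ × ℂ) ∞
      (fun q : ℝ × ℂ => (Complex.exp (q.1 * Complex.I), q.2)) := by
    apply ContDiff.contMDiff
    have : ContDiff ℝ ∞ (fun q : ℝ × ℂ => (q.1 : ℂ)) :=
      Complex.ofRealCLM.contDiff.comp contDiff_fst
    fun_prop
  refine (hs.contMDiffAt.comp _ (hg.contMDiffAt (hN.mem_nhds hmem))).congr_of_eventuallyEq ?_
  filter_upwards [hN.mem_nhds hmem] with y hy
  have := hT.coord_apply i (g y).1 (g y).2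
  rw [Prod.mk.eta, h1 y hy] at this
  rw [this]
  simp [Circle.coe_exp]

omit [IsManifold (𝓡 3) ∞ M] in
/-- A compact set missing a component of the binding misses a neighbourhood of it. -/
theorem exists_radius (hT : IsCollars B π T) (i : Bool) {C : Set M} (hC : IsClosed C)
    (h : ∀ t, T i (t, 0) ∉ C) : ∃ ε > 0, ∀ t z, ‖z‖ ≤ ε → T i (t, z) ∉ C := by
  have h1 : ∀ t ∈ Icc 0 (2 * Real.pi), ∀ᶠ p : ℂ × ℝ in 𝓝 (0, t), T i (p.2, p.1) ∉ C := by
    intro t _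
    have hc : Continuous (fun p : ℂ × ℝ => T i (p.2, p.1)) :=
      (hT.contMDiff i).continuous.comp (by fun_prop)
    have h0 : (fun p : ℂ × ℝ => T i (p.2, p.1)) (0, t) ∈ Cᶜ := h t
    exact hc.continuousAt.eventually (hC.isOpen_compl.mem_nhds h0)
  have h2 := (isCompact_Icc (a := (0 : ℝ)) (b := 2 * Real.pi)).eventually_forall_of_forall_eventually
    (x₀ := (0 : ℂ)) (P := fun z t => T i (t, z) ∉ C) h1
  obtain ⟨ε, hε, h3⟩ := Metric.eventually_nhds_iff.1 h2
  refine ⟨ε / 2, by positivity, fun t z hz => ?_⟩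
  obtain ⟨t', ht', he⟩ := exists_mem_Icc_circleExp_eq t
  rw [hT.congr_exp i he.symm z]
  exact h3 (by simpa using by linarith) t' ht'

end IsCollars

theorem Manifold.surjective_mfderiv_of_injective {E H V : Type*} [NormedAddCommGroup E]
    [NormedSpace ℝ E] [FiniteDimensional ℝ E] [TopologicalSpace H] {I : ModelWithCorners ℝ E H}
    {N : Type*} [TopologicalSpace N] [ChartedSpace H N] [NormedAddCommGroup V] [NormedSpace ℝ V]
    [FiniteDimensional ℝ V] (hd : finrank ℝ V = finrank ℝ E) {f : V → N} {x : V}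
    (hinj : Injective (mfderiv 𝓘(ℝ, V) I f x)) : Surjective (mfderiv 𝓘(ℝ, V) I f x) := by
  let L : V →ₗ[ℝ] E := (mfderiv 𝓘(ℝ, V) I f x).toLinearMap
  exact (LinearMap.injective_iff_surjective_of_finrank_eq_finrank (f := L) hd).1 hinj

/-- `ζ` is a smooth complex function with zero set `B` and argument `π`, and equal to the normal
coordinate near `B`. -/
structure IsDefiningFun (B : Set M) (π : M → Circle) (T : Bool → ℝ × ℂ → M) (ζ : M → ℂ) :
    Prop where
  contMDiff : ContMDiff (𝓡 3) 𝓘(ℝ, ℂ) ∞ ζ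
  apply_collar : ∀ i t z, ‖z‖ ≤ 1 → ζ (T i (t, z)) = z
  ne_zero : ∀ x ∉ B, ζ x ≠ 0
  eq_mul : ∀ x ∉ B, ζ x = ‖ζ x‖ * (π x : ℂ)

variable {B : Set M} {π : M → Circle} {T : Bool → ℝ × ℂ → M}

/-- Being a positive multiple of π off `B`, and being equal to z on the unit collars, are convex
conditions on a value. Local solutions are z itself on the collars of radius 2 and π away from the
closed unit collars; a partition of unity glues them. -/
theorem IsCollars.exists_isDefiningFun [IsManifold (𝓡 3) ∞ M] [T2Space M] [CompactSpace M]
    (hT : IsCollars B π T)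
    (hπ : ContMDiffOn (𝓡 3) (𝓡 1) ∞ π Bᶜ) : ∃ ζ, IsDefiningFun B π T ζ := by
  let S : M → Set ℂ := fun x => {w | (∀ i t z, ‖z‖ ≤ 1 → T i (t, z) = x → w = z) ∧
    (x ∉ B → ∃ r : ℝ, 0 < r ∧ w = r * (π x : ℂ))}
  have hS : ∀ x, Convex ℝ (S x) := by
    rintro x w₁ ⟨h1, h2⟩ w₂ ⟨h3, h4⟩ a b ha hb hab
    refine ⟨fun i t z hz hx => ?_, fun hx => ?_⟩
    · rw [h1 i t z hz hx, h3 i t z hz hx, ← add_smul, hab, one_smul]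
    · obtain ⟨r₁, hr₁, rfl⟩ := h2 hx
      obtain ⟨r₂, hr₂, rfl⟩ := h4 hx
      refine ⟨a * r₁ + b * r₂, ?_, by simp only [Complex.real_smul]; push_cast; ring⟩
      rcases ha.eq_or_lt with rfl | ha
      · have : b = 1 := by linarith
        simp [this, hr₂]
      · have := mul_pos ha hr₁
        have := mul_nonneg hb hr₂.le
        linarith
  have hloc : ∀ x, ∃ U ∈ 𝓝 x, ∃ g : M → ℂ, ContMDiffOn (𝓡 3) 𝓘(ℝ, ℂ) ∞ g U ∧
      ∀ y ∈ U, g y ∈ S y := by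
    intro x
    by_cases hx : ∃ i t z, ‖z‖ ≤ 1 ∧ T i (t, z) = x
    · obtain ⟨i, t, z, hz, rfl⟩ := hx
      refine ⟨T i '' {p | ‖p.2‖ < 2}, (hT.isOpen_image i 2).mem_nhds
        ⟨(t, z), by simp only [mem_ofPred_eq]; linarith, rfl⟩,
        fun y => (collarCoord (T i) y).2, ?_, ?_⟩
      · have h2 : ContMDiff 𝓘(ℝ, ℂ × ℂ) 𝓘(ℝ, ℂ) ∞ (Prod.snd : ℂ × ℂ → ℂ) :=
          contDiff_snd.contMDiff
        exact h2.comp_contMDiffOn ((hT.contMDiffOn_coord i).mono (image_subset_range _ _))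
      · rintro _ ⟨⟨t', z'⟩, hz', rfl⟩
        simp only [S, hT.coord_apply, mem_ofPred_eq]
        refine ⟨fun j t'' z'' _ h => ((hT.eq_iff _ _ _ _ _ _).1 h).2.2.symm, fun h => ?_⟩
        rw [hT.not_mem_binding] at h
        exact ⟨‖z'‖, by simpa using h, hT.proj_eq _ _ _ h⟩
    · push Not at hx
      refine ⟨(T true '' {p | ‖p.2‖ ≤ 1} ∪ T false '' {p | ‖p.2‖ ≤ 1})ᶜ,
        (((hT.isClosed_image true 1).union (hT.isClosed_image false 1)).isOpen_compl).mem_nhds ?_,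
        fun y => (π y : ℂ), ?_, ?_⟩
      · rintro (⟨⟨t, z⟩, hz, rfl⟩ | ⟨⟨t, z⟩, hz, rfl⟩)
        · exact hx _ _ _ hz rfl
        · exact hx _ _ _ hz rfl
      · refine contMDiff_coe_circle.comp_contMDiffOn (hπ.mono ?_)
        intro y hy hyB
        apply hy
        obtain ⟨i, t, rfl⟩ := (hT.mem_binding _).1 hyB
        cases i
        · exact Or.inr ⟨(t, 0), by simp, rfl⟩
        · exact Or.inl ⟨(t, 0), by simp, rfl⟩
      · intro y hy
        refine ⟨fun i t z hz h => ?_, fun _ => ⟨1, one_pos, by simp⟩⟩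
        exfalso
        apply hy
        cases i
        · exact Or.inr ⟨(t, z), hz, h⟩
        · exact Or.inl ⟨(t, z), hz, h⟩
  obtain ⟨ζ, hζ⟩ := exists_contMDiffMap_forall_mem_convex_of_local (𝓡 3) hS hloc
  have hne : ∀ x ∉ B, ∃ r : ℝ, 0 < r ∧ ζ x = r * (π x : ℂ) := fun x hx => (hζ x).2 hx
  refine ⟨ζ, ζ.contMDiff, fun i t z hz => (hζ _).1 i t z hz rfl, fun x hx => ?_, fun x hx => ?_⟩
  · obtain ⟨r, hr, h⟩ := hne x hx
    rw [h]
    exact mul_ne_zero (by exact_mod_cast hr.ne') (Circle.coe_ne_zero _)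
  · obtain ⟨r, hr, h⟩ := hne x hx
    rw [h]
    simp [abs_of_pos hr, Circle.norm_coe]

theorem IsDefiningFun.contMDiffOn_norm {ζ : M → ℂ} (hζ : IsDefiningFun B π T ζ) :
    ContMDiffOn (𝓡 3) 𝓘(ℝ, ℝ) ∞ (fun x => ‖ζ x‖) Bᶜ := by
  intro x hx
  apply ContMDiffAt.contMDiffWithinAt
  have h1 : ContMDiffAt 𝓘(ℝ, ℂ) 𝓘(ℝ, ℝ) ∞ (fun z : ℂ => ‖z‖) (ζ x) :=
    (contDiffAt_norm ℝ (hζ.ne_zero x hx)).contMDiffAt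
  exact h1.comp x (hζ.contMDiff x)

/-- Gluing of functions off the binding with prescribed values near the binding. -/
theorem IsCollars.exists_contMDiffOn_of_local [IsManifold (𝓡 3) ∞ M] [T2Space M]
    [CompactSpace M] (hT : IsCollars B π T) (hB : IsClosed B)
    (hπ : ContMDiffOn (𝓡 3) (𝓡 1) ∞ π Bᶜ) (i : Bool) (S : M → Set ℂ)
    (hS : ∀ x ∉ B, Convex ℝ (S x))
    (hloc : ∀ x ∉ B, ∃ U ∈ 𝓝 x, ∃ g : M → ℂ, ContMDiffOn (𝓡 3) 𝓘(ℝ, ℂ) ∞ g U ∧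
      ∀ y ∈ U, y ∉ B → g y ∈ S y)
    (hnear : ∃ ε > 0, ∀ t z, z ≠ 0 → ‖z‖ ≤ ε →
      (Circle.exp t : ℂ) / ‖z‖ ∈ S (T i (t, z)) ∧ 0 ∈ S (T (!i) (t, z))) :
    ∃ p : M → ℂ, ContMDiffOn (𝓡 3) 𝓘(ℝ, ℂ) ∞ p Bᶜ ∧ ∀ x ∉ B, p x ∈ S x := by
  obtain ⟨ζ, hζ⟩ := hT.exists_isDefiningFun hπ
  obtain ⟨ε', hε', hnear'⟩ := hnear
  -- The cap at 1 is the radius up to which ζ is the normal coordinate.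
  set ε := min ε' 1
  have hε : 0 < ε := lt_min hε' one_pos
  have hε1 : ε ≤ 1 := min_le_right _ _
  have hnear : ∀ t z, z ≠ 0 → ‖z‖ ≤ ε →
      (Circle.exp t : ℂ) / ‖z‖ ∈ S (T i (t, z)) ∧ 0 ∈ S (T (!i) (t, z)) :=
    fun t z hz hz' => hnear' t z hz (hz'.trans (min_le_left _ _))
  -- The gluing is carried out on all of `M`, for the function multiplied by ‖ζ‖: the singular value
  -- exp(it) / ‖z‖ becomes exp(it), which is smooth across component `i`. No condition is imposed on
  -- `B` itself.
  let S' : M → Set ℂ := fun x => {w | x ∉ B → w / ‖ζ x‖ ∈ S x}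
  have hS' : ∀ x, Convex ℝ (S' x) := by
    intro x w₁ h1 w₂ h2 a b ha hb hab hx
    have := hS x hx (h1 hx) (h2 hx) ha hb hab
    convert this using 1
    simp only [Complex.real_smul]
    ring
  have hloc' : ∀ x, ∃ U ∈ 𝓝 x, ∃ g : M → ℂ, ContMDiffOn (𝓡 3) 𝓘(ℝ, ℂ) ∞ g U ∧
      ∀ y ∈ U, g y ∈ S' y := by
    intro x
    by_cases hx : x ∈ B
    · obtain ⟨j, t, rfl⟩ := (hT.mem_binding _).1 hx
      by_cases hj : j = i
      · subst hj
        refine ⟨T j '' {p | ‖p.2‖ < ε}, (hT.isOpen_image j ε).mem_nhds ⟨(t, 0), by simpa, rfl⟩,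
          fun y => (collarCoord (T j) y).1, ?_, ?_⟩
        · have h2 : ContMDiff 𝓘(ℝ, ℂ × ℂ) 𝓘(ℝ, ℂ) ∞ (Prod.fst : ℂ × ℂ → ℂ) :=
            contDiff_fst.contMDiff
          exact h2.comp_contMDiffOn ((hT.contMDiffOn_coord j).mono (image_subset_range _ _))
        · rintro _ ⟨⟨t', z'⟩, hz', rfl⟩ hy
          have hz' : ‖z'‖ < ε := hz'
          rw [hT.not_mem_binding] at hy
          change (collarCoord (T j) (T j (t', z'))).1 / _ ∈ _
          rw [hT.coord_apply, hζ.apply_collar _ _ _ (hz'.le.trans hε1)]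
          exact (hnear t' z' hy hz'.le).1
      · obtain rfl : j = !i := by cases i <;> cases j <;> simp_all
        refine ⟨T (!i) '' {p | ‖p.2‖ < ε}, (hT.isOpen_image (!i) ε).mem_nhds
          ⟨(t, 0), by simpa, rfl⟩, fun y => 0, contMDiffOn_const, ?_⟩
        rintro _ ⟨⟨t', z'⟩, hz', rfl⟩ hy
        have hz' : ‖z'‖ < ε := hz'
        rw [hT.not_mem_binding] at hy
        rw [zero_div]
        exact (hnear t' z' hy hz'.le).2
    · obtain ⟨U, hU, g, hg, hgS⟩ := hloc x hx
      refine ⟨U ∩ Bᶜ, inter_mem hU (hB.isOpen_compl.mem_nhds hx), fun y => ‖ζ y‖ • g y, ?_, ?_⟩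
      · exact (hζ.contMDiffOn_norm.mono inter_subset_right).smul (hg.mono inter_subset_left)
      · rintro y ⟨hy, hyB⟩ _
        have h0 : (‖ζ y‖ : ℂ) ≠ 0 := by simpa using hζ.ne_zero y hyB
        change ‖ζ y‖ • g y / _ ∈ _
        rw [Complex.real_smul, mul_div_cancel_left₀ _ h0]
        exact hgS y hy hyB
  obtain ⟨a, ha⟩ := exists_contMDiffMap_forall_mem_convex_of_local (𝓡 3) hS' hloc'
  refine ⟨fun x => ‖ζ x‖⁻¹ • a x, ?_, fun x hx => ?_⟩
  · exact ContMDiffOn.smul (f := fun x => ‖ζ x‖⁻¹)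
      (hζ.contMDiffOn_norm.inv₀ fun x hx => by simpa using hζ.ne_zero x hx)
      a.contMDiff.contMDiffOn
  · have := ha x hx
    simpa [Complex.real_smul, div_eq_inv_mul] using this

end

/-! ### Coordinates at an end of the annulus and their interpolation -/

section

section Kernel

variable {E₁ E₂ E₃ : Type*} [NormedAddCommGroup E₁] [NormedSpace ℝ E₁]
  [NormedAddCommGroup E₂] [NormedSpace ℝ E₂] [NormedAddCommGroup E₃] [NormedSpace ℝ E₃]

/-- This is how immersivity is proved throughout: instead of computing a derivative, a known
immersion is recovered from the map by a differentiable operation. -/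
theorem HasFDerivAt.apply_eq_zero_of_comp {f : E₁ → E₂} {g : E₂ → E₃} {k : E₁ → E₃} {x : E₁}
    {f' : E₁ →L[ℝ] E₂} {k' : E₁ →L[ℝ] E₃} (hk : HasFDerivAt k k' x) (hf : HasFDerivAt f f' x)
    (hg : DifferentiableAt ℝ g (f x)) (h : k =ᶠ[𝓝 x] g ∘ f) {v : E₁} (hv : f' v = 0) :
    k' v = 0 := by
  have h1 := (hg.hasFDerivAt.comp x hf).congr_of_eventuallyEq h
  rw [hk.unique h1]
  simp [hv]

end Kernel

/-- The closed strip of width `r`. -/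
def stripOf (r : ℝ) : Set (ℝ × ℝ) := univ ×ˢ Icc 0 r

/-- `R` and `Λ` are the coordinates (distance to the end and angular coordinate) of an end of an
annulus, read in some parametrization of the annulus. -/
structure IsEndCoord (R : ℝ × ℝ → ℝ) (Λ : ℝ × ℝ → ℂ) (r : ℝ) : Prop where
  pos : 0 < r
  contDiffOn_fst : ContDiffOn ℝ ∞ R (stripOf r)
  contDiffOn_snd : ContDiffOn ℝ ∞ Λ (stripOf r)
  congr_fst : ∀ t t', ∀ s ∈ Icc 0 r, Circle.exp t = Circle.exp t' → R (t, s) = R (t', s)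
  congr_snd : ∀ t t', ∀ s ∈ Icc 0 r, Circle.exp t = Circle.exp t' → Λ (t, s) = Λ (t', s)
  norm_snd : ∀ x ∈ stripOf r, ‖Λ x‖ = 1
  fst_zero : ∀ t, R (t, 0) = 0
  fst_pos : ∀ t, ∀ s ∈ Ioc 0 r, 0 < R (t, s)
  fst_lt_one : ∀ x ∈ stripOf r, R x < 1
  snd_inj : ∀ t t', Λ (t, 0) = Λ (t', 0) → Circle.exp t = Circle.exp t'
  injective_fderivWithin : ∀ t, Injective
    (fderivWithin ℝ (fun x => (R x, Λ x)) (stripOf r) (t, 0))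

/-- The linear interpolation from `Λ (t, 0)` to `Λ (t, s)`. -/
def angleInterp (Λ : ℝ × ℝ → ℂ) (y : ℝ × ℝ × ℝ) : ℂ :=
  (1 - y.2.2) • Λ (y.1, 0) + y.2.2 • Λ (y.1, y.2.1)

/-- The normalized interpolation between angular coordinates, as a map in three variables. -/
def interpMap (R : ℝ × ℝ → ℝ) (Λ : ℝ × ℝ → ℂ) (y : ℝ × ℝ × ℝ) : ℝ × ℂ × ℝ :=
  (R (y.1, y.2.1), ‖angleInterp Λ y‖⁻¹ • angleInterp Λ y, y.2.2)

/-- The domain of `interpMap`. -/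
def slabOf (r : ℝ) : Set (ℝ × ℝ × ℝ) := univ ×ˢ Icc 0 r ×ˢ univ

namespace IsEndCoord

variable {R : ℝ × ℝ → ℝ} {Λ : ℝ × ℝ → ℂ} {r : ℝ}

theorem zero_mem (h : IsEndCoord R Λ r) (t : ℝ) : (t, (0 : ℝ)) ∈ stripOf r :=
  ⟨mem_univ _, le_rfl, h.pos.le⟩

theorem uniqueDiffOn (h : IsEndCoord R Λ r) : UniqueDiffOn ℝ (stripOf r) :=
  uniqueDiffOn_univ.prod (uniqueDiffOn_Icc h.pos)

theorem contDiff_zero (h : IsEndCoord R Λ r) : ContDiff ℝ ∞ (fun t => Λ (t, 0)) := by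
  rw [← contDiffOn_univ]
  exact h.contDiffOn_snd.comp (by fun_prop) fun t _ => h.zero_mem t

theorem fderivWithin_eq (h : IsEndCoord R Λ r) {x : ℝ × ℝ} (hx : x ∈ stripOf r) (v : ℝ × ℝ) :
    fderivWithin ℝ (fun x => (R x, Λ x)) (stripOf r) x v =
      (fderivWithin ℝ R (stripOf r) x v, fderivWithin ℝ Λ (stripOf r) x v) := by
  have h1 := (h.contDiffOn_fst x hx).differentiableWithinAt (by simp)
  have h2 := (h.contDiffOn_snd x hx).differentiableWithinAt (by simp)
  rw [(h1.hasFDerivWithinAt.prodMk h2.hasFDerivWithinAt).fderivWithin (h.uniqueDiffOn x hx)]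
  rfl

theorem hasDerivAt_zero (h : IsEndCoord R Λ r) (t : ℝ) :
    HasDerivAt (fun t => Λ (t, 0)) (fderivWithin ℝ Λ (stripOf r) (t, 0) (1, 0)) t := by
  have h2 := (h.contDiffOn_snd _ (h.zero_mem t)).differentiableWithinAt (by simp)
  have hi : HasFDerivAt (fun t : ℝ => (t, (0 : ℝ))) (ContinuousLinearMap.inl ℝ ℝ ℝ) t :=
    hasFDerivAt_prodMk_left _ _
  have h3 := h2.hasFDerivWithinAt.comp t (hi.hasFDerivWithinAt (s := univ))
    (fun t' _ => h.zero_mem t')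
  rw [hasFDerivWithinAt_univ] at h3
  exact h3.hasDerivAt

theorem fderivWithin_fst_zero (h : IsEndCoord R Λ r) (t : ℝ) :
    fderivWithin ℝ R (stripOf r) (t, 0) (1, 0) = 0 := by
  have h2 := (h.contDiffOn_fst _ (h.zero_mem t)).differentiableWithinAt (by simp)
  have hi : HasFDerivAt (fun t : ℝ => (t, (0 : ℝ))) (ContinuousLinearMap.inl ℝ ℝ ℝ) t :=
    hasFDerivAt_prodMk_left _ _
  have h3 := h2.hasFDerivWithinAt.comp t (hi.hasFDerivWithinAt (s := univ))
    (fun t' _ => h.zero_mem t')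
  rw [hasFDerivWithinAt_univ] at h3
  have h4 : HasDerivAt (fun _ : ℝ => (0 : ℝ)) _ t :=
    (h3.congr_of_eventuallyEq (Eventually.of_forall fun t' => (h.fst_zero t').symm)).hasDerivAt
  have h5 := h4.unique (hasDerivAt_const t 0)
  simpa using h5

/-- `R` is constant along the end, so the derivative of the injectively differentiable pair (R, Λ)
along the end is carried by `Λ` alone. -/
theorem deriv_zero_ne (h : IsEndCoord R Λ r) (t : ℝ) :
    fderivWithin ℝ Λ (stripOf r) (t, 0) (1, 0) ≠ 0 := by
  intro h0
  have h1 : fderivWithin ℝ (fun x => (R x, Λ x)) (stripOf r) (t, 0) (1, 0) = 0 := by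
    rw [h.fderivWithin_eq (h.zero_mem t), h0, h.fderivWithin_fst_zero]
    rfl
  have h2 := h.injective_fderivWithin t (h1.trans (map_zero _).symm)
  simp at h2

theorem inner_fderivWithin (h : IsEndCoord R Λ r) {x : ℝ × ℝ} (hx : x ∈ stripOf r) (v : ℝ × ℝ) :
    (fderivWithin ℝ Λ (stripOf r) x v * (starRingEnd ℂ) (Λ x)).re = 0 := by
  have h1 := ((h.contDiffOn_snd x hx).differentiableWithinAt (by simp)).hasFDerivWithinAt
  have h2 := h1.inner ℝ h1
  have h3 : HasFDerivWithinAt (fun _ : ℝ × ℝ => (1 : ℝ)) _ (stripOf r) x :=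
    h2.congr (fun y hy => by simp [h.norm_snd y hy]) (by simp [h.norm_snd x hx])
  have h4 := (h.uniqueDiffOn x hx).eq h3 (hasFDerivWithinAt_const 1 x _)
  have h5 := DFunLike.congr_fun h4 v
  simp [Complex.inner] at h5
  simp only [Complex.mul_re, Complex.conj_re, Complex.conj_im]
  linarith

/-- `R` is minimal on the end, so its inward derivative is nonnegative. Were it zero, all of dR
would vanish there, while dΛ takes values in the tangent line of the unit circle; then (dR, dΛ)
would have rank at most one. -/
theorem fderivWithin_fst_pos (h : IsEndCoord R Λ r) (t : ℝ) :
    0 < fderivWithin ℝ R (stripOf r) (t, 0) (0, 1) := by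
  have hx := h.zero_mem t
  have h1 := ((h.contDiffOn_fst _ hx).differentiableWithinAt (by simp)).hasFDerivWithinAt
  have hnn : 0 ≤ fderivWithin ℝ R (stripOf r) (t, 0) (0, r) := by
    refine IsLocalMinOn.hasFDerivWithinAt_nonneg (f := R) (s := stripOf r) (a := (t, 0)) ?_ h1 ?_
    · filter_upwards [self_mem_nhdsWithin] with y hy
      rw [h.fst_zero]
      rcases hy.2.1.eq_or_lt with h0 | h0
      · have := h.fst_zero y.1
        have hy0 : y = (y.1, 0) := Prod.ext rfl h0.symm
        rw [hy0, this]
      · exact (h.fst_pos y.1 y.2 ⟨h0, hy.2.2⟩).le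
    · have hc : Convex ℝ (stripOf r) := convex_univ.prod (convex_Icc 0 r)
      have := sub_mem_posTangentConeAt_of_segment_subset
        (hc.segment_subset hx (⟨mem_univ _, h.pos.le, le_rfl⟩ : (t, r) ∈ stripOf r))
      simpa using this
  have hr : ((0 : ℝ), r) = r • ((0 : ℝ), (1 : ℝ)) := by simp
  rw [hr, map_smul, smul_eq_mul] at hnn
  refine lt_of_le_of_ne (nonneg_of_mul_nonneg_right hnn h.pos) (Ne.symm fun h0 => ?_)
  set L := fderivWithin ℝ Λ (stripOf r) (t, 0) with hL
  let α : ℝ × ℝ → ℝ := fun v => (L v * (starRingEnd ℂ) (Λ (t, 0))).im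
  have hα : ∀ v, α v = 0 → L v = 0 := by
    intro v hv
    have h2 : L v * (starRingEnd ℂ) (Λ (t, 0)) = 0 :=
      Complex.ext (h.inner_fderivWithin hx v) hv
    have h3 : Λ (t, 0) ≠ 0 := by
      rw [← norm_ne_zero_iff, h.norm_snd _ hx]
      exact one_ne_zero
    simpa [h3] using h2
  -- The combination of the two basis vectors that dΛ kills.
  let u : ℝ × ℝ := α (0, 1) • (1, 0) - α (1, 0) • (0, 1)
  have hαu : α u = 0 := by
    simp only [α, u, map_sub, map_smul, Complex.real_smul, sub_mul, mul_assoc, Complex.sub_im,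
      Complex.im_ofReal_mul]
    ring
  have hu : fderivWithin ℝ (fun x => (R x, Λ x)) (stripOf r) (t, 0) u = 0 := by
    rw [h.fderivWithin_eq hx, ← hL, hα u hαu]
    simp only [u, map_sub, map_smul, h.fderivWithin_fst_zero, h0]
    simp
  have hu0 := h.injective_fderivWithin t (hu.trans (map_zero _).symm)
  have h5 : α (1, 0) = 0 := by
    have := congrArg Prod.snd hu0
    simpa [u] using this
  exact h.deriv_zero_ne t (hα _ h5)

theorem zero_mem_slab (h : IsEndCoord R Λ r) (t c : ℝ) : (t, (0 : ℝ), c) ∈ slabOf r :=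
  ⟨mem_univ _, ⟨le_rfl, h.pos.le⟩, mem_univ _⟩

theorem uniqueDiffOn_slab (h : IsEndCoord R Λ r) : UniqueDiffOn ℝ (slabOf r) :=
  uniqueDiffOn_univ.prod ((uniqueDiffOn_Icc h.pos).prod uniqueDiffOn_univ)

theorem convex_slab (r : ℝ) : Convex ℝ (slabOf r) :=
  convex_univ.prod ((convex_Icc 0 r).prod convex_univ)

theorem contDiffOn_angleInterp (h : IsEndCoord R Λ r) :
    ContDiffOn ℝ ∞ (angleInterp Λ) (slabOf r) := by
  have h1 : ContDiffOn ℝ ∞ (fun y : ℝ × ℝ × ℝ => Λ (y.1, 0)) (slabOf r) :=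
    (h.contDiff_zero.comp contDiff_fst).contDiffOn
  have h2 : ContDiffOn ℝ ∞ (fun y : ℝ × ℝ × ℝ => Λ (y.1, y.2.1)) (slabOf r) :=
    h.contDiffOn_snd.comp (by fun_prop) fun y hy => ⟨mem_univ _, hy.2.1⟩
  have h3 : ContDiffOn ℝ ∞ (fun y : ℝ × ℝ × ℝ => y.2.2) (slabOf r) := by fun_prop
  exact ((contDiffOn_const.sub h3).smul h1).add (h3.smul h2)

theorem contDiffWithinAt_interpMap (h : IsEndCoord R Λ r) {y : ℝ × ℝ × ℝ} (hy : y ∈ slabOf r)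
    (h0 : angleInterp Λ y ≠ 0) : ContDiffWithinAt ℝ ∞ (interpMap R Λ) (slabOf r) y := by
  have h1 : ContDiffOn ℝ ∞ (fun y : ℝ × ℝ × ℝ => R (y.1, y.2.1)) (slabOf r) :=
    h.contDiffOn_fst.comp (by fun_prop) fun y hy => ⟨mem_univ _, hy.2.1⟩
  have h2 := h.contDiffOn_angleInterp y hy
  have h3 : ContDiffWithinAt ℝ ∞ (fun y : ℝ × ℝ × ℝ => y.2.2) (slabOf r) y := by fun_prop
  exact (h1 y hy).prodMk ((((h2.norm ℝ h0).inv (norm_ne_zero_iff.2 h0)).smul h2).prodMk h3)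

theorem angleInterp_zero (t c : ℝ) : angleInterp Λ (t, 0, c) = Λ (t, 0) := by
  simp only [angleInterp]
  rw [← add_smul, sub_add_cancel, one_smul]

theorem interpMap_zero (h : IsEndCoord R Λ r) (t c : ℝ) :
    interpMap R Λ (t, 0, c) = (0, Λ (t, 0), c) := by
  simp [interpMap, angleInterp_zero, h.fst_zero, h.norm_snd _ (h.zero_mem t)]

theorem angleInterp_zero_ne (h : IsEndCoord R Λ r) (t c : ℝ) : angleInterp Λ (t, 0, c) ≠ 0 := by
  rw [angleInterp_zero, ← norm_ne_zero_iff, h.norm_snd _ (h.zero_mem t)]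
  exact one_ne_zero

/-- On the end itself the interpolation is Λ(t, 0) whatever the parameter c. The kernel is therefore
cut down one variable at a time: the last component gives the c-direction, the inward derivative of
`R` the s-direction, and the derivative of Λ(·, 0) the t-direction. -/
theorem injective_fderivWithin_interpMap (h : IsEndCoord R Λ r) (t c : ℝ) :
    Injective (fderivWithin ℝ (interpMap R Λ) (slabOf r) (t, 0, c)) := by
  have hx := h.zero_mem_slab t c
  have hd := ((h.contDiffWithinAt_interpMap hx
    (h.angleInterp_zero_ne t c)).differentiableWithinAt (by simp)).hasFDerivWithinAt
  set L := fderivWithin ℝ (interpMap R Λ) (slabOf r) (t, 0, c)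
  refine (injective_iff_map_eq_zero _).2 ?_
  rintro ⟨a, b, e⟩ hv
  have he : e = 0 := by
    have h1 := hasFDerivAt_snd.comp_hasFDerivWithinAt (t, 0, c)
      (hasFDerivAt_snd.comp_hasFDerivWithinAt (t, 0, c) hd)
    have h2 : HasFDerivWithinAt (fun y : ℝ × ℝ × ℝ => y.2.2)
      ((ContinuousLinearMap.snd ℝ ℝ ℝ).comp (ContinuousLinearMap.snd ℝ ℝ (ℝ × ℝ)))
      (slabOf r) (t, 0, c) :=
      (HasFDerivAt.comp (g := Prod.snd) (f := Prod.snd) (t, 0, c) hasFDerivAt_snd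
        hasFDerivAt_snd).hasFDerivWithinAt
    have h3 := (h.uniqueDiffOn_slab _ hx).eq h2 h1
    have h4 := DFunLike.congr_fun h3 (a, b, e)
    have h5 : e = (L (a, b, e)).2.2 := h4
    rw [hv] at h5
    exact h5
  have hb : b = 0 := by
    have h1 := hasFDerivAt_fst.comp_hasFDerivWithinAt (t, 0, c) hd
    have hR := ((h.contDiffOn_fst _ (h.zero_mem t)).differentiableWithinAt
      (by simp)).hasFDerivWithinAt
    have hp : HasFDerivAt (fun y : ℝ × ℝ × ℝ => (y.1, y.2.1))
      ((ContinuousLinearMap.fst ℝ ℝ (ℝ × ℝ)).prod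
        ((ContinuousLinearMap.fst ℝ ℝ ℝ).comp (ContinuousLinearMap.snd ℝ ℝ (ℝ × ℝ))))
      (t, (0 : ℝ), c) :=
      hasFDerivAt_fst.prodMk (HasFDerivAt.comp (g := Prod.fst) (f := Prod.snd) (t, (0 : ℝ), c)
        hasFDerivAt_fst hasFDerivAt_snd)
    have h2 := HasFDerivWithinAt.comp (g := R) (f := fun y : ℝ × ℝ × ℝ => (y.1, y.2.1))
      (t, (0 : ℝ), c) hR (hp.hasFDerivWithinAt (s := slabOf r))
      (fun y hy => (⟨mem_univ _, hy.2.1⟩ : (y.1, y.2.1) ∈ stripOf r))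
    have h3 := (h.uniqueDiffOn_slab _ hx).eq h2 h1
    have h4 := DFunLike.congr_fun h3 (a, b, e)
    have h5 : fderivWithin ℝ R (stripOf r) (t, 0) (a, b) = (L (a, b, e)).1 := h4
    rw [hv] at h5
    have h6 : (a, b) = a • ((1 : ℝ), (0 : ℝ)) + b • ((0 : ℝ), (1 : ℝ)) := by simp
    rw [h6, map_add, map_smul, map_smul, h.fderivWithin_fst_zero] at h5
    have h7 : b * fderivWithin ℝ R (stripOf r) (t, 0) (0, 1) = 0 := by simpa using h5
    exact (mul_eq_zero.1 h7).resolve_right (h.fderivWithin_fst_pos t).ne'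
  subst he hb
  have hi : HasFDerivAt (fun t : ℝ => (t, (0 : ℝ), c)) (ContinuousLinearMap.inl ℝ ℝ (ℝ × ℝ)) t :=
    hasFDerivAt_prodMk_left _ _
  have h3 := hd.comp t (hi.hasFDerivWithinAt (s := univ))
    (fun t' _ => h.zero_mem_slab t' c)
  rw [hasFDerivWithinAt_univ] at h3
  have h4 := (hasFDerivAt_fst.comp t (hasFDerivAt_snd.comp t h3)).congr_of_eventuallyEq
    (f₁ := fun t => Λ (t, 0)) (Eventually.of_forall fun t' => by simp [h.interpMap_zero])
  have h5 := DFunLike.congr_fun (h4.unique (h.hasDerivAt_zero t).hasFDerivAt) a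
  have h6 : (L (a, 0, 0)).2.1 = a • fderivWithin ℝ Λ (stripOf r) (t, 0) (1, 0) := by
    exact h5
  rw [hv] at h6
  have h7 : a = 0 := (smul_eq_zero.1 h6.symm).resolve_right (h.deriv_zero_ne t)
  rw [h7]
  rfl

end IsEndCoord

end

/-! ### A uniform width on which the interpolations are embeddings -/

section

namespace IsEndCoord

variable {R : ℝ × ℝ → ℝ} {Λ : ℝ × ℝ → ℂ} {r : ℝ}

theorem angleInterp_congr (h : IsEndCoord R Λ r) {t t' s : ℝ} (c : ℝ) (hs : s ∈ Icc 0 r)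
    (ht : Circle.exp t = Circle.exp t') :
    angleInterp Λ (t, s, c) = angleInterp Λ (t', s, c) := by
  simp only [angleInterp]
  rw [h.congr_snd t t' s hs ht, h.congr_snd t t' 0 ⟨le_rfl, h.pos.le⟩ ht]

theorem interpMap_congr (h : IsEndCoord R Λ r) {t t' s : ℝ} (c : ℝ) (hs : s ∈ Icc 0 r)
    (ht : Circle.exp t = Circle.exp t') :
    interpMap R Λ (t, s, c) = interpMap R Λ (t', s, c) := by
  simp only [interpMap]
  rw [h.angleInterp_congr c hs ht, h.congr_fst t t' s hs ht]

theorem eventually_angleInterp_ne (h : IsEndCoord R Λ r) (t c : ℝ) :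
    ∀ᶠ y in 𝓝[slabOf r] (t, (0 : ℝ), c), angleInterp Λ y ≠ 0 :=
  (h.contDiffOn_angleInterp _ (h.zero_mem_slab t c)).continuousWithinAt.eventually_ne
    (h.angleInterp_zero_ne t c)

theorem eventually_fderivWithin_fst_pos (h : IsEndCoord R Λ r) (t : ℝ) :
    ∀ᶠ x in 𝓝[stripOf r] (t, (0 : ℝ)), 0 < fderivWithin ℝ R (stripOf r) x (0, 1) := by
  have h1 := (h.contDiffOn_fst _ (h.zero_mem t)).fderivWithin_right (m := 0) h.uniqueDiffOn
    (by simp) (h.zero_mem t)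
  have h2 := h1.continuousWithinAt.clm_apply
    (continuousWithinAt_const (b := ((0 : ℝ), (1 : ℝ))))
  exact h2.eventually (lt_mem_nhds (h.fderivWithin_fst_pos t))

/-- Near the end, the interpolated coordinates are embeddings. -/
theorem exists_width (h : IsEndCoord R Λ r) : ∃ δ, 0 < δ ∧ δ < r ∧
    (∀ t, ∀ s ∈ Icc 0 δ, ∀ c ∈ Icc (0 : ℝ) 1, angleInterp Λ (t, s, c) ≠ 0) ∧
    (∀ t t', ∀ s ∈ Icc 0 δ, ∀ s' ∈ Icc 0 δ, ∀ c ∈ Icc (0 : ℝ) 1,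
      interpMap R Λ (t, s, c) = interpMap R Λ (t', s', c) → Circle.exp t = Circle.exp t' ∧ s = s') ∧
    (∀ t ∈ Icc 0 (2 * Real.pi), ∀ s ∈ Icc 0 δ, ∀ c ∈ Icc (0 : ℝ) 1,
      Injective (fderivWithin ℝ (interpMap R Λ) (slabOf r) (t, s, c))) ∧
    ∀ t ∈ Icc 0 (2 * Real.pi), ∀ s ∈ Icc 0 δ,
      0 < fderivWithin ℝ R (stripOf r) (t, s) (0, 1) := by
  -- All requirements are local near s = s' = 0, with (t, t', c) in a compact set, so compactness
  -- provides one width for all of them.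
  let P : ℝ × ℝ → ℝ × ℝ × ℝ → Prop := fun s y => s.1 ∈ Icc 0 r → s.2 ∈ Icc 0 r →
    angleInterp Λ (y.1, s.1, y.2.2) ≠ 0 ∧
    (interpMap R Λ (y.1, s.1, y.2.2) = interpMap R Λ (y.2.1, s.2, y.2.2) →
      Circle.exp y.1 = Circle.exp y.2.1 ∧ s.1 = s.2) ∧
    Injective (fderivWithin ℝ (interpMap R Λ) (slabOf r) (y.1, s.1, y.2.2)) ∧
    0 < fderivWithin ℝ R (stripOf r) (y.1, s.1) (0, 1)
  let K : Set (ℝ × ℝ × ℝ) := Icc 0 (2 * Real.pi) ×ˢ Icc 0 (2 * Real.pi) ×ˢ Icc 0 1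
  have hK : IsCompact K := isCompact_Icc.prod (isCompact_Icc.prod isCompact_Icc)
  have hP : ∀ y ∈ K, ∀ᶠ q : (ℝ × ℝ) × (ℝ × ℝ × ℝ) in 𝓝 ((0, 0), y), P q.1 q.2 := by
    rintro ⟨t, t', c⟩ -
    have ht₁ : Tendsto (fun q : (ℝ × ℝ) × (ℝ × ℝ × ℝ) => (q.2.1, q.1.1, q.2.2.2))
        (𝓝 ((0, 0), (t, t', c))) (𝓝 (t, 0, c)) :=
      (by fun_prop : Continuous fun q : (ℝ × ℝ) × (ℝ × ℝ × ℝ) => (q.2.1, q.1.1, q.2.2.2)).tendsto _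
    have ht₂ : Tendsto (fun q : (ℝ × ℝ) × (ℝ × ℝ × ℝ) => (q.2.1, q.1.1))
        (𝓝 ((0, 0), (t, t', c))) (𝓝 (t, 0)) :=
      (by fun_prop : Continuous fun q : (ℝ × ℝ) × (ℝ × ℝ × ℝ) => (q.2.1, q.1.1)).tendsto _
    have hd : ∀ t c, ContDiffWithinAt ℝ ∞ (interpMap R Λ) (slabOf r) (t, 0, c) := fun t c =>
      h.contDiffWithinAt_interpMap (h.zero_mem_slab t c) (h.angleInterp_zero_ne t c)
    obtain ⟨U, hU, hUi, hUd⟩ := exists_nhdsWithin_injOn_of_injective_fderivWithin (convex_slab r)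
      h.uniqueDiffOn_slab (h.zero_mem_slab t c) ((hd t c).of_le (by exact_mod_cast le_top))
      (h.injective_fderivWithin_interpMap t c)
    have e1 := ht₁.eventually (eventually_nhdsWithin_iff.1 (h.eventually_angleInterp_ne t c))
    have e2 := ht₁.eventually (eventually_nhdsWithin_iff.1 hU)
    have e3 := ht₂.eventually (eventually_nhdsWithin_iff.1 (h.eventually_fderivWithin_fst_pos t))
    have e4 : ∀ᶠ q : (ℝ × ℝ) × (ℝ × ℝ × ℝ) in 𝓝 ((0, 0), (t, t', c)),
        q.1.1 ∈ Icc 0 r → q.1.2 ∈ Icc 0 r →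
        interpMap R Λ (q.2.1, q.1.1, q.2.2.2) = interpMap R Λ (q.2.2.1, q.1.2, q.2.2.2) →
        Circle.exp q.2.1 = Circle.exp q.2.2.1 ∧ q.1.1 = q.1.2 := by
      -- If t and t' represent the same angle, t' is shifted by a multiple of 2π and local
      -- injectivity at (t, 0, c) applies. Otherwise Λ(t, 0) and Λ(t', 0) differ, and disjoint
      -- neighbourhoods separate the values.
      by_cases htt : Circle.exp t = Circle.exp t'
      · obtain ⟨m, hm⟩ := Circle.exp_eq_exp.1 htt
        have hm' : ∀ x : ℝ, Circle.exp (x + m * (2 * Real.pi)) = Circle.exp x := fun x =>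
          Circle.exp_eq_exp.2 ⟨m, rfl⟩
        have ht₃ : Tendsto (fun q : (ℝ × ℝ) × (ℝ × ℝ × ℝ) =>
            (q.2.2.1 + m * (2 * Real.pi), q.1.2, q.2.2.2))
            (𝓝 ((0, 0), (t, t', c))) (𝓝 (t, 0, c)) := by
          have := (by fun_prop : Continuous fun q : (ℝ × ℝ) × (ℝ × ℝ × ℝ) =>
            (q.2.2.1 + m * (2 * Real.pi), q.1.2, q.2.2.2)).tendsto ((0, 0), (t, t', c))
          rwa [← hm] at this
        filter_upwards [e2, ht₃.eventually (eventually_nhdsWithin_iff.1 hU)] with q h1 h2 hs hs' he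
        have h3 := h1 ⟨mem_univ _, hs, mem_univ _⟩
        have h4 := h2 ⟨mem_univ _, hs', mem_univ _⟩
        rw [← h.interpMap_congr q.2.2.2 hs' (hm' q.2.2.1)] at he
        have h5 := hUi h3 h4 he
        have h6 : q.2.1 = q.2.2.1 + m * (2 * Real.pi) := congrArg Prod.fst h5
        have h7 : q.1.1 = q.1.2 := congrArg (fun z : ℝ × ℝ × ℝ => z.2.1) h5
        exact ⟨by rw [h6, hm'], h7⟩
      · have hne : Λ (t, 0) ≠ Λ (t', 0) := fun he => htt (h.snd_inj t t' he)
        have ht₃ : Tendsto (fun q : (ℝ × ℝ) × (ℝ × ℝ × ℝ) => (q.2.2.1, q.1.2, q.2.2.2))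
            (𝓝 ((0, 0), (t, t', c))) (𝓝 (t', 0, c)) :=
          (by fun_prop : Continuous fun q : (ℝ × ℝ) × (ℝ × ℝ × ℝ) =>
            (q.2.2.1, q.1.2, q.2.2.2)).tendsto _
        obtain ⟨A, A', hA, hA', hm, hm', hAA⟩ := t2_separation hne
        have hcont : ∀ (t : ℝ) (A : Set ℂ), IsOpen A → Λ (t, 0) ∈ A →
            ∀ᶠ y in 𝓝[slabOf r] (t, (0 : ℝ), c), (interpMap R Λ y).2.1 ∈ A := by
          intro t A hA hm
          have h1 : ContinuousWithinAt (fun y => (interpMap R Λ y).2.1) (slabOf r) (t, 0, c) :=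
            ((hd t c).continuousWithinAt.snd).fst
          refine h1.eventually (hA.mem_nhds ?_)
          change (interpMap R Λ (t, 0, c)).2.1 ∈ A
          rw [h.interpMap_zero]
          exact hm
        filter_upwards [ht₁.eventually (eventually_nhdsWithin_iff.1 (hcont t A hA hm)),
          ht₃.eventually (eventually_nhdsWithin_iff.1 (hcont t' A' hA' hm'))]
          with q h1 h2 hs hs' he
        have h3 := h1 ⟨mem_univ _, hs, mem_univ _⟩
        have h4 := h2 ⟨mem_univ _, hs', mem_univ _⟩
        rw [← he] at h4
        exact (disjoint_left.1 hAA h3 h4).elim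
    filter_upwards [e1, e2, e3, e4] with q h1 h2 h3 h4 hs hs'
    exact ⟨h1 ⟨mem_univ _, hs, mem_univ _⟩, h4 hs hs', hUd _ (h2 ⟨mem_univ _, hs, mem_univ _⟩),
      h3 ⟨mem_univ _, hs⟩⟩
  have hev := hK.eventually_forall_of_forall_eventually (x₀ := ((0 : ℝ), (0 : ℝ))) (P := P) hP
  obtain ⟨η, hη, hball⟩ := Metric.eventually_nhds_iff.1 hev
  have hδ : 0 < min (η / 2) (r / 2) := lt_min (by positivity) (by linarith [h.pos])
  have hδη : min (η / 2) (r / 2) < η := (min_le_left _ _).trans_lt (by linarith)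
  have hδr : min (η / 2) (r / 2) < r := (min_le_right _ _).trans_lt (by linarith [h.pos])
  set δ := min (η / 2) (r / 2)
  have hr : ∀ s ∈ Icc 0 δ, s ∈ Icc 0 r := fun s hs => ⟨hs.1, hs.2.trans hδr.le⟩
  have key : ∀ t ∈ Icc 0 (2 * Real.pi), ∀ t' ∈ Icc 0 (2 * Real.pi), ∀ s ∈ Icc 0 δ,
      ∀ s' ∈ Icc 0 δ, ∀ c ∈ Icc (0 : ℝ) 1, P (s, s') (t, t', c) := by
    intro t ht t' ht' s hs s' hs' c hc
    refine hball ?_ (t, t', c) ⟨ht, ht', hc⟩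
    rw [Prod.dist_eq, max_lt_iff, Real.dist_eq, Real.dist_eq, sub_zero, sub_zero,
      abs_of_nonneg hs.1, abs_of_nonneg hs'.1]
    exact ⟨hs.2.trans_lt hδη, hs'.2.trans_lt hδη⟩
  refine ⟨δ, hδ, hδr, ?_, ?_, ?_, ?_⟩
  · intro t s hs c hc
    obtain ⟨t', ht', he⟩ := exists_mem_Icc_circleExp_eq t
    rw [← h.angleInterp_congr c (hr s hs) he]
    exact (key t' ht' t' ht' s hs s hs c hc (hr s hs) (hr s hs)).1
  · intro t t' s hs s' hs' c hc he
    obtain ⟨u, hu, hue⟩ := exists_mem_Icc_circleExp_eq t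
    obtain ⟨u', hu', hue'⟩ := exists_mem_Icc_circleExp_eq t'
    rw [← h.interpMap_congr c (hr s hs) hue, ← h.interpMap_congr c (hr s' hs') hue'] at he
    rw [← hue, ← hue']
    exact (key u hu u' hu' s hs s' hs' c hc (hr s hs) (hr s' hs')).2.1 he
  · intro t ht s hs c hc
    exact (key t ht t ht s hs s hs c hc (hr s hs) (hr s hs)).2.2.1
  · intro t ht s hs
    exact (key t ht t ht s hs s hs 0 ⟨le_rfl, zero_le_one⟩ (hr s hs) (hr s hs)).2.2.2

end IsEndCoord

end

/-! ### The model function on an annulus: standard at one end, zero at the other -/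

section

/-- A cutoff equal to `1` on `(-∞, ε / 2]` and to `0` on `[3 ε / 4, ∞)`. -/
def innerCut (ε ρ : ℝ) : ℝ := 1 - Real.smoothTransition ((ρ - ε / 2) / (ε / 4))

/-- A cutoff equal to `0` on `(-∞, δ / 3]` and to `1` on `[2 δ / 3, ∞)`. -/
def blendCut (δ s : ℝ) : ℝ := Real.smoothTransition ((s - δ / 3) / (δ / 3))

/-- A function which decreases on `(-∞, b]` and vanishes on `[b, ∞)`. -/
def tailFun (b s : ℝ) : ℝ := expNegInvGlue (b - s) / 2

theorem contDiff_innerCut (ε : ℝ) : ContDiff ℝ ∞ (innerCut ε) :=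
  contDiff_const.sub (Real.smoothTransition.contDiff.comp (by fun_prop))

theorem contDiff_blendCut (δ : ℝ) : ContDiff ℝ ∞ (blendCut δ) :=
  Real.smoothTransition.contDiff.comp (by fun_prop)

theorem contDiff_tailFun (b : ℝ) : ContDiff ℝ ∞ (tailFun b) :=
  (expNegInvGlue.contDiff.comp (by fun_prop)).div_const 2

theorem innerCut_mem (ε ρ : ℝ) : innerCut ε ρ ∈ Icc (0 : ℝ) 1 :=
  ⟨by have := Real.smoothTransition.le_one ((ρ - ε / 2) / (ε / 4)); unfold innerCut; linarith,
    by have := Real.smoothTransition.nonneg ((ρ - ε / 2) / (ε / 4)); unfold innerCut; linarith⟩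

theorem innerCut_eq_one {ε ρ : ℝ} (hε : 0 < ε) (h : ρ ≤ ε / 2) : innerCut ε ρ = 1 := by
  rw [innerCut, Real.smoothTransition.zero_of_nonpos, sub_zero]
  exact div_nonpos_of_nonpos_of_nonneg (by linarith) (by linarith)

theorem innerCut_eq_zero {ε ρ : ℝ} (hε : 0 < ε) (h : 3 * ε / 4 ≤ ρ) : innerCut ε ρ = 0 := by
  rw [innerCut, Real.smoothTransition.one_of_one_le, sub_self]
  rw [le_div_iff₀ (by linarith)]
  linarith

theorem blendCut_eq_zero {δ s : ℝ} (hδ : 0 < δ) (h : s ≤ δ / 3) : blendCut δ s = 0 :=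
  Real.smoothTransition.zero_of_nonpos
    (div_nonpos_of_nonpos_of_nonneg (by linarith) (by linarith))

theorem blendCut_eq_one {δ s : ℝ} (hδ : 0 < δ) (h : 2 * δ / 3 ≤ s) : blendCut δ s = 1 := by
  apply Real.smoothTransition.one_of_one_le
  rw [le_div_iff₀ (by linarith)]
  linarith

theorem blendCut_mem (δ s : ℝ) : blendCut δ s ∈ Icc (0 : ℝ) 1 :=
  ⟨Real.smoothTransition.nonneg _, Real.smoothTransition.le_one _⟩

theorem monotone_blendCut {δ : ℝ} (hδ : 0 < δ) : Monotone (blendCut δ) := fun s s' h =>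
  Real.smoothTransition.monotone (by gcongr)

theorem tailFun_pos {b s : ℝ} (h : s < b) : 0 < tailFun b s :=
  half_pos (expNegInvGlue.pos_of_pos (by linarith))

theorem tailFun_eq_zero {b s : ℝ} (h : b ≤ s) : tailFun b s = 0 := by
  rw [tailFun, expNegInvGlue.zero_of_nonpos (by linarith), zero_div]

/-- Since `R` is below 1 near the end, the tail stays below 1 / R. Hence shifting weight from 1 / R
to the tail only lowers the modulus. -/
theorem tailFun_le (b s : ℝ) : tailFun b s ≤ 1 / 2 := by
  have : expNegInvGlue (b - s) ≤ 1 := by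
    unfold expNegInvGlue
    split_ifs with h
    · exact zero_le_one
    · rw [Real.exp_le_one_iff]
      have := inv_pos.2 (not_le.1 h)
      linarith
  unfold tailFun
  linarith

theorem deriv_tailFun_neg {b s : ℝ} (h : s < b) : deriv (tailFun b) s < 0 := by
  have h1 := expNegInvGlue.hasDerivAt_polynomial_eval_inv_mul 1 (b - s)
  simp only [Polynomial.eval_one, one_mul, Polynomial.derivative_one, sub_zero, mul_one,
    Polynomial.eval_pow, Polynomial.eval_X] at h1
  have h2 := (h1.comp s ((hasDerivAt_id s).const_sub b)).div_const 2
  have h3 : deriv (tailFun b) s = _ := h2.deriv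
  rw [h3]
  have h4 := expNegInvGlue.pos_of_pos (sub_pos.2 h)
  have h5 : 0 < (b - s)⁻¹ := inv_pos.2 (sub_pos.2 h)
  have h6 := mul_pos (pow_pos h5 2) h4
  linarith

/-- Data for the construction of a function on an annulus from the coordinates of one end. -/
structure IsEndData (R : ℝ × ℝ → ℝ) (Λ : ℝ × ℝ → ℂ) (r δ ε b : ℝ) : Prop where
  coord : IsEndCoord R Λ r
  pos : 0 < δ
  lt : δ < r
  interp_ne : ∀ t, ∀ s ∈ Icc 0 δ, ∀ c ∈ Icc (0 : ℝ) 1, angleInterp Λ (t, s, c) ≠ 0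
  interp_inj : ∀ t t', ∀ s ∈ Icc 0 δ, ∀ s' ∈ Icc 0 δ, ∀ c ∈ Icc (0 : ℝ) 1,
    interpMap R Λ (t, s, c) = interpMap R Λ (t', s', c) → Circle.exp t = Circle.exp t' ∧ s = s'
  interp_imm : ∀ t ∈ Icc 0 (2 * Real.pi), ∀ s ∈ Icc 0 δ, ∀ c ∈ Icc (0 : ℝ) 1,
    Injective (fderivWithin ℝ (interpMap R Λ) (slabOf r) (t, s, c))
  fderiv_pos : ∀ t ∈ Icc 0 (2 * Real.pi), ∀ s ∈ Icc 0 δ,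
    0 < fderivWithin ℝ R (stripOf r) (t, s) (0, 1)
  eps_pos : 0 < ε
  eps_lt : ε < 1
  lt_of_lt : ∀ t, ∀ s ∈ Icc 0 r, R (t, s) < ε → s < δ / 3
  lt_end : δ < b

/-- The argument of `endFun`. -/
def endAngle (R : ℝ × ℝ → ℝ) (Λ : ℝ × ℝ → ℂ) (δ ε : ℝ) (x : ℝ × ℝ) : ℂ :=
  open scoped Classical in
  if x.2 < δ then (interpMap R Λ (x.1, x.2, innerCut ε (R x))).2.1 else Λ (x.1, 0)

/-- The modulus of `endFun`. -/
def endModulus (R : ℝ × ℝ → ℝ) (δ b : ℝ) (x : ℝ × ℝ) : ℝ :=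
  open scoped Classical in
  if x.2 < δ then (1 - blendCut δ x.2) * (R x)⁻¹ + blendCut δ x.2 * tailFun b x.2
  else tailFun b x.2

/-- A function on the annulus `ℝ / 2π × (0, 1)` which is equal to `Λ / R` near the end `0` and
vanishes near the end `1`, and which is an embedding of the complement of its zero set. -/
def endFun (R : ℝ × ℝ → ℝ) (Λ : ℝ × ℝ → ℂ) (δ ε b : ℝ) (x : ℝ × ℝ) : ℂ :=
  endModulus R δ b x • endAngle R Λ δ ε x

namespace IsEndData

variable {R : ℝ × ℝ → ℝ} {Λ : ℝ × ℝ → ℂ} {r δ ε b : ℝ}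

theorem norm_interp (h : IsEndData R Λ r δ ε b) {t s c : ℝ} (hs : s ∈ Icc 0 δ)
    (hc : c ∈ Icc (0 : ℝ) 1) : ‖(interpMap R Λ (t, s, c)).2.1‖ = 1 := by
  have := norm_ne_zero_iff.2 (h.interp_ne t s hs c hc)
  simp only [interpMap, norm_smul, norm_inv, norm_norm]
  exact inv_mul_cancel₀ this

theorem interp_zero (h : IsEndData R Λ r δ ε b) (t s : ℝ) :
    (interpMap R Λ (t, s, 0)).2.1 = Λ (t, 0) := by
  have := h.coord.norm_snd _ (h.coord.zero_mem t)
  simp [interpMap, angleInterp, this]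

theorem interp_one (h : IsEndData R Λ r δ ε b) (t : ℝ) {s : ℝ} (hs : s ∈ Icc 0 r) :
    (interpMap R Λ (t, s, 1)).2.1 = Λ (t, s) := by
  have := h.coord.norm_snd (t, s) ⟨mem_univ _, hs⟩
  simp [interpMap, angleInterp, this]

theorem mem_Icc (h : IsEndData R Λ r δ ε b) {s : ℝ} (hs : 0 < s) (hs' : s < δ) : s ∈ Icc 0 r :=
  ⟨hs.le, (hs'.trans h.lt).le⟩

theorem fst_pos (h : IsEndData R Λ r δ ε b) (t : ℝ) {s : ℝ} (hs : 0 < s) (hs' : s < δ) :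
    0 < R (t, s) := h.coord.fst_pos t s ⟨hs, (hs'.trans h.lt).le⟩

theorem norm_endAngle (h : IsEndData R Λ r δ ε b) (t : ℝ) {s : ℝ} (hs : 0 < s) :
    ‖endAngle R Λ δ ε (t, s)‖ = 1 := by
  unfold endAngle
  split_ifs with h1
  · exact h.norm_interp ⟨hs.le, le_of_lt h1⟩ (innerCut_mem _ _)
  · exact h.coord.norm_snd _ (h.coord.zero_mem t)

/-- The angular interpolation takes place where `R` is below ε, hence where s is below δ / 3, before
`blendCut` starts to act: angle and modulus are never modified at the same point. -/
theorem eps_le (h : IsEndData R Λ r δ ε b) {t s : ℝ} (hs : δ / 3 ≤ s) (hs' : s < δ) :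
    ε ≤ R (t, s) := by
  by_contra! h1
  have hp := h.pos
  have := h.lt_of_lt t s (h.mem_Icc (by linarith) hs') h1
  linarith

theorem endAngle_eq (h : IsEndData R Λ r δ ε b) {t s : ℝ}
    (h1 : s < δ → 3 * ε / 4 ≤ R (t, s)) : endAngle R Λ δ ε (t, s) = Λ (t, 0) := by
  unfold endAngle
  split_ifs with h2
  · rw [innerCut_eq_zero h.eps_pos (h1 h2)]
    exact h.interp_zero t s
  · rfl

theorem isOpen_inner (δ : ℝ) : IsOpen {x : ℝ × ℝ | 0 < x.2 ∧ x.2 < δ} :=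
  (isOpen_lt continuous_const continuous_snd).inter (isOpen_lt continuous_snd continuous_const)

theorem contDiffAt_fst (h : IsEndData R Λ r δ ε b) {x : ℝ × ℝ} (hx : 0 < x.2) (hx' : x.2 < δ) :
    ContDiffAt ℝ ∞ R x :=
  h.coord.contDiffOn_fst.contDiffAt
    (prod_mem_nhds univ_mem (Icc_mem_nhds hx (hx'.trans h.lt)))

theorem slab_mem_nhds (h : IsEndData R Λ r δ ε b) {x : ℝ × ℝ × ℝ} (hx : 0 < x.2.1)
    (hx' : x.2.1 < δ) : slabOf r ∈ 𝓝 x :=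
  prod_mem_nhds univ_mem (prod_mem_nhds (Icc_mem_nhds hx (hx'.trans h.lt)) univ_mem)

theorem contDiffAt_interp (h : IsEndData R Λ r δ ε b) {x : ℝ × ℝ} (hx : 0 < x.2)
    (hx' : x.2 < δ) :
    ContDiffAt ℝ ∞ (fun x : ℝ × ℝ => interpMap R Λ (x.1, x.2, innerCut ε (R x))) x := by
  have h1 : ContDiffAt ℝ ∞ (interpMap R Λ) (x.1, x.2, innerCut ε (R x)) :=
    (h.coord.contDiffWithinAt_interpMap ⟨mem_univ _, h.mem_Icc hx hx', mem_univ _⟩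
      (h.interp_ne _ _ ⟨hx.le, hx'.le⟩ _ (innerCut_mem _ _))).contDiffAt
      (h.slab_mem_nhds (x := (x.1, x.2, innerCut ε (R x))) hx hx')
  have h2 : ContDiffAt ℝ ∞ (fun x : ℝ × ℝ => (x.1, x.2, innerCut ε (R x))) x :=
    _root_.contDiffAt_fst.prodMk (contDiffAt_snd.prodMk
      ((contDiff_innerCut ε).contDiffAt.comp x (h.contDiffAt_fst hx hx')))
  exact h1.comp x h2

theorem endAngle_eventuallyEq_inner {x : ℝ × ℝ} (hx : x.2 < δ) :
    endAngle R Λ δ ε =ᶠ[𝓝 x] fun x => (interpMap R Λ (x.1, x.2, innerCut ε (R x))).2.1 := by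
  filter_upwards [(isOpen_lt continuous_snd continuous_const).mem_nhds hx] with y hy
  exact if_pos hy

theorem endAngle_eventuallyEq_outer (h : IsEndData R Λ r δ ε b) {x : ℝ × ℝ} (hx : 0 < x.2)
    (hx' : x.2 < δ → ε ≤ R x) : endAngle R Λ δ ε =ᶠ[𝓝 x] fun x => Λ (x.1, 0) := by
  by_cases h1 : x.2 < δ
  · have h2 : 3 * ε / 4 < R x := by linarith [hx' h1, h.eps_pos]
    filter_upwards [(h.contDiffAt_fst hx h1).continuousAt.eventually (lt_mem_nhds h2)] with y hy
    exact h.endAngle_eq fun _ => le_of_lt hy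
  · have h2 : δ / 3 < x.2 := by linarith [h.pos, not_lt.1 h1]
    filter_upwards [(isOpen_lt continuous_const continuous_snd).mem_nhds h2] with y hy
    refine h.endAngle_eq fun hy' => ?_
    have := h.eps_le (t := y.1) (le_of_lt hy) hy'
    linarith [h.eps_pos]

theorem contDiffAt_endAngle (h : IsEndData R Λ r δ ε b) {x : ℝ × ℝ} (hx : 0 < x.2) :
    ContDiffAt ℝ ∞ (endAngle R Λ δ ε) x := by
  by_cases h1 : x.2 < δ
  · exact ((h.contDiffAt_interp hx h1).snd.fst).congr_of_eventuallyEq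
      (endAngle_eventuallyEq_inner h1)
  · exact (h.coord.contDiff_zero.comp contDiff_fst).contDiffAt.congr_of_eventuallyEq
      (h.endAngle_eventuallyEq_outer hx fun h2 => (h1 h2).elim)

theorem endModulus_eventuallyEq_inner {x : ℝ × ℝ} (hx : x.2 < δ) :
    endModulus R δ b =ᶠ[𝓝 x]
      fun x => (1 - blendCut δ x.2) * (R x)⁻¹ + blendCut δ x.2 * tailFun b x.2 := by
  filter_upwards [(isOpen_lt continuous_snd continuous_const).mem_nhds hx] with y hy
  exact if_pos hy

theorem endModulus_eventuallyEq_outer (h : IsEndData R Λ r δ ε b) {x : ℝ × ℝ} (hx : δ ≤ x.2) :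
    endModulus R δ b =ᶠ[𝓝 x] fun x => tailFun b x.2 := by
  have h1 : 2 * δ / 3 < x.2 := by linarith [h.pos]
  filter_upwards [(isOpen_lt continuous_const continuous_snd).mem_nhds h1] with y hy
  unfold endModulus
  split_ifs
  · rw [blendCut_eq_one h.pos (le_of_lt hy)]
    ring
  · rfl

theorem contDiffAt_endModulus (h : IsEndData R Λ r δ ε b) {x : ℝ × ℝ} (hx : 0 < x.2) :
    ContDiffAt ℝ ∞ (endModulus R δ b) x := by
  have h3 : ContDiffAt ℝ ∞ (fun x : ℝ × ℝ => tailFun b x.2) x :=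
    ((contDiff_tailFun b).comp contDiff_snd).contDiffAt
  by_cases h1 : x.2 < δ
  · refine ContDiffAt.congr_of_eventuallyEq ?_ (endModulus_eventuallyEq_inner h1)
    have h2 : ContDiffAt ℝ ∞ (fun x : ℝ × ℝ => blendCut δ x.2) x :=
      ((contDiff_blendCut δ).comp contDiff_snd).contDiffAt
    exact ((contDiffAt_const.sub h2).mul ((h.contDiffAt_fst hx h1).inv
      (h.fst_pos x.1 hx h1).ne')).add (h2.mul h3)
  · exact h3.congr_of_eventuallyEq (h.endModulus_eventuallyEq_outer (not_lt.1 h1))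

theorem contDiffAt_endFun (h : IsEndData R Λ r δ ε b) {x : ℝ × ℝ} (hx : 0 < x.2) :
    ContDiffAt ℝ ∞ (endFun R Λ δ ε b) x :=
  (h.contDiffAt_endModulus hx).smul (h.contDiffAt_endAngle hx)

theorem endModulus_pos (h : IsEndData R Λ r δ ε b) (t : ℝ) {s : ℝ} (hs : 0 < s) (hs' : s < b) :
    0 < endModulus R δ b (t, s) := by
  have h1 := tailFun_pos hs'
  unfold endModulus
  split_ifs with h2
  · have h3 := blendCut_mem δ s
    have h4 := inv_pos.2 (h.fst_pos t hs h2)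
    rcases h3.2.eq_or_lt with h5 | h5
    · simp [h5, h1]
    · have := mul_pos (sub_pos.2 h5) h4
      have := mul_nonneg h3.1 h1.le
      simp only
      linarith
  · exact h1

theorem endModulus_eq_zero (h : IsEndData R Λ r δ ε b) (t : ℝ) {s : ℝ} (hs : b ≤ s) :
    endModulus R δ b (t, s) = 0 := by
  have h2 : ¬ s < δ := by linarith [h.lt_end]
  rw [endModulus, if_neg h2]
  exact tailFun_eq_zero hs

theorem endModulus_inner (h : IsEndData R Λ r δ ε b) {t s : ℝ} (hs : 0 < s) (hs' : s < δ)
    (hR : R (t, s) < ε) : endModulus R δ b (t, s) = (R (t, s))⁻¹ := by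
  have h1 := h.lt_of_lt t s (h.mem_Icc hs hs') hR
  rw [endModulus, if_pos hs', blendCut_eq_zero h.pos h1.le]
  ring

/-- With `endModulus_inner`, this makes 1 / ε a threshold: the modulus exceeds it where `R` is below
ε and nowhere else. The inner and outer regions thus have disjoint images. -/
theorem endModulus_le (h : IsEndData R Λ r δ ε b) {t s : ℝ} (hR : s < δ → ε ≤ R (t, s)) :
    endModulus R δ b (t, s) ≤ ε⁻¹ := by
  have h1 : tailFun b s ≤ ε⁻¹ := by
    have h2 := tailFun_le b s
    have h3 := (one_lt_inv₀ h.eps_pos).2 h.eps_lt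
    linarith
  unfold endModulus
  split_ifs with h2
  · have h3 := blendCut_mem δ s
    have h4 : (R (t, s))⁻¹ ≤ ε⁻¹ := inv_anti₀ h.eps_pos (hR h2)
    have h5 := mul_le_mul_of_nonneg_left h4 (sub_nonneg.2 h3.2)
    have h6 := mul_le_mul_of_nonneg_left h1 h3.1
    simp only
    linarith
  · exact h1

/-- For s below δ the derivative is the sum of three nonpositive terms: the growth of the cutoff
times (tail − 1 / R), the decrease of 1 / R with weight 1 − χ, and the decrease of the tail with
weight χ. The last two do not vanish together. -/
theorem deriv_endModulus_neg (h : IsEndData R Λ r δ ε b) {t s : ℝ} (ht : t ∈ Icc 0 (2 * Real.pi))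
    (hs : 0 < s) (hs' : s < b) : deriv (fun s => endModulus R δ b (t, s)) s < 0 := by
  have hφ : HasDerivAt (tailFun b) (deriv (tailFun b) s) s :=
    ((contDiff_tailFun b).differentiable (by simp) s).hasDerivAt
  have hφ' := deriv_tailFun_neg hs'
  have htend : Tendsto (fun s : ℝ => (t, s)) (𝓝 s) (𝓝 (t, s)) :=
    (by fun_prop : Continuous fun s : ℝ => (t, s)).tendsto _
  by_cases h1 : s < δ
  · have hχ : HasDerivAt (blendCut δ) (deriv (blendCut δ) s) s :=
      ((contDiff_blendCut δ).differentiable (by simp) s).hasDerivAt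
    have hχ' : 0 ≤ deriv (blendCut δ) s := (monotone_blendCut h.pos).deriv_nonneg
    have hR0 := h.fst_pos t hs h1
    have hmem : stripOf r ∈ 𝓝 (t, s) :=
      prod_mem_nhds univ_mem (Icc_mem_nhds hs (h1.trans h.lt))
    have hR1 := ((h.coord.contDiffOn_fst _ (mem_of_mem_nhds hmem)).differentiableWithinAt
      (by simp)).hasFDerivWithinAt.hasFDerivAt hmem
    have hi : HasDerivAt (fun s : ℝ => (t, s)) ((0 : ℝ), (1 : ℝ)) s :=
      (hasDerivAt_const s t).prodMk (hasDerivAt_id s)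
    have hR : HasDerivAt (fun s => R (t, s)) (fderivWithin ℝ R (stripOf r) (t, s) (0, 1)) s :=
      hR1.comp_hasDerivAt s hi
    have hR' := h.fderiv_pos t ht s ⟨hs.le, h1.le⟩
    set ρ := fderivWithin ℝ R (stripOf r) (t, s) (0, 1)
    have hd := (((hχ.const_sub 1).mul (hR.inv hR0.ne')).add (hχ.mul hφ)).congr_of_eventuallyEq
      (f₁ := fun s => endModulus R δ b (t, s)) (htend.eventually (endModulus_eventuallyEq_inner h1))
    rw [hd.deriv]
    have h2 : 1 < (R (t, s))⁻¹ := (one_lt_inv₀ hR0).2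
      (h.coord.fst_lt_one _ (mem_of_mem_nhds hmem))
    have h3 := tailFun_le b s
    have h4 := blendCut_mem δ s
    have h5 : 0 ≤ deriv (blendCut δ) s * ((R (t, s))⁻¹ - tailFun b s) :=
      mul_nonneg hχ' (by linarith)
    have h6 : 0 < ρ / R (t, s) ^ 2 := by positivity
    have h7 : 0 < (1 - blendCut δ s) * (ρ / R (t, s) ^ 2) -
        blendCut δ s * deriv (tailFun b) s := by
      rcases h4.1.eq_or_lt with h8 | h8
      · rw [← h8]
        linarith
      · have := mul_pos_of_neg_of_neg hφ' (neg_lt_zero.2 h8)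
        have := mul_nonneg (sub_nonneg.2 h4.2) h6.le
        linarith
    simp only [neg_div, Pi.inv_apply]
    linarith
  · have hd := hφ.congr_of_eventuallyEq (f₁ := fun s => endModulus R δ b (t, s))
      (htend.eventually (h.endModulus_eventuallyEq_outer (not_lt.1 h1)))
    rw [hd.deriv]
    exact hφ'

theorem strictAntiOn_endModulus (h : IsEndData R Λ r δ ε b) {t : ℝ}
    (ht : t ∈ Icc 0 (2 * Real.pi)) :
    StrictAntiOn (fun s => endModulus R δ b (t, s)) (Ioo 0 b) := by
  refine strictAntiOn_of_deriv_neg (convex_Ioo 0 b) ?_ ?_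
  · intro s hs
    have h1 := (h.contDiffAt_endModulus (x := (t, s)) hs.1).continuousAt
    exact (h1.comp (f := fun s : ℝ => (t, s)) (by fun_prop)).continuousWithinAt
  · intro s hs
    rw [interior_Ioo] at hs
    exact h.deriv_endModulus_neg ht hs.1 hs.2

theorem norm_endFun (h : IsEndData R Λ r δ ε b) (t : ℝ) {s : ℝ} (hs : 0 < s) :
    ‖endFun R Λ δ ε b (t, s)‖ = endModulus R δ b (t, s) := by
  have h0 : 0 ≤ endModulus R δ b (t, s) := by
    by_cases h1 : s < b
    · exact (h.endModulus_pos t hs h1).le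
    · exact (h.endModulus_eq_zero t (not_lt.1 h1)).ge
  rw [endFun, norm_smul, h.norm_endAngle t hs, mul_one, Real.norm_of_nonneg h0]

theorem endFun_eq_zero_iff (h : IsEndData R Λ r δ ε b) {t s : ℝ} (hs : 0 < s) :
    endFun R Λ δ ε b (t, s) = 0 ↔ b ≤ s := by
  rw [← norm_eq_zero, h.norm_endFun t hs]
  refine ⟨fun h1 => ?_, fun h1 => h.endModulus_eq_zero t h1⟩
  by_contra! h2
  exact (h.endModulus_pos t hs h2).ne' h1

theorem endFun_inner (h : IsEndData R Λ r δ ε b) {t s : ℝ} (hs : s ∈ Ioc 0 r)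
    (hR : R (t, s) ≤ ε / 2) : endFun R Λ δ ε b (t, s) = (R (t, s))⁻¹ • Λ (t, s) := by
  have hR' : R (t, s) < ε := by linarith [h.eps_pos]
  have h1 := h.lt_of_lt t s ⟨hs.1.le, hs.2⟩ hR'
  have h2 : s < δ := by linarith [h.pos]
  rw [endFun, h.endModulus_inner hs.1 h2 hR', endAngle, if_pos h2,
    innerCut_eq_one h.eps_pos hR, h.interp_one t ⟨hs.1.le, hs.2⟩]

theorem endFun_congr (h : IsEndData R Λ r δ ε b) {t t' s : ℝ} (hs : 0 < s)
    (he : Circle.exp t = Circle.exp t') :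
    endFun R Λ δ ε b (t, s) = endFun R Λ δ ε b (t', s) := by
  unfold endFun endModulus endAngle
  by_cases h1 : s < δ
  · simp only [if_pos h1, h.coord.congr_fst t t' s (h.mem_Icc hs h1) he,
      h.coord.interpMap_congr _ (h.mem_Icc hs h1) he]
  · simp only [if_neg h1, h.coord.congr_snd t t' 0 ⟨le_rfl, h.coord.pos.le⟩ he]

/-- The modulus tells which of the two regions a point is in. In the inner region it determines `R`,
and injectivity of the interpolated coordinates applies; in the outer region the argument Λ(t, 0)
determines the angle, and the modulus is strictly decreasing in s. -/
theorem endFun_inj (h : IsEndData R Λ r δ ε b) {t t' s s' : ℝ} (ht : t ∈ Icc 0 (2 * Real.pi))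
    (hs : 0 < s) (hs' : 0 < s')
    (hb : s < b) (hb' : s' < b) (he : endFun R Λ δ ε b (t, s) = endFun R Λ δ ε b (t', s')) :
    Circle.exp t = Circle.exp t' ∧ s = s' := by
  have hV : endModulus R δ b (t, s) = endModulus R δ b (t', s') := by
    rw [← h.norm_endFun t hs, ← h.norm_endFun t' hs', he]
  have hU : endAngle R Λ δ ε (t, s) = endAngle R Λ δ ε (t', s') := by
    rw [endFun, endFun, hV] at he
    exact smul_right_injective ℂ (h.endModulus_pos t' hs' hb').ne' he
  have hmix : ∀ {t t' s s' : ℝ}, 0 < s → s < δ → R (t, s) < ε → (s' < δ → ε ≤ R (t', s')) →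
      endModulus R δ b (t, s) ≠ endModulus R δ b (t', s') := by
    intro t t' s s' h1 h2 h3 h4 h5
    rw [h.endModulus_inner h1 h2 h3] at h5
    have h6 := h.endModulus_le h4
    have h7 := (inv_lt_inv₀ h.eps_pos (h.fst_pos t h1 h2)).2 h3
    linarith
  by_cases hA : s < δ ∧ R (t, s) < ε
  · by_cases hA' : s' < δ ∧ R (t', s') < ε
    · rw [h.endModulus_inner hs hA.1 hA.2, h.endModulus_inner hs' hA'.1 hA'.2, inv_inj] at hV
      rw [endAngle, endAngle, if_pos hA.1, if_pos hA'.1, hV] at hU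
      refine h.interp_inj t t' s ⟨hs.le, hA.1.le⟩ s' ⟨hs'.le, hA'.1.le⟩ _
        (innerCut_mem ε (R (t', s'))) ?_
      exact Prod.ext hV (Prod.ext hU rfl)
    · push Not at hA'
      exact (hmix hs hA.1 hA.2 hA' hV).elim
  · push Not at hA
    by_cases hA' : s' < δ ∧ R (t', s') < ε
    · exact (hmix hs' hA'.1 hA'.2 hA hV.symm).elim
    · push Not at hA'
      have hε := h.eps_pos
      rw [h.endAngle_eq fun h1 => (by linarith : 3 * ε / 4 ≤ ε).trans (hA h1),
        h.endAngle_eq fun h1 => (by linarith : 3 * ε / 4 ≤ ε).trans (hA' h1)] at hU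
      have hexp := h.coord.snd_inj t t' hU
      refine ⟨hexp, ?_⟩
      -- Monotonicity is known on a single segment t = const, so the second point is moved to the
      -- representative t of its angle.
      have hp : endModulus R δ b (t', s') = endModulus R δ b (t, s') := by
        rw [← h.norm_endFun t' hs', ← h.norm_endFun t hs', h.endFun_congr hs' hexp]
      rw [hp] at hV
      exact (h.strictAntiOn_endModulus ht).injOn ⟨hs, hb⟩ ⟨hs', hb'⟩ hV

theorem injective_fderiv_endFun (h : IsEndData R Λ r δ ε b) {t s : ℝ}
    (ht : t ∈ Icc 0 (2 * Real.pi)) (hs : 0 < s) (hb : s < b) :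
    Injective (fderiv ℝ (endFun R Λ δ ε b) (t, s)) := by
  have hg := ((h.contDiffAt_endFun (x := (t, s)) hs).differentiableAt (by simp)).hasFDerivAt
  have hg0 : endFun R Λ δ ε b (t, s) ≠ 0 := by
    rw [Ne, h.endFun_eq_zero_iff hs]
    linarith
  have hpos : ∀ᶠ x : ℝ × ℝ in 𝓝 (t, s), 0 < x.2 ∧ x.2 < b :=
    (isOpen_inner b).mem_nhds ⟨hs, hb⟩
  have hnorm : ∀ᶠ x : ℝ × ℝ in 𝓝 (t, s),
      ‖endFun R Λ δ ε b x‖ = endModulus R δ b x ∧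
      ‖endFun R Λ δ ε b x‖⁻¹ • endFun R Λ δ ε b x = endAngle R Λ δ ε x := by
    filter_upwards [hpos] with x hx
    have h1 := h.norm_endFun x.1 hx.1
    refine ⟨h1, ?_⟩
    have h2 := (h.endModulus_pos x.1 hx.1 hx.2).ne'
    rw [Prod.mk.eta] at h1 h2
    rw [h1, endFun, smul_smul, inv_mul_cancel₀ h2, one_smul]
  have hN : DifferentiableAt ℝ (fun z : ℂ => ‖z‖) (endFun R Λ δ ε b (t, s)) :=
    (contDiffAt_norm ℝ hg0).differentiableAt (by simp : (∞ : WithTop ℕ∞) ≠ 0)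
  have hNi : DifferentiableAt ℝ (fun z : ℂ => ‖z‖⁻¹) (endFun R Λ δ ε b (t, s)) :=
    hN.inv (norm_ne_zero_iff.2 hg0)
  have hA : DifferentiableAt ℝ (fun z : ℂ => ‖z‖⁻¹ • z) (endFun R Λ δ ε b (t, s)) :=
    hNi.smul differentiableAt_id
  refine (injective_iff_map_eq_zero _).2 fun v hv => ?_
  by_cases hAin : s < δ ∧ R (t, s) < ε
  · obtain ⟨h1, h2⟩ := hAin
    have hR := ((h.contDiffAt_fst (x := (t, s)) hs h1).continuousAt).eventually (gt_mem_nhds h2)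
    have hin : ∀ᶠ x : ℝ × ℝ in 𝓝 (t, s), 0 < x.2 ∧ x.2 < δ := (isOpen_inner δ).mem_nhds ⟨hs, h1⟩
    have hT := ((h.contDiffAt_interp (x := (t, s)) hs h1).differentiableAt
      (by simp)).hasFDerivAt
    have hκ : DifferentiableAt ℝ (innerCut ε) (‖endFun R Λ δ ε b (t, s)‖⁻¹) :=
      (contDiff_innerCut ε).differentiable (by simp) _
    -- From the value of `endFun`, the inverse modulus gives `R`, the normalized value gives the
    -- argument, and `innerCut` of the former gives c. So the composite of `interpMap` with the
    -- graph of c is recovered, and that composite is an immersion.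
    have hH : DifferentiableAt ℝ (fun z : ℂ => (‖z‖⁻¹, ‖z‖⁻¹ • z, innerCut ε ‖z‖⁻¹))
        (endFun R Λ δ ε b (t, s)) := hNi.prodMk (hA.prodMk (DifferentiableAt.comp
        (g := innerCut ε) (f := fun z : ℂ => ‖z‖⁻¹) _ hκ hNi))
    have h3 := hT.apply_eq_zero_of_comp hg hH (by
      filter_upwards [hnorm, hR, hin] with x hx hxR hxi
      have h4 := h.endModulus_inner (t := x.1) hxi.1 hxi.2 hxR
      have h5 : ‖endFun R Λ δ ε b x‖⁻¹ = R x := by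
        rw [hx.1]
        exact (congrArg _ h4).trans (inv_inv _)
      have h6 : endAngle R Λ δ ε x = _ := if_pos hxi.2
      refine Prod.ext h5.symm (Prod.ext ?_ ?_)
      · exact (hx.2.trans h6).symm
      · exact (congrArg (innerCut ε) h5).symm) hv
    have hj : HasFDerivAt (fun x : ℝ × ℝ => (x.1, x.2, innerCut ε (R x)))
        ((ContinuousLinearMap.fst ℝ ℝ ℝ).prod ((ContinuousLinearMap.snd ℝ ℝ ℝ).prod
          (fderiv ℝ (fun x => innerCut ε (R x)) (t, s)))) (t, s) := by
      refine hasFDerivAt_fst.prodMk (hasFDerivAt_snd.prodMk ?_)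
      exact (((contDiff_innerCut ε).contDiffAt.comp (t, s)
        (h.contDiffAt_fst (x := (t, s)) hs h1)).differentiableAt (by simp)).hasFDerivAt
    have hmem := h.slab_mem_nhds (x := (t, s, innerCut ε (R (t, s)))) hs h1
    have hI := ((h.coord.contDiffWithinAt_interpMap (mem_of_mem_nhds hmem)
      (h.interp_ne _ _ ⟨hs.le, h1.le⟩ _ (innerCut_mem _ _))).differentiableWithinAt
      (by simp)).hasFDerivWithinAt.hasFDerivAt hmem
    have h4 := DFunLike.congr_fun (hT.unique (HasFDerivAt.comp
      (f := fun x : ℝ × ℝ => (x.1, x.2, innerCut ε (R x))) (t, s) hI hj)) v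
    rw [h3] at h4
    have h5 := h.interp_imm t ht s ⟨hs.le, h1.le⟩ _ (innerCut_mem ε (R (t, s)))
      (h4.symm.trans (map_zero _).symm)
    have h6 : v.1 = 0 := congrArg Prod.fst h5
    have h7 : v.2 = 0 := congrArg (fun z : ℝ × ℝ × ℝ => z.2.1) h5
    exact Prod.ext h6 h7
  · push Not at hAin
    -- In the outer region the argument depends only on t, which kills the first component of the
    -- vector; the strictly decreasing modulus kills the second.
    have hU := h.endAngle_eventuallyEq_outer (x := (t, s)) hs hAin
    have h0 := HasFDerivAt.comp (g := fun t => Λ (t, 0)) (f := Prod.fst) (t, s)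
      (h.coord.hasDerivAt_zero t).hasFDerivAt (hasFDerivAt_fst (𝕜 := ℝ) (p := (t, s)))
    have h1 := h0.apply_eq_zero_of_comp hg hA (by
      filter_upwards [hnorm, hU] with x hx hxU
      exact (hx.2.trans hxU).symm) hv
    have h2 : v.1 • fderivWithin ℝ Λ (stripOf r) (t, 0) (1, 0) = 0 := by simpa using h1
    have h3 : v.1 = 0 := (smul_eq_zero.1 h2).resolve_right (h.coord.deriv_zero_ne t)
    have hV := ((h.contDiffAt_endModulus (x := (t, s)) hs).differentiableAt (by simp)).hasFDerivAt
    have h4 := hV.apply_eq_zero_of_comp hg hN (by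
      filter_upwards [hnorm] with x hx
      exact hx.1.symm) hv
    have hi : HasDerivAt (fun s : ℝ => (t, s)) ((0 : ℝ), (1 : ℝ)) s :=
      (hasDerivAt_const s t).prodMk (hasDerivAt_id s)
    have h5 : HasDerivAt (fun s => endModulus R δ b (t, s)) _ s := hV.comp_hasDerivAt s hi
    have h6 := h.deriv_endModulus_neg ht hs hb
    rw [h5.deriv] at h6
    have h7 : v = v.2 • ((0 : ℝ), (1 : ℝ)) := Prod.ext (by simp [h3]) (by simp)
    rw [h7, map_smul, smul_eq_mul] at h4
    rw [h7, (mul_eq_zero.1 h4).resolve_right h6.ne, zero_smul]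

end IsEndData

end

/-! ### Pages in collar coordinates -/

section

variable {M : Type*} [TopologicalSpace M] [ChartedSpace (EuclideanSpace ℝ (Fin 3)) M]
  {B : Set M} {π : M → Circle} {T : Bool → ℝ × ℂ → M}

theorem hasDerivAt_coe_circleExp (t : ℝ) :
    HasDerivAt (fun t : ℝ => (Circle.exp t : ℂ)) (Circle.exp t * Complex.I) t := by
  have h := ((hasDerivAt_id (t : ℝ)).ofReal_comp.mul_const Complex.I).cexp
  simpa [Circle.coe_exp] using h

theorem IsCollars.injective_mfderiv_coord [IsManifold (𝓡 3) ∞ M] (hT : IsCollars B π T) (i : Bool)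
    (p : ℝ × ℂ) : Injective (mfderiv (𝓡 3) 𝓘(ℝ, ℂ × ℂ) (collarCoord (T i)) (T i p)) := by
  refine (injective_iff_map_eq_zero _).2 fun v hv => ?_
  have hd : finrank ℝ (ℝ × ℂ) = finrank ℝ (EuclideanSpace ℝ (Fin 3)) := by simp
  obtain ⟨w, rfl⟩ := Manifold.surjective_mfderiv_of_injective hd (hT.injective_mfderiv i p) v
  have hTd := ((hT.contMDiff i p).mdifferentiableAt (by simp)).hasMFDerivAt
  have hc := (((hT.contMDiffOn_coord i).contMDiffAt
    ((hT.isOpenMap i).isOpen_range.mem_nhds ⟨p, rfl⟩)).mdifferentiableAt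
    (by simp : (∞ : WithTop ℕ∞) ≠ 0)).hasMFDerivAt
  have h1 := hc.comp p hTd
  have h2 : HasFDerivAt (fun q : ℝ × ℂ => ((Circle.exp q.1 : ℂ), q.2))
      ((((1 : ℝ →L[ℝ] ℝ).smulRight ((Circle.exp p.1 : ℂ) * Complex.I)).comp
        (ContinuousLinearMap.fst ℝ ℝ ℂ)).prod (ContinuousLinearMap.snd ℝ ℝ ℂ)) p :=
    (HasFDerivAt.comp (g := fun t : ℝ => (Circle.exp t : ℂ)) (f := Prod.fst) p
      (hasDerivAt_coe_circleExp p.1).hasFDerivAt hasFDerivAt_fst).prodMk hasFDerivAt_snd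
  have h3 := h1.congr_of_eventuallyEq (f₁ := fun q : ℝ × ℂ => ((Circle.exp q.1 : ℂ), q.2))
    (Eventually.of_forall fun q => (hT.coord_apply i q.1 q.2).symm)
  have h4 := DFunLike.congr_fun (hasMFDerivAt_unique h3 h2.hasMFDerivAt) w
  have h5 : (w.1 • ((Circle.exp p.1 : ℂ) * Complex.I), w.2) = (0 : ℂ × ℂ) := h4.symm.trans hv
  have h6 : w.1 = 0 := (smul_eq_zero.1 (congrArg Prod.fst h5)).resolve_right
    (mul_ne_zero (Circle.coe_ne_zero _) Complex.I_ne_zero)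
  have h7 : w.2 = 0 := congrArg Prod.snd h5
  have h8 : w = 0 := Prod.ext h6 h7
  rw [h8]
  exact map_zero (mfderiv 𝓘(ℝ, ℝ × ℂ) (𝓡 3) (T i) p)

namespace IsPageParam

variable {θ : Circle} {J : ℝ × ℝ → M}

theorem congr_exp (hJ : IsPageParam B π θ J) {t t' s : ℝ} (hs : s ∈ Icc (0 : ℝ) 1)
    (he : Circle.exp t = Circle.exp t') : J (t, s) = J (t', s) :=
  (hJ.eq_iff t t' s hs s hs).2 ⟨he, rfl⟩

theorem isCompact_image (hJ : IsPageParam B π θ J) {a b : ℝ} (ha : 0 ≤ a) (hb : b ≤ 1) :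
    IsCompact (J '' (univ ×ˢ Icc a b)) := by
  have h1 : J '' (univ ×ˢ Icc a b) = J '' (Icc 0 (2 * Real.pi) ×ˢ Icc a b) := by
    apply subset_antisymm
    · rintro _ ⟨⟨t, s⟩, ⟨-, hs⟩, rfl⟩
      obtain ⟨t', ht', he⟩ := exists_mem_Icc_circleExp_eq t
      exact ⟨(t', s), ⟨ht', hs⟩, hJ.congr_exp ⟨ha.trans hs.1, hs.2.trans hb⟩ he⟩
    · exact image_mono (prod_mono_left (subset_univ _))
  rw [h1]
  refine (isCompact_Icc.prod isCompact_Icc).image_of_continuousOn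
    (hJ.contMDiffOn.continuousOn.mono ?_)
  rintro ⟨t, s⟩ ⟨-, hs⟩
  exact ⟨mem_univ _, ha.trans hs.1, hs.2.trans hb⟩

theorem exists_strip_subset (hJ : IsPageParam B π θ J) {N : Set M} (hN : IsOpen N)
    (h : ∀ t, J (t, 0) ∈ N) : ∃ r ∈ Ioo (0 : ℝ) 1, ∀ t, ∀ s ∈ Icc 0 r, J (t, s) ∈ N := by
  have hc : Continuous (fun p : ℝ × ℝ => J (p.2, (projIcc (0 : ℝ) 1 zero_le_one p.1 : ℝ))) :=
    hJ.contMDiffOn.continuousOn.comp_continuous (by fun_prop) fun p => ⟨mem_univ _, Subtype.mem _⟩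
  have h1 : ∀ t ∈ Icc 0 (2 * Real.pi), ∀ᶠ p : ℝ × ℝ in 𝓝 (0, t),
      J (p.2, (projIcc (0 : ℝ) 1 zero_le_one p.1 : ℝ)) ∈ N := by
    intro t _
    refine hc.continuousAt.eventually (hN.mem_nhds ?_)
    change J (t, (projIcc (0 : ℝ) 1 zero_le_one 0 : ℝ)) ∈ N
    rw [projIcc_left]
    exact h t
  have h2 := (isCompact_Icc (a := (0 : ℝ)) (b := 2 * Real.pi)).eventually_forall_of_forall_eventually
    (x₀ := (0 : ℝ)) (P := fun s t => J (t, (projIcc (0 : ℝ) 1 zero_le_one s : ℝ)) ∈ N) h1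
  obtain ⟨ε, hε, h3⟩ := Metric.eventually_nhds_iff.1 h2
  have hr : 0 < min (ε / 2) (1 / 2) := lt_min (by positivity) (by norm_num)
  have hr1 : min (ε / 2) (1 / 2) ≤ 1 / 2 := min_le_right _ _
  have hr2 : min (ε / 2) (1 / 2) ≤ ε / 2 := min_le_left _ _
  refine ⟨min (ε / 2) (1 / 2), ⟨hr, by linarith⟩, fun t s hs => ?_⟩
  obtain ⟨t', ht', he⟩ := exists_mem_Icc_circleExp_eq t
  have hs1 : s ∈ Icc (0 : ℝ) 1 := ⟨hs.1, by linarith [hs.2]⟩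
  rw [hJ.congr_exp hs1 he.symm]
  have h4 : dist s 0 < ε := by
    rw [Real.dist_eq, sub_zero, abs_of_nonneg hs.1]
    linarith [hs.2]
  have h5 := h3 h4 t' ht'
  rwa [projIcc_of_mem zero_le_one hs1] at h5

/-- The coordinates of a page near one of its ends, provided by a collar. -/
theorem isEndCoord [IsManifold (𝓡 3) ∞ M] (hJ : IsPageParam B π θ J) (hT : IsCollars B π T)
    (i : Bool) (h0 : ∀ t, ∃ t', J (t, 0) = T i (t', 0)) {r : ℝ} (hr : r ∈ Ioo (0 : ℝ) 1)
    (hN : ∀ t, ∀ s ∈ Icc 0 r, J (t, s) ∈ T i '' {p | ‖p.2‖ < 1}) :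
    IsEndCoord (fun x => ((collarCoord (T i) (J x)).2 * (starRingEnd ℂ) (θ : ℂ)).re)
      (fun x => (collarCoord (T i) (J x)).1) r := by
  have hsub : stripOf r ⊆ strip := fun x hx => ⟨mem_univ _, hx.2.1, hx.2.2.trans hr.2.le⟩
  have hmem : ∀ x ∈ stripOf r, ∃ t z, ‖z‖ < 1 ∧ J x = T i (t, z) := by
    rintro ⟨t, s⟩ hx
    obtain ⟨⟨t', z⟩, hz, he⟩ := hN t s hx.2
    exact ⟨t', z, hz, he.symm⟩
  have hθ : (θ : ℂ) * (starRingEnd ℂ) (θ : ℂ) = 1 := by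
    rw [Complex.mul_conj, Complex.normSq_eq_norm_sq]
    simp [Circle.norm_coe]
  -- On the page over θ the normal coordinate is z = ‖z‖ θ. Thus ‖z‖ is the real part of z times the
  -- conjugate of θ, which is smooth up to the boundary although the norm is not smooth at 0.
  have hdiv : ∀ x ∈ stripOf r, ∀ t z, J x = T i (t, z) →
      z = ‖z‖ * (θ : ℂ) ∧ (0 < x.2 → z ≠ 0) := by
    rintro ⟨t, s⟩ hx t' z he
    rcases hx.2.1.eq_or_lt with hs | hs
    · obtain ⟨t₁, h1⟩ := h0 t
      have hs' : s = 0 := hs.symm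
      subst hs'
      have h2 := ((hT.eq_iff _ _ _ _ _ _).1 (he.symm.trans h1)).2.2
      refine ⟨by simp [h2], fun h => (lt_irrefl _ h).elim⟩
    · have h1 := (hJ.mem_page (J (t, s))).2 ⟨t, s, ⟨hs, hx.2.2.trans_lt hr.2⟩, rfl⟩
      rw [he, hT.not_mem_binding] at h1
      refine ⟨?_, fun _ => h1.1⟩
      have h2 := hT.proj_eq i t' z h1.1
      rwa [h1.2] at h2
  have hR : ∀ x ∈ stripOf r, ∀ t z, J x = T i (t, z) →
      ((collarCoord (T i) (J x)).2 * (starRingEnd ℂ) (θ : ℂ)).re = ‖z‖ := by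
    intro x hx t z he
    rw [he, hT.coord_apply]
    simp only
    rw [(hdiv x hx t z he).1, mul_assoc, hθ, mul_one, Complex.ofReal_re]
    simp [Circle.norm_coe]
  have hrange : ∀ x ∈ stripOf r, J x ∈ range (T i) := fun x hx => by
    obtain ⟨t, z, -, he⟩ := hmem x hx
    exact ⟨_, he.symm⟩
  have hcoord : ContDiffOn ℝ ∞ (fun x => collarCoord (T i) (J x)) (stripOf r) := by
    rw [← contMDiffOn_iff_contDiffOn]
    exact (hT.contMDiffOn_coord i).comp (hJ.contMDiffOn.mono hsub) hrange
  refine ⟨hr.1, ?_, hcoord.fst, ?_, ?_, ?_, ?_, ?_, ?_, ?_, ?_⟩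
  · exact Complex.reCLM.contDiff.comp_contDiffOn (hcoord.snd.mul contDiffOn_const)
  · intro t t' s hs he
    rw [hJ.congr_exp ⟨hs.1, hs.2.trans hr.2.le⟩ he]
  · intro t t' s hs he
    rw [hJ.congr_exp ⟨hs.1, hs.2.trans hr.2.le⟩ he]
  · intro x hx
    obtain ⟨t, z, -, he⟩ := hmem x hx
    rw [he, hT.coord_apply]
    exact Circle.norm_coe _
  · intro t
    obtain ⟨t₁, h1⟩ := h0 t
    rw [h1, hT.coord_apply]
    simp
  · intro t s hs
    have hx : (t, s) ∈ stripOf r := ⟨mem_univ _, hs.1.le, hs.2⟩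
    obtain ⟨t', z, -, he⟩ := hmem _ hx
    rw [hR _ hx t' z he]
    exact norm_pos_iff.2 ((hdiv _ hx t' z he).2 hs.1)
  · intro x hx
    obtain ⟨t', z, hz, he⟩ := hmem _ hx
    rw [hR _ hx t' z he]
    exact hz
  · intro t t' he
    obtain ⟨t₁, h1⟩ := h0 t
    obtain ⟨t₂, h2⟩ := h0 t'
    simp only [h1, h2, hT.coord_apply] at he
    have h3 : J (t, 0) = J (t', 0) := by
      rw [h1, h2]
      exact hT.congr_exp i (Circle.coe_injective he) 0
    exact ((hJ.eq_iff t t' 0 ⟨le_rfl, zero_le_one⟩ 0 ⟨le_rfl, zero_le_one⟩).1 h3).1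
  · intro t
    have hx : (t, (0 : ℝ)) ∈ stripOf r := ⟨mem_univ _, le_rfl, hr.1.le⟩
    have hu : UniqueDiffWithinAt ℝ (stripOf r) (t, 0) :=
      (uniqueDiffOn_univ.prod (uniqueDiffOn_Icc hr.1)) _ hx
    obtain ⟨t', h1⟩ := h0 t
    set κ := collarCoord (T i) with hκ
    have hRd : DifferentiableWithinAt ℝ (fun x => ((κ (J x)).2 * (starRingEnd ℂ) (θ : ℂ)).re)
        (stripOf r) (t, 0) :=
      ((Complex.reCLM.contDiff.comp_contDiffOn (hcoord.snd.mul contDiffOn_const)) _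
        hx).differentiableWithinAt (by simp)
    have hΛd : DifferentiableWithinAt ℝ (fun x => (κ (J x)).1) (stripOf r) (t, 0) :=
      (hcoord.fst _ hx).differentiableWithinAt (by simp)
    have hd := (hRd.prodMk hΛd).hasFDerivWithinAt
    set L := fderivWithin ℝ (fun x => (((κ (J x)).2 * (starRingEnd ℂ) (θ : ℂ)).re, (κ (J x)).1))
      (stripOf r) (t, 0)
    refine (injective_iff_map_eq_zero _).2 fun v hv => ?_
    -- The linear map (R, Λ) ↦ (Λ, Rθ) restores the collar coordinates on the page, so the kernel of
    -- d(R, Λ) is contained in that of the page immersion.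
    let A : ℝ × ℂ →L[ℝ] ℂ × ℂ := (ContinuousLinearMap.snd ℝ ℝ ℂ).prod
      (((1 : ℝ →L[ℝ] ℝ).smulRight (θ : ℂ)).comp (ContinuousLinearMap.fst ℝ ℝ ℂ))
    have hAd := (A.hasFDerivAt (x := (((κ (J (t, 0))).2 * (starRingEnd ℂ) (θ : ℂ)).re,
      (κ (J (t, 0))).1))).comp_hasFDerivWithinAt (t, 0) hd
    have hpt : ∀ x ∈ stripOf r, κ (J x) =
        A (((κ (J x)).2 * (starRingEnd ℂ) (θ : ℂ)).re, (κ (J x)).1) := by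
      intro x hx
      obtain ⟨t', z, -, he⟩ := hmem _ hx
      refine Prod.ext rfl ?_
      have h2 := hR x hx t' z he
      have h3 := (hdiv x hx t' z he).1
      change (κ (J x)).2 = ((κ (J x)).2 * (starRingEnd ℂ) (θ : ℂ)).re • (θ : ℂ)
      rw [h2, he, hκ, hT.coord_apply, Complex.real_smul]
      exact h3
    have hκd := hAd.congr (f₁ := fun x => κ (J x)) hpt (hpt _ hx)
    have hJd := ((hJ.contMDiffOn _ (hsub hx)).mdifferentiableWithinAt
      (by simp)).hasMFDerivWithinAt
    have hκm : HasMFDerivAt (𝓡 3) 𝓘(ℝ, ℂ × ℂ) κ (J (t, 0)) _ :=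
      (((hT.contMDiffOn_coord i).contMDiffAt
        ((hT.isOpenMap i).isOpen_range.mem_nhds (hrange _ hx))).mdifferentiableAt
        (by simp : (∞ : WithTop ℕ∞) ≠ 0)).hasMFDerivAt
    have h2 := (hκm.comp_hasMFDerivWithinAt (t, 0) (hJd.mono hsub)).hasFDerivWithinAt
    have h3 := DFunLike.congr_fun (hu.eq hκd h2) v
    have h4 : (A.comp L) v = 0 := (congrArg A hv).trans (map_zero A)
    have h5 : mfderiv (𝓡 3) 𝓘(ℝ, ℂ × ℂ) κ (J (t, 0))
      (mfderivWithin 𝓘(ℝ, ℝ × ℝ) (𝓡 3) J strip (t, 0) v) = 0 := h3.symm.trans h4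
    have h6 : Injective (mfderiv (𝓡 3) 𝓘(ℝ, ℂ × ℂ) κ (J (t, 0))) := by
      rw [h1]
      exact hT.injective_mfderiv_coord i _
    have h7 := h6 (h5.trans (map_zero _).symm)
    exact hJ.injective_mfderivWithin _ (hsub hx) (h7.trans (map_zero _).symm)

end IsPageParam

end

/-! ### Page functions, good pages, and extension from a page -/

section

variable {M : Type*} [TopologicalSpace M] [ChartedSpace (EuclideanSpace ℝ (Fin 3)) M]
  {B : Set M} {π : M → Circle} {T : Bool → ℝ × ℂ → M}

/-- `p` is smooth off the binding, is equal to `exp (i t) / ‖z‖` near the component `i` of the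
binding, and vanishes near the other one. -/
structure IsPageFun (B : Set M) (T : Bool → ℝ × ℂ → M) (i : Bool) (r ρ : ℝ) (p : M → ℂ) :
    Prop where
  radius_pos : 0 < r
  radius_pos' : 0 < ρ
  contMDiffOn : ContMDiffOn (𝓡 3) 𝓘(ℝ, ℂ) ∞ p Bᶜ
  apply_collar : ∀ t z, z ≠ 0 → ‖z‖ ≤ r → p (T i (t, z)) = (Circle.exp t : ℂ) / ‖z‖
  apply_collar_not : ∀ t z, z ≠ 0 → ‖z‖ ≤ ρ → p (T (!i) (t, z)) = 0

/-- `p` restricts to an embedding of the complement of its zero set in the page over `θ`, and this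
zero set is contained in a collar. -/
structure IsGood (B : Set M) (π : M → Circle) (T : Bool → ℝ × ℂ → M) (i : Bool) (p : M → ℂ)
    (θ : Circle) : Prop where
  inj : ∀ x ∉ B, ∀ y ∉ B, π x = θ → π y = θ → p x = p y → p x ≠ 0 → x = y
  imm : ∀ x ∉ B, π x = θ → p x ≠ 0 → ∀ v : TangentSpace (𝓡 3) x,
    mfderiv (𝓡 3) 𝓘(ℝ, ℂ) (fun x => (π x : ℂ)) x v = 0 →
    mfderiv (𝓡 3) 𝓘(ℝ, ℂ) p x v = 0 → v = 0
  zero : ∀ x ∉ B, π x = θ → p x = 0 → ∃ t z, ‖z‖ < 1 ∧ T (!i) (t, z) = x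

/-- A parametrization of a page which starts at the component `i` of the binding. -/
structure IsPageParamFrom (B : Set M) (π : M → Circle) (T : Bool → ℝ × ℂ → M) (i : Bool)
    (θ : Circle) (J : ℝ × ℝ → M) : Prop extends IsPageParam B π θ J where
  start : ∀ t, ∃ t', J (t, 0) = T i (t', 0)
  finish : ∀ t, ∃ t', J (t, 1) = T (!i) (t', 0)

namespace IsPageParamFrom

variable {i : Bool} {θ : Circle} {J : ℝ × ℝ → M}

theorem flip (hJ : IsPageParamFrom B π T i θ J) :
    IsPageParamFrom B π T (!i) θ (fun x => J (x.1, 1 - x.2)) :=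
  ⟨hJ.toIsPageParam.flip, fun t => by simpa using hJ.finish t, fun t => by simpa using hJ.start t⟩

/-- The part of a page away from its start misses a collar. -/
theorem exists_collar_disjoint [T2Space M] (hJ : IsPageParamFrom B π T i θ J)
    (hT : IsCollars B π T) {a : ℝ} (ha : 0 < a) :
    ∃ ε > 0, ∀ t z, ‖z‖ ≤ ε → ∀ t', ∀ s ∈ Icc a 1, J (t', s) ≠ T i (t, z) := by
  have hC : IsClosed (J '' (univ ×ˢ Icc a 1)) := (hJ.isCompact_image ha.le le_rfl).isClosed
  have h0 : ∀ t, T i (t, 0) ∉ J '' (univ ×ˢ Icc a 1) := by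
    rintro t ⟨⟨t', s⟩, ⟨-, hs⟩, he⟩
    rcases hs.2.eq_or_lt with h1 | h1
    · obtain ⟨t₁, h2⟩ := hJ.finish t'
      have h3 : J (t', s) = T (!i) (t₁, 0) := by
        have h1 : s = 1 := h1
        rw [h1, h2]
      have := ((hT.eq_iff _ _ _ _ _ _).1 (he.symm.trans h3)).1
      cases i <;> simp at this
    · have h2 := ((hJ.mem_page (J (t', s))).2 ⟨t', s, ⟨ha.trans_le hs.1, h1⟩, rfl⟩).1
      exact h2 ((hT.mem_binding _).2 ⟨i, t, he.symm⟩)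
  obtain ⟨ε, hε, h⟩ := hT.exists_radius i hC h0
  exact ⟨ε, hε, fun t z hz t' s hs he => h t z hz ⟨(t', s), ⟨mem_univ _, hs⟩, he⟩⟩

end IsPageParamFrom

/-- Vectors killed by dπ are tangent to the page, as π advances at nonzero speed in the first chart
variable. -/
theorem IsPageParam.mfderiv_proj_eq_zero {θ : Circle} {E : ℝ × ℝ × ℝ → M}
    {U : Set (ℝ × ℝ × ℝ)} {q : ℝ × ℝ}
    (hU : IsOpen U) (hq : (0, q) ∈ U) (hE : ContMDiffOn 𝓘(ℝ, ℝ × ℝ × ℝ) (𝓡 3) ∞ E U)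
    (hπE : ∀ p ∈ U, π (E p) = θ * Circle.exp p.1)
    (hπ : MDifferentiableAt (𝓡 3) 𝓘(ℝ, ℂ) (fun x => (π x : ℂ)) (E (0, q))) {w : ℝ × ℝ × ℝ}
    (hw : mfderiv (𝓡 3) 𝓘(ℝ, ℂ) (fun x => (π x : ℂ)) (E (0, q))
      (mfderiv 𝓘(ℝ, ℝ × ℝ × ℝ) (𝓡 3) E (0, q) w) = 0) : w.1 = 0 := by
  have hEd := ((hE.contMDiffAt (hU.mem_nhds hq)).mdifferentiableAt
    (by simp : (∞ : WithTop ℕ∞) ≠ 0)).hasMFDerivAt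
  have h1 : HasFDerivAt (fun p : ℝ × ℝ × ℝ => (θ : ℂ) * (Circle.exp p.1 : ℂ)) _ ((0 : ℝ), q) :=
    HasFDerivAt.comp (g := fun t : ℝ => (θ : ℂ) * (Circle.exp t : ℂ)) (f := Prod.fst) (0, q)
      ((hasDerivAt_coe_circleExp 0).const_mul (θ : ℂ)).hasFDerivAt hasFDerivAt_fst
  have h2 := (hπ.hasMFDerivAt.comp ((0 : ℝ), q) hEd).congr_of_eventuallyEq
    (f₁ := fun p : ℝ × ℝ × ℝ => (θ : ℂ) * (Circle.exp p.1 : ℂ)) (by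
      filter_upwards [hU.mem_nhds hq] with p hp
      simp [hπE p hp])
  have h3 := DFunLike.congr_fun (hasMFDerivAt_unique h1.hasMFDerivAt h2) w
  have h4 : w.1 • ((θ : ℂ) * ((Circle.exp 0 : ℂ) * Complex.I)) = 0 := h3.trans hw
  exact (smul_eq_zero.1 h4).resolve_right (mul_ne_zero (Circle.coe_ne_zero _)
    (mul_ne_zero (Circle.coe_ne_zero _) Complex.I_ne_zero))

/-- An extension of `endFun` from a page. -/
theorem IsCollars.exists_isPageFun_extension [IsManifold (𝓡 3) ∞ M] [T2Space M] [CompactSpace M]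
    (hT : IsCollars B π T) (hB : IsClosed B) (hπ : ContMDiffOn (𝓡 3) (𝓡 1) ∞ π Bᶜ) {i : Bool}
    {θ : Circle} {J : ℝ × ℝ → M} (hJ : IsPageParamFrom B π T i θ J) {g : ℝ × ℝ → ℂ}
    (hg : ∀ x : ℝ × ℝ, 0 < x.2 → ContDiffAt ℝ ∞ g x)
    (hgc : ∀ t t' s, s ∈ Ioo (0 : ℝ) 1 → Circle.exp t = Circle.exp t' → g (t, s) = g (t', s))
    {ε ρ : ℝ} (hε : 0 < ε) (hρ : 0 < ρ)
    (hin : ∀ t t' s z, s ∈ Ioo (0 : ℝ) 1 → ‖z‖ ≤ ε → J (t, s) = T i (t', z) →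
      g (t, s) = (Circle.exp t' : ℂ) / ‖z‖)
    (hout : ∀ t t' s z, s ∈ Ioo (0 : ℝ) 1 → ‖z‖ ≤ ρ → J (t, s) = T (!i) (t', z) → g (t, s) = 0) :
    ∃ p, IsPageFun B T i (ε / 2) (ρ / 2) p ∧ ∀ t, ∀ s ∈ Ioo (0 : ℝ) 1, p (J (t, s)) = g (t, s) := by
  have hij : ∀ {t t' z z'}, T i (t, z) ≠ T (!i) (t', z') := fun h => by
    have := ((hT.eq_iff _ _ _ _ _ _).1 h).1
    cases i <;> simp at this
  -- Each of the three prescriptions fixes a single value, so the conditions are convex. The radii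
  -- are halved so that the closed collars where a value is required have open neighbourhoods on
  -- which `hin` and `hout` make it compatible with the page.
  let S : M → Set ℂ := fun x => {w |
    (∀ t z, z ≠ 0 → ‖z‖ ≤ ε / 2 → T i (t, z) = x → w = (Circle.exp t : ℂ) / ‖z‖) ∧
    (∀ t z, z ≠ 0 → ‖z‖ ≤ ρ / 2 → T (!i) (t, z) = x → w = 0) ∧
    ∀ t, ∀ s ∈ Ioo (0 : ℝ) 1, J (t, s) = x → w = g (t, s)}
  have hS : ∀ x ∉ B, Convex ℝ (S x) := by
    rintro x - w₁ h1 w₂ h2 a b - - hab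
    refine ⟨fun t z hz hz' hx => ?_, fun t z hz hz' hx => ?_, fun t s hs hx => ?_⟩
    · rw [h1.1 t z hz hz' hx, h2.1 t z hz hz' hx, ← add_smul, hab, one_smul]
    · rw [h1.2.1 t z hz hz' hx, h2.2.1 t z hz hz' hx, ← add_smul, hab, one_smul]
    · rw [h1.2.2 t s hs hx, h2.2.2 t s hs hx, ← add_smul, hab, one_smul]
  have hstd : ∀ t z, z ≠ 0 → ‖z‖ ≤ ε → (Circle.exp t : ℂ) / ‖z‖ ∈ S (T i (t, z)) := by
    intro t z hz hz'
    refine ⟨fun t' z' _ _ h => ?_, fun t' z' _ _ h => (hij h.symm).elim, fun t' s hs h => ?_⟩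
    · have h1 := (hT.eq_iff _ _ _ _ _ _).1 h
      rw [h1.2.1, h1.2.2]
    · exact (hin t' t s z hs hz' h).symm
  have hstd' : ∀ t z, ‖z‖ ≤ ρ → 0 ∈ S (T (!i) (t, z)) := fun t z hz =>
    ⟨fun t' z' _ _ h => (hij h).elim, fun _ _ _ _ _ => rfl,
      fun t' s hs h => (hout t' t s z hs hz h).symm⟩
  have hcl : IsClosed (T i '' {p | ‖p.2‖ ≤ ε / 2} ∪ T (!i) '' {p | ‖p.2‖ ≤ ρ / 2}) :=
    (hT.isClosed_image i _).union (hT.isClosed_image (!i) _)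
  set C := T i '' {p | ‖p.2‖ ≤ ε / 2} ∪ T (!i) '' {p | ‖p.2‖ ≤ ρ / 2}
  have hSC : ∀ y ∉ C, ∀ w, (∀ t, ∀ s ∈ Ioo (0 : ℝ) 1, J (t, s) = y → w = g (t, s)) → w ∈ S y := by
    intro y hy w hw
    refine ⟨fun t z _ hz h => ?_, fun t z _ hz h => ?_, hw⟩
    · exact (hy (Or.inl ⟨(t, z), hz, h⟩)).elim
    · exact (hy (Or.inr ⟨(t, z), hz, h⟩)).elim
  have hloc : ∀ x ∉ B, ∃ U ∈ 𝓝 x, ∃ f : M → ℂ, ContMDiffOn (𝓡 3) 𝓘(ℝ, ℂ) ∞ f U ∧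
      ∀ y ∈ U, y ∉ B → f y ∈ S y := by
    intro x hx
    by_cases hxC : x ∈ C
    · rcases hxC with ⟨⟨t, z⟩, hz, rfl⟩ | ⟨⟨t, z⟩, hz, rfl⟩
      · have hz : ‖z‖ ≤ ε / 2 := hz
        have hz0 := hT.not_mem_binding.1 hx
        refine ⟨T i '' {p | ‖p.2‖ < ε} ∩ Bᶜ, inter_mem ((hT.isOpen_image i ε).mem_nhds
          ⟨(t, z), by change ‖z‖ < ε; linarith, rfl⟩) (hB.isOpen_compl.mem_nhds hx),
          fun y => ‖(collarCoord (T i) y).2‖⁻¹ • (collarCoord (T i) y).1, ?_, ?_⟩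
        · rintro _ ⟨⟨⟨t', z'⟩, hz', rfl⟩, hy⟩
          have hz0' := hT.not_mem_binding.1 hy
          apply ContMDiffAt.contMDiffWithinAt
          have hH : ContDiffAt ℝ ∞ (fun c : ℂ × ℂ => ‖c.2‖⁻¹ • c.1)
              (collarCoord (T i) (T i (t', z'))) := by
            rw [hT.coord_apply]
            exact ((contDiffAt_snd.norm ℝ hz0').inv (norm_ne_zero_iff.2 hz0')).smul contDiffAt_fst
          exact hH.contMDiffAt.comp _ ((hT.contMDiffOn_coord i).contMDiffAt
            ((hT.isOpenMap i).isOpen_range.mem_nhds ⟨_, rfl⟩))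
        · rintro _ ⟨⟨⟨t', z'⟩, hz', rfl⟩, -⟩ hy
          have hz0' := hT.not_mem_binding.1 hy
          have := hstd t' z' hz0' (le_of_lt hz')
          change ‖(collarCoord (T i) (T i (t', z'))).2‖⁻¹ • (collarCoord (T i) (T i (t', z'))).1 ∈ _
          rw [hT.coord_apply]
          simpa [div_eq_inv_mul, Complex.real_smul] using this
      · have hz : ‖z‖ ≤ ρ / 2 := hz
        refine ⟨T (!i) '' {p | ‖p.2‖ < ρ}, (hT.isOpen_image (!i) ρ).mem_nhds
          ⟨(t, z), by change ‖z‖ < ρ; linarith, rfl⟩, fun _ => 0, contMDiffOn_const, ?_⟩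
        rintro _ ⟨⟨t', z'⟩, hz', rfl⟩ -
        exact hstd' t' z' (le_of_lt hz')
    · by_cases hxθ : π x = θ
      · obtain ⟨t, s, hs, rfl⟩ := (hJ.mem_page x).1 ⟨hx, hxθ⟩
        obtain ⟨E, U, hU, hmem, hE, hinj, hE0, hEp⟩ := hJ.chart t s hs
        have hd : finrank ℝ (ℝ × ℝ × ℝ) = finrank ℝ (EuclideanSpace ℝ (Fin 3)) := by simp
        obtain ⟨N, h, hN, hmN, hh, hhx, hhE, -⟩ :=
          exists_localInverse_of_injective_mfderiv hd hU hmem hE hinj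
        have hE0' : E (0, t, s) = J (t, s) := (hE0 (t, s) hmem).2
        rw [hE0'] at hmN hhx
        have hcont := (hh.contMDiffAt (hN.mem_nhds hmN)).continuousAt
        have h1 : ∀ᶠ y in 𝓝 (J (t, s)), (h y).1 ∈ Ioo (-Real.pi) Real.pi := by
          refine hcont.fst.eventually (isOpen_Ioo.mem_nhds ?_)
          change (h (J (t, s))).1 ∈ _
          rw [hhx]
          exact ⟨by simpa using Real.pi_pos, Real.pi_pos⟩
        have h2 : ∀ᶠ y in 𝓝 (J (t, s)), 0 < (h y).2.2 := by
          refine hcont.snd.snd.eventually (isOpen_Ioi.mem_nhds ?_)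
          change (h (J (t, s))).2.2 ∈ _
          rw [hhx]
          exact hs.1
        refine ⟨{y | (y ∈ N ∧ (h y).1 ∈ Ioo (-Real.pi) Real.pi) ∧ 0 < (h y).2.2 ∧ y ∉ C},
          ?_, fun y => g (h y).2, ?_, ?_⟩
        · filter_upwards [hN.mem_nhds hmN, h1, h2, hcl.isOpen_compl.mem_nhds hxC] with y a b c d
          exact ⟨⟨a, b⟩, c, d⟩
        · rintro y ⟨⟨hyN, -⟩, hy2, -⟩
          apply ContMDiffAt.contMDiffWithinAt
          have hs2 : ContDiffAt ℝ ∞ (fun q : ℝ × ℝ × ℝ => g q.2) (h y) :=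
            (hg (h y).2 hy2).comp (h y) contDiffAt_snd
          exact hs2.contMDiffAt.comp y (hh.contMDiffAt (hN.mem_nhds hyN))
        · rintro y ⟨⟨hyN, hy1⟩, hy2, hyC⟩ hyB
          refine hSC y hyC _ fun t' s' hs' hJy => ?_
          obtain ⟨hyU, hEy⟩ := hhE y hyN
          have h3 := (hEp _ hyU).2
          rw [hEy, ← hJy, ((hJ.mem_page _).2 ⟨t', s', hs', rfl⟩).2] at h3
          have h4 : Circle.exp (h (J (t', s'))).1 = 1 := by simpa using h3.symm
          rw [← Circle.exp_zero, Circle.exp_eq_exp] at h4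
          obtain ⟨m, hm⟩ := h4
          rw [zero_add] at hm
          rw [← hJy] at hy1
          -- The projection determines the first chart coordinate only modulo 2π; restricting it to
          -- (−π, π) ensures that points of the page in this neighbourhood have coordinate 0.
          have hm0 : m = 0 := by
            have hpi := Real.pi_pos
            have h5 : (m : ℝ) * (2 * Real.pi) < 1 * (2 * Real.pi) := by
              rw [← hm]; linarith [hy1.2]
            have h6 : (-1 : ℝ) * (2 * Real.pi) < m * (2 * Real.pi) := by
              rw [← hm]; linarith [hy1.1]
            have h7 := lt_of_mul_lt_mul_right h5 (by positivity)
            have h8 := lt_of_mul_lt_mul_right h6 (by positivity)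
            have h9 : m < 1 := by exact_mod_cast h7
            have h10 : -1 < m := by exact_mod_cast h8
            omega
          have hz : (h (J (t', s'))).1 = 0 := by rw [hm, hm0]; simp
          rw [hJy] at hz
          have hq : h y = (0, (h y).2) := Prod.ext hz rfl
          rw [hq] at hyU hEy
          obtain ⟨h5, h6⟩ := hE0 _ hyU
          rw [hEy] at h6
          have h7 := (hJ.eq_iff (h y).2.1 t' _ (Ioo_subset_Icc_self h5) s'
            (Ioo_subset_Icc_self hs')).1 (h6.symm.trans hJy.symm)
          have h8 : (h y).2 = ((h y).2.1, s') := Prod.ext rfl h7.2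
          change g (h y).2 = _
          rw [h8]
          exact hgc _ _ _ hs' h7.1
      -- Away from the page and the collars nothing is prescribed, and 0 serves.
      · have hπc : ContinuousAt π x := (hπ.contMDiffAt (hB.isOpen_compl.mem_nhds hx)).continuousAt
        refine ⟨{y | π y ≠ θ ∧ y ∉ C}, ?_, fun _ => 0, contMDiffOn_const, ?_⟩
        · filter_upwards [hπc.eventually (isOpen_ne.mem_nhds hxθ),
            hcl.isOpen_compl.mem_nhds hxC] with y h1 h2
          exact ⟨h1, h2⟩
        · rintro y ⟨hy1, hy2⟩ -
          refine hSC y hy2 _ fun t s hs hJy => ?_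
          rw [← hJy] at hy1
          exact (hy1 ((hJ.mem_page _).2 ⟨t, s, hs, rfl⟩).2).elim
  obtain ⟨p, hp, hpS⟩ := hT.exists_contMDiffOn_of_local hB hπ i S hS hloc
    ⟨min ε ρ, lt_min hε hρ, fun t z hz hz' => ⟨hstd t z hz (hz'.trans (min_le_left _ _)),
      hstd' t z (hz'.trans (min_le_right _ _))⟩⟩
  refine ⟨p, ⟨by positivity, by positivity, hp, fun t z hz hz' => ?_, fun t z hz hz' => ?_⟩,
    fun t s hs => ?_⟩
  · exact (hpS _ (hT.not_mem_binding.2 hz)).1 t z hz hz' rfl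
  · exact (hpS _ (hT.not_mem_binding.2 hz)).2.1 t z hz hz' rfl
  · exact (hpS _ ((hJ.mem_page _).2 ⟨t, s, hs, rfl⟩).1).2.2 t s hs rfl

end

/-! ### Existence of a good function on one page -/

section

variable {M : Type*} [TopologicalSpace M] [ChartedSpace (EuclideanSpace ℝ (Fin 3)) M]
  {B : Set M} {π : M → Circle} {T : Bool → ℝ × ℂ → M}

theorem contMDiffOn_coe_proj (hπ : ContMDiffOn (𝓡 3) (𝓡 1) ∞ π Bᶜ) :
    ContMDiffOn (𝓡 3) 𝓘(ℝ, ℂ) ∞ (fun x => (π x : ℂ)) Bᶜ :=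
  contMDiff_coe_circle.comp_contMDiffOn hπ

/-- A function which restricts to an embedding of a page, on the complement of its zero set, and
which vanishes only near the end of the page. -/
theorem IsPageParamFrom.isGood [IsManifold (𝓡 3) ∞ M] (hB : IsClosed B)
    (hπ : ContMDiffOn (𝓡 3) (𝓡 1) ∞ π Bᶜ) {i : Bool} {θ : Circle}
    {J : ℝ × ℝ → M} (hJ : IsPageParamFrom B π T i θ J) {g : ℝ × ℝ → ℂ} {p : M → ℂ}
    (hp : ContMDiffOn (𝓡 3) 𝓘(ℝ, ℂ) ∞ p Bᶜ)
    (hpJ : ∀ t, ∀ s ∈ Ioo (0 : ℝ) 1, p (J (t, s)) = g (t, s))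
    (hg : ∀ x : ℝ × ℝ, 0 < x.2 → ContDiffAt ℝ ∞ g x) {b : ℝ}
    (hb : ∀ t, ∀ s ∈ Ioo (0 : ℝ) 1, g (t, s) = 0 ↔ b ≤ s)
    (hinj : ∀ t t' s s', t ∈ Icc 0 (2 * Real.pi) → 0 < s → 0 < s' → s < b → s' < b →
      g (t, s) = g (t', s') → Circle.exp t = Circle.exp t' ∧ s = s')
    (himm : ∀ t s, t ∈ Icc 0 (2 * Real.pi) → 0 < s → s < b → Injective (fderiv ℝ g (t, s)))
    (hend : ∀ t, ∀ s ∈ Icc b 1, J (t, s) ∈ T (!i) '' {p | ‖p.2‖ < 1}) :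
    IsGood B π T i p θ := by
  have hpage : ∀ x ∉ B, π x = θ → ∃ t ∈ Icc 0 (2 * Real.pi), ∃ s ∈ Ioo (0 : ℝ) 1,
      J (t, s) = x := by
    intro x hx hxθ
    obtain ⟨t, s, hs, rfl⟩ := (hJ.mem_page x).1 ⟨hx, hxθ⟩
    obtain ⟨t', ht', he⟩ := exists_mem_Icc_circleExp_eq t
    exact ⟨t', ht', s, hs, hJ.congr_exp (Ioo_subset_Icc_self hs) he⟩
  refine ⟨?_, ?_, ?_⟩
  · intro x hx y hy hxθ hyθ hxy hx0
    obtain ⟨t, ht, s, hs, rfl⟩ := hpage x hx hxθ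
    obtain ⟨t', ht', s', hs', rfl⟩ := hpage y hy hyθ
    have hy0 : p (J (t', s')) ≠ 0 := hxy ▸ hx0
    rw [hpJ t s hs, Ne, hb t s hs, not_le] at hx0
    rw [hpJ t' s' hs', Ne, hb t' s' hs', not_le] at hy0
    rw [hpJ t s hs, hpJ t' s' hs'] at hxy
    exact (hJ.eq_iff t t' s (Ioo_subset_Icc_self hs) s' (Ioo_subset_Icc_self hs')).2
      (hinj t t' s s' ht hs.1 hs'.1 hx0 hy0 hxy)
  · intro x hx hxθ hx0 v hv hpv
    obtain ⟨t, ht, s, hs, rfl⟩ := hpage x hx hxθ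
    rw [hpJ t s hs, Ne, hb t s hs, not_le] at hx0
    obtain ⟨E, U, hU, hmem, hE, hEinj, hE0, hEp⟩ := hJ.chart t s hs
    have hd : finrank ℝ (ℝ × ℝ × ℝ) = finrank ℝ (EuclideanSpace ℝ (Fin 3)) := by simp
    have hE0' : E (0, t, s) = J (t, s) := (hE0 (t, s) hmem).2
    rw [← hE0'] at hx
    have hπd := ((contMDiffOn_coe_proj hπ).contMDiffAt
      (hB.isOpen_compl.mem_nhds hx)).mdifferentiableAt (by simp : (∞ : WithTop ℕ∞) ≠ 0)
    have hpd := (hp.contMDiffAt (hB.isOpen_compl.mem_nhds hx)).mdifferentiableAt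
      (by simp : (∞ : WithTop ℕ∞) ≠ 0)
    have hEd := ((hE.contMDiffAt (hU.mem_nhds hmem)).mdifferentiableAt
      (by simp : (∞ : WithTop ℕ∞) ≠ 0)).hasMFDerivAt
    have hsurj := Manifold.surjective_mfderiv_of_injective hd hEinj
    revert v
    rw [← hE0']
    intro v hv hpv
    obtain ⟨⟨a, w⟩, rfl⟩ := hsurj v
    -- The vector is tangent to the page, so dp acts on it as dg, which is injective.
    obtain rfl : a = 0 := IsPageParam.mfderiv_proj_eq_zero hU hmem hE
      (fun p hp => (hEp p hp).2) hπd hv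
    have hi : HasFDerivAt (fun q : ℝ × ℝ => ((0 : ℝ), q))
        (ContinuousLinearMap.inr ℝ ℝ (ℝ × ℝ)) (t, s) := hasFDerivAt_prodMk_right _ _
    have h1 := hpd.hasMFDerivAt.comp (t, s) (hEd.comp (t, s) hi.hasMFDerivAt)
    have h2 := h1.congr_of_eventuallyEq (f₁ := g) (by
      have hc : Continuous (fun q : ℝ × ℝ => ((0 : ℝ), q)) := by fun_prop
      filter_upwards [hc.continuousAt.preimage_mem_nhds (hU.mem_nhds hmem)] with q hq
      obtain ⟨hq1, hq2⟩ := hE0 q hq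
      exact (hpJ q.1 q.2 hq1).symm.trans (congrArg p hq2.symm))
    have h3 := DFunLike.congr_fun (hasMFDerivAt_unique
      ((hg (t, s) hs.1).differentiableAt (by simp)).hasFDerivAt.hasMFDerivAt h2) w
    have h4 : fderiv ℝ g (t, s) w = 0 := h3.trans hpv
    have h5 : w = 0 := himm t s ht hs.1 hx0 (h4.trans (map_zero _).symm)
    rw [h5]
    exact map_zero (mfderiv 𝓘(ℝ, ℝ × ℝ × ℝ) (𝓡 3) E (0, t, s))
  · intro x hx hxθ hx0
    obtain ⟨t, ht, s, hs, rfl⟩ := hpage x hx hxθ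
    rw [hpJ t s hs, hb t s hs] at hx0
    obtain ⟨⟨t', z⟩, hz, he⟩ := hend t s ⟨hx0, hs.2.le⟩
    exact ⟨t', z, hz, he⟩

variable [IsManifold (𝓡 3) ∞ M] [T2Space M] [CompactSpace M]

/-- The key construction on a single page. -/
theorem IsCollars.exists_isGood (hT : IsCollars B π T)
    (hπ : IsOpenBook3 annulusModel Annulus B π) (i : Bool) (θ : Circle) :
    ∃ p r ρ, IsPageFun B T i r ρ p ∧ IsGood B π T i p θ := by
  obtain ⟨J, hJ0, hJs, hJf⟩ := hT.exists_isPageParam hπ θ i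
  have hJ : IsPageParamFrom B π T i θ J := ⟨hJ0, hJs, hJf⟩
  obtain ⟨r, hr, hrN⟩ := hJ.exists_strip_subset (hT.isOpen_image i 1) (fun t => by
    obtain ⟨t', h⟩ := hJs t
    exact ⟨(t', 0), by simp, h.symm⟩)
  have hcoord := hJ.isEndCoord hT i hJs hr hrN
  obtain ⟨δ, hδ, hδr, h1, h2, h3, h4⟩ := hcoord.exists_width
  -- The part s ≥ δ / 3 of the page stays out of the collar of radius ε₀; this is what forces points
  -- with `R` below ε to have s below δ / 3.
  obtain ⟨ε₀, hε₀, hεd⟩ := hJ.exists_collar_disjoint hT (a := δ / 3) (by positivity)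
  obtain ⟨b₀, hb₀, hbN⟩ := hJ.flip.exists_strip_subset (hT.isOpen_image (!i) 1) (fun t => by
    obtain ⟨t', h⟩ := hJ.flip.start t
    exact ⟨(t', 0), by simp, h.symm⟩)
  -- Zeros occur for s ≥ b. The bound 1 − b₀ places them in the unit collar of the far component,
  -- and (1 + δ) / 2 keeps b strictly between δ and 1.
  set b := max ((1 + δ) / 2) (1 - b₀) with hbdef
  have hδ1 : δ < 1 := hδr.trans hr.2
  have hδb : δ < b := lt_of_lt_of_le (by linarith) (le_max_left _ _)
  have hb1 : b < 1 := max_lt (by linarith) (by linarith [hb₀.1])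
  set ε := min ε₀ (1 / 2) with hεdef
  have hε : 0 < ε := lt_min hε₀ (by norm_num)
  have hε1 : ε < 1 := (min_le_right _ _).trans_lt (by norm_num)
  have hεε : ε ≤ ε₀ := min_le_left _ _
  set R : ℝ × ℝ → ℝ := fun x => ((collarCoord (T i) (J x)).2 * (starRingEnd ℂ) (θ : ℂ)).re
  set Λ : ℝ × ℝ → ℂ := fun x => (collarCoord (T i) (J x)).1
  have hRT : ∀ t t' s z, s ∈ Ioo (0 : ℝ) 1 → J (t, s) = T i (t', z) →
      R (t, s) = ‖z‖ ∧ Λ (t, s) = Circle.exp t' := by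
    intro t t' s z hs he
    have h5 := (hJ.mem_page (J (t, s))).2 ⟨t, s, hs, rfl⟩
    rw [he, hT.not_mem_binding] at h5
    have h6 := hT.proj_eq i t' z h5.1
    rw [h5.2] at h6
    have hθ : (θ : ℂ) * (starRingEnd ℂ) (θ : ℂ) = 1 := by
      rw [Complex.mul_conj, Complex.normSq_eq_norm_sq]
      simp [Circle.norm_coe]
    simp only [R, Λ, he, hT.coord_apply]
    refine ⟨?_, trivial⟩
    conv_lhs => rw [h6]
    rw [mul_assoc, hθ, mul_one, Complex.ofReal_re]
  have hD : IsEndData R Λ r δ ε b := by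
    refine ⟨hcoord, hδ, hδr, h1, h2, h3, h4, hε, hε1, fun t s hs hR => ?_, hδb⟩
    by_contra! hs'
    have hs0 : s ∈ Ioo (0 : ℝ) 1 := ⟨by linarith, hs.2.trans_lt hr.2⟩
    obtain ⟨⟨t', z⟩, hz, he⟩ := hrN t s hs
    rw [(hRT t t' s z hs0 he.symm).1] at hR
    exact hεd t' z (hR.le.trans hεε) t s ⟨hs', hs0.2.le⟩ he.symm
  -- In the flipped page, s ≤ b becomes s ≥ 1 − b, which misses a collar of the far component;
  -- within that collar the function is therefore zero.
  obtain ⟨ρ, hρ, hρd⟩ := hJ.flip.exists_collar_disjoint hT (a := 1 - b) (by linarith)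
  have hb0 : 0 < b := hδ.trans hδb
  obtain ⟨p, hp, hpJ⟩ := hT.exists_isPageFun_extension hπ.isClosed_binding hπ.contMDiffOn_proj hJ
    (g := endFun R Λ δ ε b) (fun x hx => hD.contDiffAt_endFun hx)
    (fun t t' s hs he => hD.endFun_congr hs.1 he) (half_pos hε) hρ (by
      intro t t' s z hs hz he
      have h5 := hRT t t' s z hs he
      have h6 : s < δ / 3 := by
        by_contra! h7
        exact hεd t' z (hz.trans (by linarith)) t s ⟨h7, hs.2.le⟩ he
      rw [hD.endFun_inner ⟨hs.1, by linarith⟩ (by rw [h5.1]; exact hz), h5.1, h5.2]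
      rw [Complex.real_smul, div_eq_inv_mul]
      push_cast
      rfl) (by
      intro t t' s z hs hz he
      rw [hD.endFun_eq_zero_iff hs.1]
      by_contra! h5
      refine hρd t' z hz t (1 - s) ⟨by linarith, by linarith [hs.1]⟩ ?_
      simpa using he)
  refine ⟨p, _, _, hp, hJ.isGood hπ.isClosed_binding hπ.contMDiffOn_proj hp.contMDiffOn hpJ
    (fun x hx => hD.contDiffAt_endFun hx) (fun t s hs => hD.endFun_eq_zero_iff hs.1)
    (fun t t' s s' ht hs hs' hb hb' he => hD.endFun_inj ht hs hs' hb hb' he)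
    (fun t s ht hs hb => hD.injective_fderiv_endFun ht hs hb) fun t s hs => ?_⟩
  have h5 : 1 - b₀ ≤ s := (le_max_right _ _).trans hs.1
  have h6 := hbN t (1 - s) ⟨by linarith [hs.2], by linarith⟩
  simpa using h6

end

/-! ### Radial maps of the plane; goodness on nearby pages -/

section

section Radial

/-- The radial map `z ↦ c (‖z‖ ^ 2) z`. -/
def radialMap (c : ℝ → ℝ) (z : ℂ) : ℂ := c (‖z‖ ^ 2) • z

variable {c : ℝ → ℝ}

theorem contDiff_radialMap (hc : ContDiff ℝ ∞ c) : ContDiff ℝ ∞ (radialMap c) :=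
  (hc.comp (contDiff_norm_sq ℝ)).smul contDiff_id

theorem norm_radialMap (z : ℂ) (hc : 0 ≤ c (‖z‖ ^ 2)) : ‖radialMap c z‖ = c (‖z‖ ^ 2) * ‖z‖ := by
  rw [radialMap, norm_smul, Real.norm_of_nonneg hc]

/-- The norm of the image, c(‖z‖²) ‖z‖, is strictly increasing in ‖z‖ where c is positive, and the
direction is kept. -/
theorem radialMap_inj (hc : Monotone c) {z w : ℂ} (hz : 0 < c (‖z‖ ^ 2)) (hw : 0 < c (‖w‖ ^ 2))
    (h : radialMap c z = radialMap c w) : z = w := by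
  have key : ∀ {z w : ℂ}, 0 < c (‖z‖ ^ 2) → 0 < c (‖w‖ ^ 2) → ‖z‖ < ‖w‖ →
      radialMap c z ≠ radialMap c w := by
    intro z w hz hw hlt he
    have h1 := congrArg norm he
    rw [norm_radialMap z hz.le, norm_radialMap w hw.le] at h1
    have h2 : c (‖z‖ ^ 2) ≤ c (‖w‖ ^ 2) := hc (by gcongr)
    have h3 : c (‖z‖ ^ 2) * ‖z‖ < c (‖w‖ ^ 2) * ‖w‖ :=
      (mul_lt_mul_of_pos_left hlt hz).trans_le (mul_le_mul_of_nonneg_right h2 (norm_nonneg w))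
    linarith
  have hn : ‖z‖ = ‖w‖ := by
    rcases lt_trichotomy ‖z‖ ‖w‖ with h1 | h1 | h1
    · exact (key hz hw h1 h).elim
    · exact h1
    · exact (key hw hz h1 h.symm).elim
  rw [radialMap, radialMap, hn] at h
  exact smul_right_injective ℂ hw.ne' h

/-- Pairing the derivative at w with w gives c ‖w‖² + 2c' ⟨z, w⟩², a sum of nonnegative terms. -/
theorem injective_fderiv_radialMap (hc : Monotone c) (hd : ContDiff ℝ ∞ c) {z : ℂ}
    (hz : 0 < c (‖z‖ ^ 2)) : Injective (fderiv ℝ (radialMap c) z) := by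
  have h1 : HasFDerivAt (fun z : ℂ => ‖z‖ ^ 2) (2 • innerSL ℝ z) z :=
    (hasStrictFDerivAt_norm_sq z).hasFDerivAt
  have h2 : HasDerivAt c (deriv c (‖z‖ ^ 2)) (‖z‖ ^ 2) :=
    (hd.differentiable (by simp) _).hasDerivAt
  have h3 : HasFDerivAt (radialMap c) _ z := (h2.comp_hasFDerivAt z h1).smul (hasFDerivAt_id z)
  refine (injective_iff_map_eq_zero _).2 fun w hw => ?_
  rw [h3.fderiv] at hw
  have h4 : c (‖z‖ ^ 2) • w + (deriv c (‖z‖ ^ 2) * (2 * inner ℝ z w)) • z = 0 := by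
    have h : c (‖z‖ ^ 2) • w + (deriv c (‖z‖ ^ 2) • (2 : ℕ) • inner ℝ z w) • z = 0 := hw
    rwa [nsmul_eq_mul, smul_eq_mul, Nat.cast_ofNat] at h
  have h5 := congrArg (fun u => inner ℝ u w) h4
  simp only [inner_add_left, real_inner_smul_left, inner_zero_left, real_inner_self_eq_norm_sq]
    at h5
  have h6 : 0 ≤ deriv c (‖z‖ ^ 2) := hc.deriv_nonneg
  have h7 : 0 ≤ deriv c (‖z‖ ^ 2) * inner ℝ z w ^ 2 := mul_nonneg h6 (sq_nonneg _)
  have h8 : c (‖z‖ ^ 2) * ‖w‖ ^ 2 ≤ 0 := by nlinarith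
  have h9 : ‖w‖ ^ 2 ≤ 0 := by
    by_contra! h
    exact absurd (mul_pos hz h) (not_lt.2 h8)
  simpa using h9

end Radial

variable {M : Type*} [TopologicalSpace M] [ChartedSpace (EuclideanSpace ℝ (Fin 3)) M]
  {B : Set M} {π : M → Circle} {T : Bool → ℝ × ℂ → M} {i : Bool} {r ρ : ℝ} {p : M → ℂ}

theorem norm_coe_angle_inj {z w : ℂ} (hn : ‖z‖ = ‖w‖) (ha : angle z = angle w) : z = w := by
  rw [← norm_mul_angle z, ← norm_mul_angle w, hn, ha]

theorem hasMFDerivAt_pair (hB : IsClosed B) (hπ : ContMDiffOn (𝓡 3) (𝓡 1) ∞ π Bᶜ)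
    (hp : ContMDiffOn (𝓡 3) 𝓘(ℝ, ℂ) ∞ p Bᶜ) {x : M} (hx : x ∉ B) :
    HasMFDerivAt (𝓡 3) 𝓘(ℝ, ℂ × ℂ) (fun x => ((π x : ℂ), p x)) x
      ((mfderiv (𝓡 3) 𝓘(ℝ, ℂ) (fun x => (π x : ℂ)) x).prod (mfderiv (𝓡 3) 𝓘(ℝ, ℂ) p x)) := by
  have h1 := ((contMDiffOn_coe_proj hπ).contMDiffAt
    (hB.isOpen_compl.mem_nhds hx)).mdifferentiableAt (by simp : (∞ : WithTop ℕ∞) ≠ 0)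
  have h2 := (hp.contMDiffAt (hB.isOpen_compl.mem_nhds hx)).mdifferentiableAt
      (by simp : (∞ : WithTop ℕ∞) ≠ 0)
  exact ⟨h1.hasMFDerivAt.1.prodMk h2.hasMFDerivAt.1, h1.hasMFDerivAt.2.prodMk h2.hasMFDerivAt.2⟩

namespace IsPageFun

theorem mono (h : IsPageFun B T i r ρ p) {r' ρ' : ℝ} (hr : 0 < r') (hr' : r' ≤ r) (hρ : 0 < ρ')
    (hρ' : ρ' ≤ ρ) : IsPageFun B T i r' ρ' p :=
  ⟨hr, hρ, h.contMDiffOn, fun t z hz h1 => h.apply_collar t z hz (h1.trans hr'),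
    fun t z hz h1 => h.apply_collar_not t z hz (h1.trans hρ')⟩

theorem norm_apply (h : IsPageFun B T i r ρ p) (t : ℝ) {z : ℂ} (hz : z ≠ 0) (hz' : ‖z‖ ≤ r) :
    ‖p (T i (t, z))‖ = ‖z‖⁻¹ := by
  rw [h.apply_collar t z hz hz']
  simp

/-- The modulus of `p` gives ‖z‖, its phase gives t, and π gives the argument of z. -/
theorem inj_collar (h : IsPageFun B T i r ρ p) (hT : IsCollars B π T) {t t' : ℝ} {z z' : ℂ}
    (hz : z ≠ 0) (hz' : z' ≠ 0) (hr : ‖z‖ ≤ r) (hr' : ‖z'‖ ≤ r)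
    (hπ : π (T i (t, z)) = π (T i (t', z'))) (hp : p (T i (t, z)) = p (T i (t', z'))) :
    T i (t, z) = T i (t', z') := by
  have h1 : ‖z‖ = ‖z'‖ := by
    rw [← inv_inj, ← h.norm_apply t hz hr, ← h.norm_apply t' hz' hr', hp]
  rw [hT.proj i t z hz, hT.proj i t' z' hz'] at hπ
  rw [h.apply_collar t z hz hr, h.apply_collar t' z' hz' hr', h1] at hp
  have h2 : (‖z'‖ : ℂ) ≠ 0 := by simpa using hz'
  exact (hT.eq_iff _ _ _ _ _ _).2
    ⟨rfl, Circle.coe_injective ((div_left_inj' h2).1 hp), norm_coe_angle_inj h1 hπ⟩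

/-- The collar coordinates (exp(it), z) are p / ‖p‖ and π / ‖p‖, hence smooth functions of (π, p).
-/
theorem imm_collar [IsManifold (𝓡 3) ∞ M] (h : IsPageFun B T i r ρ p) (hT : IsCollars B π T)
    (hB : IsClosed B) (hπ : ContMDiffOn (𝓡 3) (𝓡 1) ∞ π Bᶜ) {t : ℝ} {z : ℂ} (hz : z ≠ 0)
    (hr : ‖z‖ < r) (v : TangentSpace (𝓡 3) (T i (t, z)))
    (hv : mfderiv (𝓡 3) 𝓘(ℝ, ℂ) (fun x => (π x : ℂ)) (T i (t, z)) v = 0)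
    (hpv : mfderiv (𝓡 3) 𝓘(ℝ, ℂ) p (T i (t, z)) v = 0) : v = 0 := by
  have hx : T i (t, z) ∉ B := hT.not_mem_binding.2 hz
  have hpair := hasMFDerivAt_pair hB hπ h.contMDiffOn hx
  have hc := (((hT.contMDiffOn_coord i).contMDiffAt
    ((hT.isOpenMap i).isOpen_range.mem_nhds ⟨(t, z), rfl⟩)).mdifferentiableAt
    (by simp : (∞ : WithTop ℕ∞) ≠ 0)).hasMFDerivAt
  have hp0 : p (T i (t, z)) ≠ 0 := by
    rw [← norm_ne_zero_iff, h.norm_apply t hz hr.le]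
    simpa using hz
  have hN : DifferentiableAt ℝ (fun q : ℂ × ℂ => ‖q.2‖⁻¹) ((π (T i (t, z)) : ℂ), p (T i (t, z))) :=
    ((contDiffAt_snd.norm ℝ hp0).inv (norm_ne_zero_iff.2 hp0)).differentiableAt
      (by simp : (∞ : WithTop ℕ∞) ≠ 0)
  have hH : DifferentiableAt ℝ (fun q : ℂ × ℂ => (‖q.2‖⁻¹ • q.2, ‖q.2‖⁻¹ • q.1))
      ((π (T i (t, z)) : ℂ), p (T i (t, z))) :=
    (hN.smul differentiableAt_snd).prodMk (hN.smul differentiableAt_fst)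
  have h1 := hc.apply_eq_zero_of_comp hpair hH.mdifferentiableAt (by
    filter_upwards [((hT.isOpen_image i r).inter hB.isOpen_compl).mem_nhds
      ⟨⟨(t, z), hr, rfl⟩, hx⟩] with y hy
    obtain ⟨⟨⟨t', z'⟩, hz', rfl⟩, hyB⟩ := hy
    have hz' : ‖z'‖ < r := hz'
    have hz0 := hT.not_mem_binding.1 hyB
    have hn : ‖z'‖ ≠ 0 := norm_ne_zero_iff.2 hz0
    have hnc : (‖z'‖ : ℂ) ≠ 0 := by exact_mod_cast hn
    rw [hT.coord_apply]
    change _ = (‖p (T i (t', z'))‖⁻¹ • p (T i (t', z')),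
      ‖p (T i (t', z'))‖⁻¹ • (π (T i (t', z')) : ℂ))
    rw [h.norm_apply t' hz0 hz'.le, inv_inv, h.apply_collar t' z' hz0 hz'.le, Complex.real_smul,
      Complex.real_smul, mul_div_cancel₀ _ hnc]
    exact Prod.ext rfl (hT.proj_eq i t' z' hz0)) (Prod.ext hv hpv)
  exact hT.injective_mfderiv_coord i (t, z) (h1.trans (map_zero _).symm)

end IsPageFun

theorem eventually_forall_ne_of_isCompact {C : Set M} (hC : IsCompact C) (hCB : C ⊆ Bᶜ)
    (hπ : ContMDiffOn (𝓡 3) (𝓡 1) ∞ π Bᶜ) {θ : Circle}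
    (h : ∀ x ∈ C, π x ≠ θ) : ∀ᶠ θ' in 𝓝 θ, ∀ x ∈ C, π x ≠ θ' := by
  have h1 : IsClosed (π '' C) :=
    (hC.image_of_continuousOn (hπ.continuousOn.mono hCB)).isClosed
  have h2 : θ ∉ π '' C := by
    rintro ⟨x, hx, rfl⟩
    exact h x hx rfl
  filter_upwards [h1.isOpen_compl.mem_nhds h2] with θ' hθ' x hx he
  exact hθ' ⟨x, hx, he⟩

/-- A function which is good at `θ` may be modified near its zero set so as to be good near
`θ`. -/
theorem IsGood.exists_eventually [IsManifold (𝓡 3) ∞ M] [T2Space M] [CompactSpace M]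
    {θ : Circle} (h : IsGood B π T i p θ)
    (hp : IsPageFun B T i r ρ p) (hT : IsCollars B π T) (hB : IsClosed B)
    (hπ : ContMDiffOn (𝓡 3) (𝓡 1) ∞ π Bᶜ) :
    ∃ q, IsPageFun B T i r ρ q ∧ ∀ᶠ θ' in 𝓝 θ, IsGood B π T i q θ' := by
  have hr := hp.radius_pos
  have hρ := hp.radius_pos'
  let W : ℝ → ℝ → Set M := fun a b => T i '' {p | ‖p.2‖ < a} ∪ T (!i) '' {p | ‖p.2‖ < b}
  have hWo : ∀ a b, IsOpen (W a b) := fun a b =>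
    (hT.isOpen_image i a).union (hT.isOpen_image (!i) b)
  have hWB : ∀ {a b}, 0 < a → 0 < b → (W a b)ᶜ ⊆ Bᶜ := by
    intro a b ha hb x hx hxB
    obtain ⟨j, t, rfl⟩ := (hT.mem_binding x).1 hxB
    by_cases hj : j = i
    · subst hj
      exact hx (Or.inl ⟨(t, 0), by simpa, rfl⟩)
    · obtain rfl := Bool.eq_not_of_ne hj
      exact hx (Or.inr ⟨(t, 0), by simpa, rfl⟩)
  have hcl : ∀ {a b} (S : Set ℂ), 0 < a → 0 < b → IsClosed S →
      IsCompact ((W a b)ᶜ ∩ p ⁻¹' S) := fun {a b} S ha hb hS =>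
    ((hp.contMDiffOn.continuousOn.mono (hWB ha hb)).preimage_isClosed_of_isClosed
      (hWo a b).isClosed_compl hS).isCompact
  have hsub : ∀ {a b} (S : Set ℂ), 0 < a → 0 < b → (W a b)ᶜ ∩ p ⁻¹' S ⊆ Bᶜ := fun S ha hb =>
    inter_subset_left.trans (hWB ha hb)
  -- Large values occur only in the collar of component `i`. On the page over θ, a value of modulus
  -- at least 2 / r is also taken at the collar point with ‖z‖ = 1 / ‖p x‖ and t = arg(p x), so by
  -- injectivity it is taken nowhere else; compactness passes this to nearby pages.
  have e1 : ∀ᶠ θ' in 𝓝 θ, ∀ x ∈ (W r ρ)ᶜ ∩ p ⁻¹' {w | 2 / r ≤ ‖w‖}, π x ≠ θ' := by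
    refine eventually_forall_ne_of_isCompact (hcl _ hr hρ (isClosed_le continuous_const
      continuous_norm)) (hsub _ hr hρ) hπ ?_
    rintro x ⟨hxW, hxp⟩ hxθ
    have hxp : 2 / r ≤ ‖p x‖ := hxp
    have h2r : 0 < 2 / r := by positivity
    have hn : 0 < ‖p x‖ := h2r.trans_le hxp
    have hn' : (‖p x‖ : ℂ) ≠ 0 := by exact_mod_cast hn.ne'
    set z : ℂ := (‖p x‖⁻¹ : ℝ) * (θ : ℂ) with hz
    have hzn : ‖z‖ = ‖p x‖⁻¹ := by simp [hz, Circle.norm_coe]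
    have hz0 : z ≠ 0 := by
      rw [← norm_ne_zero_iff, hzn]
      exact (inv_pos.2 hn).ne'
    have hzr : ‖z‖ < r := by
      rw [hzn, inv_lt_comm₀ hn hr]
      refine lt_of_lt_of_le ?_ hxp
      rw [inv_eq_one_div]
      gcongr
      norm_num
    have hang : angle z = θ := by
      apply Circle.coe_injective
      have h1 := norm_mul_angle z
      rw [hzn, hz] at h1
      have h2 : ((‖p x‖⁻¹ : ℝ) : ℂ) ≠ 0 := by exact_mod_cast (inv_pos.2 hn).ne'
      exact mul_left_cancel₀ h2 h1
    have hpy : p (T i (Complex.arg (p x), z)) = p x := by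
      rw [hp.apply_collar _ z hz0 hzr.le, hzn]
      have h1 := norm_mul_angle (p x)
      rw [angle] at h1
      push_cast
      rw [div_inv_eq_mul, mul_comm]
      exact h1
    have h3 := h.inj x (hWB hr hρ hxW) _ (hT.not_mem_binding.2 hz0) hxθ
      ((hT.proj i _ z hz0).trans hang) hpy.symm (norm_pos_iff.1 hn)
    exact hxW (Or.inl ⟨(Complex.arg (p x), z), hzr, h3.symm⟩)
  -- Small values occur only in the far unit collar: outside the two collars |p| is bounded below on
  -- the page by compactness. Taking η below 1 / r leaves the standard values in the near collar
  -- untouched by the cutoff at η.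
  obtain ⟨η, hη, hηr, e2⟩ : ∃ η > 0, η < r⁻¹ ∧
      ∀ᶠ θ' in 𝓝 θ, ∀ x ∈ (W r 1)ᶜ ∩ p ⁻¹' {w | ‖w‖ ≤ η}, π x ≠ θ' := by
    have hK : IsCompact ((W r 1)ᶜ ∩ π ⁻¹' {θ}) :=
      ((hπ.continuousOn.mono (hWB hr one_pos)).preimage_isClosed_of_isClosed
        (hWo r 1).isClosed_compl isClosed_singleton).isCompact
    obtain ⟨m, hm, hmK⟩ := hK.exists_forall_le' (f := fun x => ‖p x‖) (a := 0)
      (hp.contMDiffOn.continuousOn.mono (inter_subset_left.trans (hWB hr one_pos))).norm (by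
        rintro x ⟨hxW, hxθ⟩
        refine norm_pos_iff.2 fun h0 => ?_
        obtain ⟨t, z, hz, rfl⟩ := h.zero x (hWB hr one_pos hxW) hxθ h0
        exact hxW (Or.inr ⟨(t, z), hz, rfl⟩))
    have hri : 0 < r⁻¹ := inv_pos.2 hr
    refine ⟨min (m / 2) (r⁻¹ / 2), lt_min (by positivity) (by positivity),
      (min_le_right _ _).trans_lt (by linarith), ?_⟩
    refine eventually_forall_ne_of_isCompact (hcl _ hr one_pos (isClosed_le
      continuous_norm continuous_const)) (hsub _ hr one_pos) hπ ?_
    rintro x ⟨hxW, hxp⟩ hxθ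
    have h1 : ‖p x‖ ≤ min (m / 2) (r⁻¹ / 2) := hxp
    have h2 : m ≤ ‖p x‖ := hmK x ⟨hxW, hxθ⟩
    have h3 := h1.trans (min_le_left _ _)
    linarith
  set Q : M → ℂ × ℂ := fun x => ((π x : ℂ), p x) with hQ
  have hQs : ContMDiffOn (𝓡 3) 𝓘(ℝ, ℂ × ℂ) ∞ Q Bᶜ :=
    (contMDiffOn_coe_proj hπ).prodMk_space hp.contMDiffOn
  have hr2 : 0 < r / 2 := half_pos hr
  -- On the remaining compact part of the page, where |p| is at least η, the map (π, p) is an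
  -- injective immersion; it stays so on a neighbourhood N, which contains the corresponding part of
  -- each nearby page.
  obtain ⟨N, hN, hNi, hNd, e3⟩ : ∃ N : Set M, IsOpen N ∧ InjOn Q N ∧
      (∀ y ∈ N, Injective (mfderiv (𝓡 3) 𝓘(ℝ, ℂ × ℂ) Q y)) ∧
      ∀ᶠ θ' in 𝓝 θ, ∀ x ∈ ((W (r / 2) ρ)ᶜ ∩ p ⁻¹' {w | η ≤ ‖w‖}) ∩ Nᶜ, π x ≠ θ' := by
    have hηc : IsClosed {w : ℂ | η ≤ ‖w‖} := isClosed_le continuous_const continuous_norm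
    have hC := hcl (a := r / 2) (b := ρ) _ hr2 hρ hηc
    have hCB := hsub (a := r / 2) (b := ρ) {w | η ≤ ‖w‖} hr2 hρ
    set C := (W (r / 2) ρ)ᶜ ∩ p ⁻¹' {w | η ≤ ‖w‖}
    have hK : IsCompact (C ∩ π ⁻¹' {θ}) :=
      ((hπ.continuousOn.mono hCB).preimage_isClosed_of_isClosed hC.isClosed
        isClosed_singleton).isCompact
    have hne : ∀ x ∈ C, p x ≠ 0 := by
      rintro x ⟨-, hx⟩
      have hx : η ≤ ‖p x‖ := hx
      exact norm_pos_iff.1 (hη.trans_le hx)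
    have hloc : ∀ x ∈ C ∩ π ⁻¹' {θ}, ∃ U ∈ 𝓝 x, InjOn Q U ∧
        ∀ y ∈ U, Injective (mfderiv (𝓡 3) 𝓘(ℝ, ℂ × ℂ) Q y) := by
      rintro x ⟨hxC, hxθ⟩
      refine exists_nhds_injOn_of_injective_mfderiv hB.isOpen_compl (hCB hxC) hQs ?_
      refine (injective_iff_map_eq_zero _).2 fun v hv => ?_
      rw [(hasMFDerivAt_pair hB hπ hp.contMDiffOn (hCB hxC)).mfderiv] at hv
      exact h.imm x (hCB hxC) hxθ (hne x hxC) v (congrArg Prod.fst hv) (congrArg Prod.snd hv)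
    have hinjK : InjOn Q (C ∩ π ⁻¹' {θ}) := by
      rintro x ⟨hxC, hxθ⟩ y ⟨hyC, hyθ⟩ hxy
      exact h.inj x (hCB hxC) y (hCB hyC) hxθ hyθ (congrArg Prod.snd hxy) (hne x hxC)
    obtain ⟨N₁, hN₁, hKN₁, hN₁i⟩ := hinjK.exists_isOpen_superset hK
      (fun x hx => (hQs.continuousOn.continuousAt (hB.isOpen_compl.mem_nhds (hCB hx.1))))
      (fun x hx => by
        obtain ⟨U, hU, hUi, -⟩ := hloc x hx
        exact ⟨U, hU, hUi⟩)
    let N₂ : Set M := interior {y | Injective (mfderiv (𝓡 3) 𝓘(ℝ, ℂ × ℂ) Q y)}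
    have hKN₂ : C ∩ π ⁻¹' {θ} ⊆ N₂ := by
      intro x hx
      obtain ⟨U, hU, -, hUd⟩ := hloc x hx
      exact mem_interior_iff_mem_nhds.2 (mem_of_superset hU hUd)
    refine ⟨N₁ ∩ N₂, hN₁.inter isOpen_interior, hN₁i.mono inter_subset_left,
      fun y hy => interior_subset hy.2, ?_⟩
    refine eventually_forall_ne_of_isCompact
      (hC.inter_right (hN₁.inter isOpen_interior).isClosed_compl)
      (inter_subset_left.trans hCB) hπ ?_
    rintro x ⟨hxC, hxN⟩ hxθ
    exact hxN ⟨hKN₁ ⟨hxC, hxθ⟩, hKN₂ ⟨hxC, hxθ⟩⟩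
  -- Near its zeros `p` may fail to be an embedding on nearby pages. Composing with a radial map
  -- that collapses the disc of radius η to 0, is injective outside it, and is the identity from 1 /
  -- r on removes that region.
  set c : ℝ → ℝ := fun u => Real.smoothTransition ((u - η ^ 2) / (r⁻¹ ^ 2 - η ^ 2)) with hc
  have hηr2 : 0 < r⁻¹ ^ 2 - η ^ 2 := by
    have : η ^ 2 < r⁻¹ ^ 2 := by gcongr
    linarith
  have hcs : ContDiff ℝ ∞ c := Real.smoothTransition.contDiff.comp (by fun_prop)
  have hcm : Monotone c := fun a b hab => Real.smoothTransition.monotone (by gcongr)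
  have hc1 : ∀ u, r⁻¹ ≤ u → c (u ^ 2) = 1 := by
    intro u hu
    apply Real.smoothTransition.one_of_one_le
    rw [le_div_iff₀ hηr2]
    have : r⁻¹ ^ 2 ≤ u ^ 2 := by gcongr
    linarith
  have hcpos : ∀ w : ℂ, 0 < c (‖w‖ ^ 2) ↔ η < ‖w‖ := by
    intro w
    have h1 : 0 < c (‖w‖ ^ 2) ↔ 0 < (‖w‖ ^ 2 - η ^ 2) / (r⁻¹ ^ 2 - η ^ 2) := by
      constructor
      · intro h1
        by_contra! h2
        exact h1.ne' (Real.smoothTransition.zero_of_nonpos h2)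
      · exact Real.smoothTransition.pos_of_pos
    rw [h1, div_pos_iff_of_pos_right hηr2, sub_pos, sq_lt_sq₀ hη.le (norm_nonneg w)]
  have hc0 : ∀ w : ℂ, radialMap c w ≠ 0 → η < ‖w‖ := by
    intro w hw
    rw [← hcpos]
    refine lt_of_le_of_ne (Real.smoothTransition.nonneg _) fun h0 => hw ?_
    rw [radialMap, ← h0, zero_smul]
  have hregion : ∀ x, x ∉ B → p x ≠ 0 → ∀ a, x ∉ T i '' {p | ‖p.2‖ < a} → x ∈ (W a ρ)ᶜ := by
    rintro x hxB hx0 a hxa (h1 | ⟨⟨t, z⟩, hz, rfl⟩)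
    · exact hxa h1
    · exact hx0 (hp.apply_collar_not t z (hT.not_mem_binding.1 hxB) (le_of_lt hz))
  have hrr : r⁻¹ < 2 / r := by
    rw [inv_eq_one_div]
    gcongr
    norm_num
  refine ⟨radialMap c ∘ p, ⟨hr, hρ, ?_, ?_, ?_⟩, ?_⟩
  · exact (contDiff_radialMap hcs).contMDiff.comp_contMDiffOn hp.contMDiffOn
  · intro t z hz hz'
    have h1 : r⁻¹ ≤ ‖p (T i (t, z))‖ := by
      rw [hp.norm_apply t hz hz']
      exact inv_anti₀ (norm_pos_iff.2 hz) hz'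
    rw [comp_apply, radialMap, hc1 _ h1, one_smul, hp.apply_collar t z hz hz']
  · intro t z hz hz'
    rw [comp_apply, hp.apply_collar_not t z hz hz', radialMap, smul_zero]
  filter_upwards [e1, e2, e3] with θ' h1 h2 h3
  have hNmem : ∀ x ∉ B, π x = θ' → η < ‖p x‖ → x ∉ T i '' {p | ‖p.2‖ < r / 2} → x ∈ N := by
    intro x hxB hxθ hxη hxr
    by_contra hxN
    exact h3 x ⟨⟨hregion x hxB (norm_pos_iff.1 (hη.trans hxη)) _ hxr, hxη.le⟩, hxN⟩ hxθ
  have hnear : ∀ x ∉ B, π x = θ' → 2 / r ≤ ‖p x‖ → x ∈ T i '' {p | ‖p.2‖ < r} := by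
    intro x hxB hxθ hxr
    by_contra hx
    have hx0 : p x ≠ 0 := norm_pos_iff.1 ((by positivity : 0 < 2 / r).trans_le hxr)
    exact h1 x ⟨hregion x hxB hx0 _ hx, hxr⟩ hxθ
  -- Near the binding compactness is unavailable. A point with ‖z‖ below r / 2 has |p| at least 2 /
  -- r, so a second point with the same value is also in the collar, where `p` is explicit.
  have hstd : ∀ x ∉ B, ∀ y ∉ B, π x = θ' → π y = θ' → p x = p y →
      x ∈ T i '' {p | ‖p.2‖ < r / 2} → x = y := by
    rintro _ hxB y hyB hxθ hyθ hxy ⟨⟨t, z⟩, hz, rfl⟩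
    have hz : ‖z‖ < r / 2 := hz
    have hz0 := hT.not_mem_binding.1 hxB
    have hzr : ‖z‖ ≤ r := by linarith
    have h4 : 2 / r ≤ ‖p y‖ := by
      rw [← hxy, hp.norm_apply t hz0 hzr, ← inv_div]
      exact inv_anti₀ (norm_pos_iff.2 hz0) hz.le
    obtain ⟨⟨t', z'⟩, hz', rfl⟩ := hnear y hyB hyθ h4
    exact hp.inj_collar hT hz0 (hT.not_mem_binding.1 hyB) hzr (le_of_lt hz')
      (hxθ.trans hyθ.symm) hxy
  refine ⟨?_, ?_, ?_⟩
  · intro x hxB y hyB hxθ hyθ hxy hx0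
    have hxη := hc0 _ hx0
    have hyη := hc0 (p y) (by
      have h4 : radialMap c (p x) = radialMap c (p y) := hxy
      rw [← h4]
      exact hx0)
    have hpxy := radialMap_inj hcm ((hcpos _).2 hxη) ((hcpos _).2 hyη) hxy
    by_cases hx : x ∈ T i '' {p | ‖p.2‖ < r / 2}
    · exact hstd x hxB y hyB hxθ hyθ hpxy hx
    by_cases hy : y ∈ T i '' {p | ‖p.2‖ < r / 2}
    · exact (hstd y hyB x hxB hyθ hxθ hpxy.symm hy).symm
    exact hNi (hNmem x hxB hxθ hxη hx) (hNmem y hyB hyθ hyη hy)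
      (Prod.ext (by simp [hQ, hxθ, hyθ]) hpxy)
  · intro x hxB hxθ hx0 v hv hqv
    have hxη := hc0 _ hx0
    have hpd := ((hp.contMDiffOn.contMDiffAt (hB.isOpen_compl.mem_nhds hxB)).mdifferentiableAt
      (by simp : (∞ : WithTop ℕ∞) ≠ 0)).hasMFDerivAt
    have hcd : HasFDerivAt (radialMap c) (fderiv ℝ (radialMap c) (p x)) (p x) :=
      ((contDiff_radialMap hcs).differentiable (by simp) _).hasFDerivAt
    have h4 := (hcd.hasMFDerivAt.comp x hpd).mfderiv
    rw [h4] at hqv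
    have hpv : mfderiv (𝓡 3) 𝓘(ℝ, ℂ) p x v = 0 :=
      injective_fderiv_radialMap hcm hcs ((hcpos _).2 hxη) (Eq.trans hqv (map_zero _).symm)
    by_cases hx : x ∈ T i '' {p | ‖p.2‖ < r / 2}
    · obtain ⟨⟨t, z⟩, hz, rfl⟩ := hx
      have hz : ‖z‖ < r / 2 := hz
      exact hp.imm_collar hT hB hπ (hT.not_mem_binding.1 hxB) (by linarith) v hv hpv
    · refine hNd x (hNmem x hxB hxθ hxη hx) (Eq.trans ?_ (map_zero _).symm)
      refine (DFunLike.congr_fun (hasMFDerivAt_pair hB hπ hp.contMDiffOn hxB).mfderiv v).trans ?_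
      exact Prod.ext hv hpv
  · intro x hxB hxθ hx0
    have hxη : ‖p x‖ ≤ η := by
      by_contra! h4
      have h5 := (smul_eq_zero.1 hx0).resolve_left ((hcpos _).2 h4).ne'
      rw [h5, norm_zero] at h4
      linarith
    by_contra hx
    refine h2 x ⟨?_, hxη⟩ hxθ
    rintro (⟨⟨t, z⟩, hz, rfl⟩ | ⟨⟨t, z⟩, hz, h4⟩)
    · have hz : ‖z‖ < r := hz
      have hz0 := hT.not_mem_binding.1 hxB
      rw [hp.norm_apply t hz0 hz.le] at hxη
      have := inv_anti₀ (norm_pos_iff.2 hz0) hz.le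
      linarith
    · exact hx ⟨t, z, hz, h4⟩

end

/-! ### Rescaling the collars -/

section

variable {M : Type*} [TopologicalSpace M] [ChartedSpace (EuclideanSpace ℝ (Fin 3)) M]
  {B : Set M} {π : M → Circle} {T : Bool → ℝ × ℂ → M} {i : Bool} {r ρ : ℝ} {p : M → ℂ}

/-- The extension by the identity of the map `T (t, z) ↦ T (t, R z)`. -/
def collarMap (T : ℝ × ℂ → M) (R : ℂ → ℂ) (x : M) : M :=
  open scoped Classical in
  if h : ∃ p, T p = x then T (h.choose.1, R h.choose.2) else x

omit [TopologicalSpace M] [ChartedSpace (EuclideanSpace ℝ (Fin 3)) M] in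
theorem collarMap_of_not {T : ℝ × ℂ → M} (R : ℂ → ℂ) {x : M} (hx : x ∉ range T) :
    collarMap T R x = x :=
  dif_neg hx

theorem angle_real_smul {a : ℝ} (ha : 0 < a) (z : ℂ) : angle (a • z) = angle z := by
  rw [angle, angle, Complex.real_smul, Complex.arg_real_mul z ha]

namespace IsCollars

variable {R : ℂ → ℂ}

theorem collarMap_apply (hT : IsCollars B π T) (i : Bool) (R : ℂ → ℂ) (t : ℝ) (z : ℂ) :
    collarMap (T i) R (T i (t, z)) = T i (t, R z) := by
  have h : ∃ p, T i p = T i (t, z) := ⟨_, rfl⟩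
  rw [collarMap, dif_pos h]
  have h1 := (hT.eq_iff i i h.choose.1 t h.choose.2 z).1 h.choose_spec
  rw [h1.2.2]
  exact hT.congr_exp i h1.2.1 _

theorem collarMap_not (hT : IsCollars B π T) (i : Bool) (R : ℂ → ℂ) (t : ℝ) (z : ℂ) :
    collarMap (T i) R (T (!i) (t, z)) = T (!i) (t, z) := by
  apply collarMap_of_not
  rintro ⟨⟨t', z'⟩, h⟩
  have := ((hT.eq_iff _ _ _ _ _ _).1 h).1
  cases i <;> simp at this

theorem collarMap_eq_self (hT : IsCollars B π T) (hR : ∀ z, r ≤ ‖z‖ → R z = z) {x : M}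
    (hx : x ∉ T i '' {p | ‖p.2‖ ≤ r}) : collarMap (T i) R x = x := by
  by_cases h : x ∈ range (T i)
  · obtain ⟨⟨t, z⟩, rfl⟩ := h
    rw [hT.collarMap_apply, hR z]
    by_contra! h
    exact hx ⟨(t, z), h.le, rfl⟩
  · exact collarMap_of_not R h

theorem collarMap_eventuallyEq [T2Space M] (hT : IsCollars B π T)
    (hR : ∀ z, r ≤ ‖z‖ → R z = z) {x : M} (hx : x ∉ range (T i)) :
    collarMap (T i) R =ᶠ[𝓝 x] id := by
  filter_upwards [(hT.isClosed_image i r).isOpen_compl.mem_nhds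
    fun h => hx (image_subset_range _ _ h)] with y hy
  exact hT.collarMap_eq_self hR hy

theorem collarMap_injective (hT : IsCollars B π T) (hR : Injective R) :
    Injective (collarMap (T i) R) := by
  intro x y hxy
  by_cases hx : x ∈ range (T i) <;> by_cases hy : y ∈ range (T i)
  · obtain ⟨⟨t, z⟩, rfl⟩ := hx
    obtain ⟨⟨t', z'⟩, rfl⟩ := hy
    rw [hT.collarMap_apply, hT.collarMap_apply, hT.eq_iff] at hxy
    exact (hT.eq_iff _ _ _ _ _ _).2 ⟨rfl, hxy.2.1, hR hxy.2.2⟩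
  · obtain ⟨⟨t, z⟩, rfl⟩ := hx
    rw [hT.collarMap_apply, collarMap_of_not R hy] at hxy
    exact (hy ⟨_, hxy⟩).elim
  · obtain ⟨⟨t, z⟩, rfl⟩ := hy
    rw [hT.collarMap_apply, collarMap_of_not R hx] at hxy
    exact (hx ⟨_, hxy.symm⟩).elim
  · rwa [collarMap_of_not R hx, collarMap_of_not R hy] at hxy

theorem collarMap_notMem_binding (hT : IsCollars B π T) (hR : ∀ z, z ≠ 0 → R z ≠ 0) {x : M}
    (hx : x ∉ B) : collarMap (T i) R x ∉ B := by
  by_cases h : x ∈ range (T i)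
  · obtain ⟨⟨t, z⟩, rfl⟩ := h
    rw [hT.collarMap_apply]
    exact hT.not_mem_binding.2 (hR z (hT.not_mem_binding.1 hx))
  · rwa [collarMap_of_not R h]

theorem proj_collarMap (hT : IsCollars B π T) (hR : ∀ z, z ≠ 0 → R z ≠ 0)
    (hRa : ∀ z, angle (R z) = angle z) {x : M} (hx : x ∉ B) : π (collarMap (T i) R x) = π x := by
  by_cases h : x ∈ range (T i)
  · obtain ⟨⟨t, z⟩, rfl⟩ := h
    have hz := hT.not_mem_binding.1 hx
    rw [hT.collarMap_apply, hT.proj i t z hz, hT.proj i t _ (hR z hz), hRa]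
  · rw [collarMap_of_not R h]

variable [IsManifold (𝓡 3) ∞ M] [T2Space M]

theorem contMDiff_collarMap (hT : IsCollars B π T) (hR : ∀ z, r ≤ ‖z‖ → R z = z)
    (hRs : ContDiff ℝ ∞ R) : ContMDiff (𝓡 3) (𝓡 3) ∞ (collarMap (T i) R) := by
  intro x
  by_cases hx : x ∈ range (T i)
  · obtain ⟨q, rfl⟩ := hx
    obtain ⟨N, g, hN, hmem, hg, hgp, h1, -⟩ := hT.exists_localInverse i q
    have hs : ContMDiff 𝓘(ℝ, ℝ × ℂ) 𝓘(ℝ, ℝ × ℂ) ∞ (fun q : ℝ × ℂ => (q.1, R q.2)) :=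
      (contDiff_fst.prodMk (hRs.comp contDiff_snd)).contMDiff
    refine (((hT.contMDiff i).comp hs).contMDiffAt.comp _
      (hg.contMDiffAt (hN.mem_nhds hmem))).congr_of_eventuallyEq ?_
    filter_upwards [hN.mem_nhds hmem] with y hy
    have := hT.collarMap_apply i R (g y).1 (g y).2
    rw [Prod.mk.eta, h1 y hy] at this
    exact this
  · exact contMDiffAt_id.congr_of_eventuallyEq (hT.collarMap_eventuallyEq hR hx)

theorem injective_mfderiv_collarMap (hT : IsCollars B π T) (hR : ∀ z, r ≤ ‖z‖ → R z = z)
    (hRs : ContDiff ℝ ∞ R) (hRd : ∀ z, Injective (fderiv ℝ R z)) (x : M) :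
    Injective (mfderiv (𝓡 3) (𝓡 3) (collarMap (T i) R) x) := by
  have hne : (∞ : WithTop ℕ∞) ≠ 0 := by simp
  by_cases hx : x ∈ range (T i)
  · obtain ⟨⟨t, z⟩, rfl⟩ := hx
    have hC := ((hT.contMDiff_collarMap (i := i) hR hRs).mdifferentiable hne
      (T i (t, z))).hasMFDerivAt
    have hTd : ∀ q, HasMFDerivAt 𝓘(ℝ, ℝ × ℂ) (𝓡 3) (T i) q _ := fun q =>
      ((hT.contMDiff i).mdifferentiable hne q).hasMFDerivAt
    have hS : HasFDerivAt (fun q : ℝ × ℂ => (q.1, R q.2)) _ (t, z) :=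
      hasFDerivAt_fst.prodMk (HasFDerivAt.comp (g := R) (f := Prod.snd) (t, z)
        ((hRs.differentiable hne) z).hasFDerivAt hasFDerivAt_snd)
    have h1 := hC.comp (t, z) (hTd (t, z))
    have h2 := ((hTd (t, R z)).comp (t, z) hS.hasMFDerivAt)
    have h3 : collarMap (T i) R ∘ T i = T i ∘ fun q : ℝ × ℂ => (q.1, R q.2) :=
      funext fun q => hT.collarMap_apply i R q.1 q.2
    rw [h3] at h1
    have h4 := hasMFDerivAt_unique h1 h2
    refine (injective_iff_map_eq_zero _).2 fun v hv => ?_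
    obtain ⟨w, rfl⟩ := Manifold.surjective_mfderiv_of_injective (by simp)
      (hT.injective_mfderiv i (t, z)) v
    have h5 := (DFunLike.congr_fun h4 w).symm.trans hv
    have h6 : ((w.1, fderiv ℝ R z w.2) : ℝ × ℂ) = 0 :=
      hT.injective_mfderiv i (t, R z) (Eq.trans h5 (map_zero _).symm)
    have h7 : w.2 = 0 := hRd z ((congrArg Prod.snd h6).trans (map_zero _).symm)
    have h8 : w = 0 := Prod.ext (Prod.ext_iff.1 h6).1 h7
    rw [h8]
    exact map_zero _
  · have h1 := (hasMFDerivAt_id (I := 𝓡 3) x).congr_of_eventuallyEq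
      (hT.collarMap_eventuallyEq hR hx)
    rw [h1.mfderiv]
    exact injective_id

end IsCollars

/-- The factor increases from r for ‖z‖ ≤ 1 to 1 for ‖z‖ ≥ 2. -/
theorem exists_radialMap (hr : 0 < r) (hr1 : r ≤ 1) : ∃ c : ℝ → ℝ, ContDiff ℝ ∞ c ∧ Monotone c ∧
    (∀ u, 0 < c u) ∧ (∀ z, ‖z‖ ≤ 1 → radialMap c z = r • z) ∧
    ∀ z, 2 ≤ ‖z‖ → radialMap c z = z := by
  have h1r : 0 ≤ 1 - r := by linarith
  refine ⟨fun u => r + (1 - r) * Real.smoothTransition ((u - 1) / 3), ?_, ?_, ?_, ?_, ?_⟩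
  · exact contDiff_const.add (contDiff_const.mul (Real.smoothTransition.contDiff.comp
      (by fun_prop)))
  · intro a b hab
    have := Real.smoothTransition.monotone (show (a - 1) / 3 ≤ (b - 1) / 3 by gcongr)
    dsimp only
    gcongr
  · intro u
    have := mul_nonneg h1r (Real.smoothTransition.nonneg ((u - 1) / 3))
    linarith
  · intro z hz
    have h1 : ‖z‖ ^ 2 ≤ 1 := pow_le_one₀ (norm_nonneg z) hz
    rw [radialMap, Real.smoothTransition.zero_of_nonpos (by linarith), mul_zero, add_zero]
  · intro z hz
    have h1 : (2 : ℝ) ^ 2 ≤ ‖z‖ ^ 2 := by gcongr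
    rw [radialMap, Real.smoothTransition.one_of_one_le (by linarith), mul_one,
      add_sub_cancel, one_smul]

/-- The radius near a component of the binding may be normalized to `1`. -/
theorem IsPageFun.exists_radius_one [IsManifold (𝓡 3) ∞ M] [T2Space M]
    (hp : IsPageFun B T i r ρ p) (hT : IsCollars B π T) (hB : IsClosed B)
    (hπ : ContMDiffOn (𝓡 3) (𝓡 1) ∞ π Bᶜ) :
    ∃ q, IsPageFun B T i 1 ρ q ∧ ∀ θ, IsGood B π T i p θ → IsGood B π T i q θ := by
  wlog hr1 : r ≤ 1 generalizing r
  · exact this (hp.mono one_pos (le_of_not_ge hr1) hp.radius_pos' le_rfl) le_rfl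
  have hne : (∞ : WithTop ℕ∞) ≠ 0 := by simp
  have hr := hp.radius_pos
  obtain ⟨c, hcs, hcm, hc0, hc1, hc2⟩ := exists_radialMap hr hr1
  have hR0 : ∀ z, z ≠ 0 → radialMap c z ≠ 0 := fun z hz => smul_ne_zero (hc0 _).ne' hz
  have hRa : ∀ z, angle (radialMap c z) = angle z := fun z => angle_real_smul (hc0 _) z
  set C := collarMap (T i) (radialMap c) with hC
  have hCB : ∀ {x}, x ∉ B → C x ∉ B := fun hx => hT.collarMap_notMem_binding hR0 hx
  have hCπ : ∀ {x}, x ∉ B → π (C x) = π x := fun hx => hT.proj_collarMap hR0 hRa hx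
  have hCs : ContMDiff (𝓡 3) (𝓡 3) ∞ C := hT.contMDiff_collarMap hc2 (contDiff_radialMap hcs)
  have hCi : Injective C :=
    hT.collarMap_injective fun z w h => radialMap_inj hcm (hc0 _) (hc0 _) h
  have hr' : (r : ℂ) ≠ 0 := by exact_mod_cast hr.ne'
  -- C shrinks the unit collar to the collar of radius r, where p gives exp(it) / (r ‖z‖); the
  -- factor r restores the standard form. C is injective and immersive and preserves π, so goodness
  -- is kept.
  refine ⟨fun x => r • p (C x), ⟨one_pos, hp.radius_pos', ?_, ?_, ?_⟩, ?_⟩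
  · exact (contDiff_const_smul r).contMDiff.comp_contMDiffOn
      (hp.contMDiffOn.comp hCs.contMDiffOn fun x hx => hCB hx)
  · intro t z hz hz1
    have hn : ‖r • z‖ = r * ‖z‖ := by rw [norm_smul, Real.norm_of_nonneg hr.le]
    have hn0 : (‖z‖ : ℂ) ≠ 0 := by simpa using hz
    change r • p (C (T i (t, z))) = _
    rw [hC, hT.collarMap_apply, hc1 z hz1, hp.apply_collar t _ (smul_ne_zero hr.ne' hz)
      (by rw [hn]; nlinarith), hn, Complex.real_smul, Complex.ofReal_mul]
    field_simp
  · intro t z hz hz1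
    rw [hC, hT.collarMap_not, hp.apply_collar_not t z hz hz1, smul_zero]
  intro θ h
  refine ⟨?_, ?_, ?_⟩
  · intro x hx y hy hxθ hyθ hxy hx0
    exact hCi (h.inj _ (hCB hx) _ (hCB hy) ((hCπ hx).trans hxθ) ((hCπ hy).trans hyθ)
      (smul_right_injective ℂ hr.ne' hxy) (right_ne_zero_of_smul hx0))
  · intro x hx hxθ hx0 v hv hqv
    have hCd := (hCs.mdifferentiable hne x).hasMFDerivAt
    have hpd := ((hp.contMDiffOn.contMDiffAt (hB.isOpen_compl.mem_nhds
      (hCB hx))).mdifferentiableAt hne).hasMFDerivAt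
    have hπd := (((contMDiffOn_coe_proj hπ).contMDiffAt (hB.isOpen_compl.mem_nhds
      (hCB hx))).mdifferentiableAt hne).hasMFDerivAt
    have hsd : HasFDerivAt (fun w : ℂ => r • w) (r • ContinuousLinearMap.id ℝ ℂ) (p (C x)) :=
      (hasFDerivAt_id _).const_smul r
    have h0 := hsd.hasMFDerivAt.comp x (hpd.comp x hCd)
    have h1 : r • mfderiv (𝓡 3) 𝓘(ℝ, ℂ) p (C x) (mfderiv (𝓡 3) (𝓡 3) C x v) = 0 :=
      (DFunLike.congr_fun h0.mfderiv v).symm.trans hqv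
    have h2 := (smul_eq_zero.1 h1).resolve_left hr.ne'
    have h3 := (hπd.comp x hCd).congr_of_eventuallyEq (f₁ := fun x => (π x : ℂ)) (by
      filter_upwards [hB.isOpen_compl.mem_nhds hx] with y hy
      exact congrArg _ (hCπ hy).symm)
    have h4 := (DFunLike.congr_fun h3.mfderiv v).symm.trans hv
    exact hT.injective_mfderiv_collarMap hc2 (contDiff_radialMap hcs)
      (fun z => injective_fderiv_radialMap hcm hcs (hc0 _)) x
      ((h.imm (C x) (hCB hx) ((hCπ hx).trans hxθ) (right_ne_zero_of_smul hx0) _ h4 h2).trans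
        (map_zero _).symm)
  · intro x hx hxθ hx0
    obtain ⟨t, z, hz, he⟩ := h.zero (C x) (hCB hx) ((hCπ hx).trans hxθ)
      ((smul_eq_zero.1 hx0).resolve_left hr.ne')
    refine ⟨t, z, hz, ?_⟩
    -- C preserves the collar of component `i` and is the identity off it, so zeros in the far
    -- collar have not moved.
    by_cases hxr : x ∈ range (T i)
    · obtain ⟨⟨t', z'⟩, rfl⟩ := hxr
      rw [hC, hT.collarMap_apply] at he
      have := ((hT.eq_iff _ _ _ _ _ _).1 he).1
      cases i <;> simp at this
    · rw [he, hC, collarMap_of_not _ hxr]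

end

/-! ### Two families of disjoint arcs covering the circle -/

section

theorem dist_circleExp_le (s t : ℝ) : dist (Circle.exp s) (Circle.exp t) ≤ |s - t| := by
  have h1 : (Circle.exp s : ℂ) - Circle.exp t =
      Circle.exp t * (Complex.exp (Complex.I * (s - t : ℝ)) - 1) := by
    simp only [Circle.coe_exp, mul_sub, mul_one, ← Complex.exp_add]
    congr 2
    push_cast
    ring
  change dist (Circle.exp s : ℂ) (Circle.exp t) ≤ _
  rw [Complex.dist_eq]
  rw [h1, norm_mul, Circle.norm_coe, one_mul]
  exact Real.norm_exp_I_mul_ofReal_sub_one_le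

/-- The arc of length `3 h / 2` around the one from `k h` to `(k + 1) h`. -/
def wideArc (h : ℝ) (k : ℕ) : Set Circle :=
  Circle.exp '' Icc ((k - 1 / 4) * h) ((k + 5 / 4) * h)

theorem isClosed_wideArc (h : ℝ) (k : ℕ) : IsClosed (wideArc h k) :=
  (isCompact_Icc.image Circle.exp.continuous).isClosed

theorem exists_wideArc_subset {V : Circle → Set Circle} (hV : ∀ θ, V θ ∈ 𝓝 θ) :
    ∃ δ > 0, ∀ h, 0 < h → h < δ → ∀ k, ∃ θ, wideArc h k ⊆ V θ := by
  obtain ⟨δ, hδ, hδV⟩ := lebesgue_number_lemma_of_metric (c := fun θ => interior (V θ))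
    isCompact_univ (fun θ => isOpen_interior)
    fun θ _ => mem_iUnion.2 ⟨θ, mem_interior_iff_mem_nhds.2 (hV θ)⟩
  -- A wide arc has length 3h / 2, which is below the Lebesgue number δ when h is below δ / 2.
  refine ⟨δ / 2, half_pos hδ, fun h hh hhδ k => ?_⟩
  obtain ⟨θ, hθ⟩ := hδV (Circle.exp ((k - 1 / 4) * h)) (mem_univ _)
  refine ⟨θ, ?_⟩
  rintro _ ⟨t, ht, rfl⟩
  refine interior_subset (hθ ((dist_circleExp_le _ _).trans_lt ?_))
  rw [abs_of_nonneg (by linarith [ht.1])]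
  linarith [ht.2]

/-- The circle is divided into 2n arcs of length h = π / n, each widened by h / 4 on both sides.
Consecutive wide arcs of the same parity are still h / 2 apart. -/
theorem disjoint_wideArc {n : ℕ} (hn : 0 < n) (b : ℕ) {j j' : Fin n} (hj : j ≠ j') :
    Disjoint (wideArc (Real.pi / n) (2 * j + b)) (wideArc (Real.pi / n) (2 * j' + b)) := by
  have hn' : (0 : ℝ) < n := by exact_mod_cast hn
  have hh : 0 < Real.pi / n := by positivity
  set h := Real.pi / n
  rw [disjoint_left]
  rintro _ ⟨s, hs, rfl⟩ ⟨s', hs', he⟩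
  obtain ⟨m, hm⟩ := Circle.exp_eq_exp.1 he
  have h2 : 2 * Real.pi = 2 * n * h := by
    simp only [h]
    field_simp
  rw [h2] at hm
  push_cast at hs hs'
  have e1 : ((2 * (j - j' + n * m) - 3 / 2 : ℝ)) * h ≤ 0 := by linarith [hs.1, hs'.2]
  have e2 : 0 ≤ ((2 * (j - j' + n * m) + 3 / 2 : ℝ)) * h := by linarith [hs.2, hs'.1]
  have e3 : ((2 * (j - j' + n * m) - 3 / 2 : ℝ)) ≤ 0 := by
    by_contra! h
    linarith [mul_pos h hh]
  have e4 : 0 ≤ ((2 * (j - j' + n * m) + 3 / 2 : ℝ)) := by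
    by_contra! h
    linarith [mul_neg_of_neg_of_pos h hh]
  have e5 : ((j : ℤ) - (j' : ℤ) + n * m : ℤ) < 1 := by
    have : (((j : ℤ) - (j' : ℤ) + n * m : ℤ) : ℝ) < 1 := by push_cast; linarith
    exact_mod_cast this
  have e6 : -1 < ((j : ℤ) - (j' : ℤ) + n * m : ℤ) := by
    have : (-1 : ℝ) < (((j : ℤ) - (j' : ℤ) + n * m : ℤ) : ℝ) := by push_cast; linarith
    exact_mod_cast this
  have e7 : (j : ℤ) - (j' : ℤ) = n * -m := by linarith
  have e8 := Int.eq_zero_of_abs_lt_dvd ⟨-m, e7⟩ (by rw [abs_lt]; omega)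
  exact hj (Fin.ext (by omega))

/-- Every angle lies in one of the 2n arcs, and the margin h / 4 makes the widened arc a
neighbourhood of it; the parity of the index selects the family. -/
theorem exists_wideArc_mem_nhds {n : ℕ} (hn : 0 < n) (θ : Circle) :
    ∃ (b : Bool) (j : Fin n), wideArc (Real.pi / n) (2 * j + b.toNat) ∈ 𝓝 θ := by
  have hn' : (0 : ℝ) < n := by exact_mod_cast hn
  have hh : 0 < Real.pi / n := by positivity
  set h := Real.pi / n with hdef
  obtain ⟨t, ht⟩ : ∃ t, Circle.exp t = θ := ⟨_, Circle.exp_arg θ⟩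
  obtain ⟨t', ht', rfl⟩ : ∃ t' ∈ Ico 0 (2 * Real.pi), Circle.exp t' = θ := by
    refine ⟨toIcoMod Real.two_pi_pos 0 t, ?_, ?_⟩
    · simpa using toIcoMod_mem_Ico Real.two_pi_pos 0 t
    · rw [← ht, Circle.exp_eq_exp]
      exact ⟨-toIcoDiv Real.two_pi_pos 0 t, by
        have := toIcoMod_add_toIcoDiv_zsmul Real.two_pi_pos 0 t
        rw [zsmul_eq_mul] at this
        push_cast
        linarith⟩
  set k := ⌊t' / h⌋₊ with hk
  have hk0 : 0 ≤ t' / h := div_nonneg ht'.1 hh.le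
  have h1 : k * h ≤ t' := (le_div_iff₀ hh).1 (Nat.floor_le hk0)
  have h2 : t' < (k + 1) * h := (div_lt_iff₀ hh).1 (Nat.lt_floor_add_one _)
  have h3 : k < 2 * n := by
    rw [hk, Nat.floor_lt hk0, div_lt_iff₀ hh]
    refine ht'.2.trans_eq ?_
    rw [hdef]
    push_cast
    field_simp
  have key : wideArc h k ∈ 𝓝 (Circle.exp t') :=
    isLocalHomeomorph_circleExp.isOpenMap.image_mem_nhds
      (Icc_mem_nhds (by linarith) (by linarith))
  have hk2 : 2 * (k / 2) + k % 2 = k := Nat.div_add_mod k 2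
  refine ⟨decide (k % 2 = 1), ⟨k / 2, by omega⟩, ?_⟩
  have : 2 * (k / 2) + (decide (k % 2 = 1)).toNat = k := by
    rcases Nat.mod_two_eq_zero_or_one k with h4 | h4 <;> simp [h4] <;> omega
  simpa only [this] using key

/-- Two finite families of disjoint arcs, small with respect to given neighbourhoods, which
together cover the circle. -/
theorem exists_arcs {V : Bool → Circle → Set Circle} (hV : ∀ i θ, V i θ ∈ 𝓝 θ) :
    ∃ (n : ℕ) (K : Bool → Fin (n + 1) → Set Circle), (∀ i j, IsClosed (K i j)) ∧
      (∀ i j, ∃ θ, K i j ⊆ V i θ) ∧ (∀ i, Pairwise (Disjoint on K i)) ∧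
      ∀ θ, ∃ i j, K i j ∈ 𝓝 θ := by
  -- Intersecting the two neighbourhood systems gives one mesh for both families. The use of n + 1
  -- below keeps the index sets nonempty.
  obtain ⟨δ, hδ, h⟩ := exists_wideArc_subset (V := fun θ => V true θ ∩ V false θ)
    fun θ => inter_mem (hV true θ) (hV false θ)
  obtain ⟨n, hn⟩ := exists_nat_gt (Real.pi / δ)
  have hn0 : (0 : ℝ) < (n + 1 : ℕ) := by positivity
  refine ⟨n, fun i j => wideArc (Real.pi / (n + 1 : ℕ)) (2 * j + i.toNat),
    fun i j => isClosed_wideArc _ _, fun i j => ?_,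
    fun i j j' hj => disjoint_wideArc n.succ_pos i.toNat hj,
    fun θ => exists_wideArc_mem_nhds n.succ_pos θ⟩
  obtain ⟨θ, hθ⟩ := h (Real.pi / (n + 1 : ℕ)) (by positivity) (by
    rw [div_lt_iff₀ hn0]
    rw [div_lt_iff₀ hδ] at hn
    push_cast
    linarith) (2 * j + i.toNat)
  refine ⟨θ, hθ.trans ?_⟩
  cases i
  · exact inter_subset_right
  · exact inter_subset_left

end

/-! ### Gluing page functions over arcs -/

section

variable {M : Type*} [TopologicalSpace M] [ChartedSpace (EuclideanSpace ℝ (Fin 3)) M]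
  {B : Set M} {π : M → Circle} {T : Bool → ℝ × ℂ → M} {i : Bool} {r ρ : ℝ} {p q : M → ℂ}

/-- Goodness at θ depends only on the function over a neighbourhood of θ; its values on the page
alone would not control the derivatives in `IsGood`. -/
theorem IsGood.congr {K : Set Circle} {θ : Circle} (h : IsGood B π T i q θ) (hB : IsClosed B)
    (hπ : ContMDiffOn (𝓡 3) (𝓡 1) ∞ π Bᶜ) (hK : K ∈ 𝓝 θ)
    (hpq : ∀ x ∉ B, π x ∈ K → p x = q x) : IsGood B π T i p θ := by
  have hθ := mem_of_mem_nhds hK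
  refine ⟨fun x hx y hy hxθ hyθ hxy hx0 => ?_, fun x hx hxθ hx0 v hv hpv => ?_,
    fun x hx hxθ hx0 => ?_⟩
  · rw [hpq x hx (hxθ ▸ hθ)] at hxy hx0
    rw [hpq y hy (hyθ ▸ hθ)] at hxy
    exact h.inj x hx y hy hxθ hyθ hxy hx0
  · have h1 : p =ᶠ[𝓝 x] q := by
      have h2 : ∀ᶠ y in 𝓝 x, π y ∈ K := (hπ.continuousOn.continuousAt
        (hB.isOpen_compl.mem_nhds hx)).eventually (by rw [hxθ]; exact hK)
      filter_upwards [h2, hB.isOpen_compl.mem_nhds hx] with y hy hyB using hpq y hyB hy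
    rw [hpq x hx (hxθ ▸ hθ)] at hx0
    exact h.imm x hx hxθ hx0 v hv ((DFunLike.congr_fun h1.mfderiv_eq v).symm.trans hpv)
  · rw [hpq x hx (hxθ ▸ hθ)] at hx0
    exact h.zero x hx hxθ hx0

variable [IsManifold (𝓡 3) ∞ M] [T2Space M] [CompactSpace M]

/-- Page functions prescribed over disjoint closed subsets of the circle may be glued. -/
theorem IsPageFun.exists_glue {ι : Type*} [Finite ι] [Nonempty ι] {K : ι → Set Circle}
    (hK : ∀ j, IsClosed (K j)) (hKd : Pairwise (Disjoint on K)) {q : ι → M → ℂ}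
    (hq : ∀ j, IsPageFun B T i r ρ (q j)) (hT : IsCollars B π T) (hB : IsClosed B)
    (hπ : ContMDiffOn (𝓡 3) (𝓡 1) ∞ π Bᶜ) :
    ∃ p, IsPageFun B T i r ρ p ∧ ∀ j, ∀ x ∉ B, π x ∈ K j → p x = q j x := by
  classical
  obtain ⟨j₁⟩ := ‹Nonempty ι›
  let S : M → Set ℂ := fun x => {w |
    (∀ t z, z ≠ 0 → ‖z‖ ≤ r → T i (t, z) = x → w = (Circle.exp t : ℂ) / ‖z‖) ∧
    (∀ t z, z ≠ 0 → ‖z‖ ≤ ρ → T (!i) (t, z) = x → w = 0) ∧ ∀ j, π x ∈ K j → w = q j x}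
  have hq' : ∀ j x, x ∉ B → (∀ j', j' ≠ j → π x ∉ K j') → q j x ∈ S x := by
    intro j x hx hj
    refine ⟨?_, ?_, ?_⟩
    · rintro t z hz hzr rfl
      exact (hq j).apply_collar t z hz hzr
    · rintro t z hz hzr rfl
      exact (hq j).apply_collar_not t z hz hzr
    · intro j' hj'
      by_cases h : j' = j
      · rw [h]
      · exact (hj j' h hj').elim
  -- By disjointness at most one arc concerns a given point; the function of that arc, or any one of
  -- them if there is none, is an admissible local choice.
  have hex : ∀ x, ∃ j, ∀ j', j' ≠ j → π x ∉ K j' := by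
    intro x
    by_cases h : ∃ j, π x ∈ K j
    · obtain ⟨j, hj⟩ := h
      exact ⟨j, fun j' hj' hx => (disjoint_left.1 (hKd hj')) hx hj⟩
    · push Not at h
      exact ⟨j₁, fun j' _ => h j'⟩
  have hr := (hq j₁).radius_pos
  have hρ := (hq j₁).radius_pos'
  obtain ⟨p, hp, hpS⟩ := hT.exists_contMDiffOn_of_local hB hπ i S (by
    rintro x - w₁ ⟨h1, h2, h3⟩ w₂ ⟨h1', h2', h3'⟩ a b ha hb hab
    refine ⟨fun t z hz hzr hx => ?_, fun t z hz hzr hx => ?_, fun j hj => ?_⟩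
    · rw [h1 t z hz hzr hx, h1' t z hz hzr hx, ← add_smul, hab, one_smul]
    · rw [h2 t z hz hzr hx, h2' t z hz hzr hx, ← add_smul, hab, one_smul]
    · rw [h3 j hj, h3' j hj, ← add_smul, hab, one_smul]) (by
    intro x hx
    obtain ⟨j, hj⟩ := hex x
    have hc := hπ.continuousOn.continuousAt (hB.isOpen_compl.mem_nhds hx)
    have h1 : ∀ᶠ y in 𝓝 x, ∀ j', j' ≠ j → π y ∉ K j' := by
      rw [eventually_all]
      intro j'
      by_cases h : j' = j
      · exact Eventually.of_forall fun y hy => (hy h).elim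
      · filter_upwards [hc.eventually ((hK j').isOpen_compl.mem_nhds (hj j' h))] with y hy _
        exact hy
    refine ⟨_, inter_mem h1 (hB.isOpen_compl.mem_nhds hx), q j,
      (hq j).contMDiffOn.mono inter_subset_right, fun y hy hyB => hq' j y hyB hy.1⟩) (by
    refine ⟨min r ρ, lt_min hr hρ, fun t z hz hzr => ⟨?_, ?_⟩⟩
    · obtain ⟨j, hj⟩ := hex (T i (t, z))
      rw [← (hq j).apply_collar t z hz (hzr.trans (min_le_left _ _))]
      exact hq' j _ (hT.not_mem_binding.2 hz) hj
    · obtain ⟨j, hj⟩ := hex (T (!i) (t, z))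
      rw [← (hq j).apply_collar_not t z hz (hzr.trans (min_le_right _ _))]
      exact hq' j _ (hT.not_mem_binding.2 hz) hj)
  exact ⟨p, ⟨hr, hρ, hp,
    fun t z hz hzr => (hpS _ (hT.not_mem_binding.2 hz)).1 t z hz hzr rfl,
    fun t z hz hzr => (hpS _ (hT.not_mem_binding.2 hz)).2.1 t z hz hzr rfl⟩,
    fun j x hx hj => (hpS x hx).2.2 j hj⟩

/-- Two page functions, at least one of which is good on each page. -/
theorem IsCollars.exists_isPageFun_pair (hT : IsCollars B π T)
    (hπ : IsOpenBook3 annulusModel Annulus B π) :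
    ∃ (p : Bool → M → ℂ) (ρ : Bool → ℝ), (∀ i, IsPageFun B T i 1 (ρ i) (p i)) ∧
      ∀ θ, ∃ i, IsGood B π T i (p i) θ := by
  have hB := hπ.isClosed_binding
  have hπs := hπ.contMDiffOn_proj
  have h1 : ∀ i θ, ∃ q ρ, IsPageFun B T i 1 ρ q ∧ ∀ᶠ θ' in 𝓝 θ, IsGood B π T i q θ' := by
    intro i θ
    obtain ⟨p, r, ρ, hp, hg⟩ := hT.exists_isGood hπ i θ
    obtain ⟨p', hp', hg'⟩ := hg.exists_eventually hp hT hB hπs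
    obtain ⟨q, hq, hqg⟩ := hp'.exists_radius_one hT hB hπs
    exact ⟨q, ρ, hq, hg'.mono hqg⟩
  choose q ρ hq hg using h1
  obtain ⟨n, K, hKc, hKs, hKd, hK⟩ := exists_arcs hg
  choose φ hφ using hKs
  have h2 : ∀ i, ∃ p ρ', IsPageFun B T i 1 ρ' p ∧
      ∀ j, ∀ x ∉ B, π x ∈ K i j → p x = q i (φ i j) x := by
    intro i
    -- The standard radius is already 1 for all pieces; the radius of vanishing is taken to be the
    -- least of the finitely many involved.
    obtain ⟨j₀, hj₀⟩ := Finite.exists_min fun j => ρ i (φ i j)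
    obtain ⟨p, hp, hpq⟩ := IsPageFun.exists_glue (hKc i) (hKd i)
      (fun j => (hq i (φ i j)).mono one_pos le_rfl (hq i (φ i j₀)).radius_pos' (hj₀ j)) hT hB hπs
    exact ⟨p, _, hp, hpq⟩
  choose p ρ' hp hpq using h2
  refine ⟨p, ρ', hp, fun θ => ?_⟩
  obtain ⟨i, j, hij⟩ := hK θ
  exact ⟨i, (hφ i j (mem_of_mem_nhds hij)).congr hB hπs hij (hpq i j)⟩

end

/-! ### The map to ℂ³: injectivity and immersivity up to positive multiples -/

section

variable {M : Type*} [TopologicalSpace M] [ChartedSpace (EuclideanSpace ℝ (Fin 3)) M]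
  {B : Set M} {π : M → Circle} {T : Bool → ℝ × ℂ → M} {i : Bool} {ρ : ℝ} {p : M → ℂ} {ζ : M → ℂ}

/-- The function `‖ζ‖ p`, extended over the binding by the angular coordinate of its
component `i`. -/
def extendPageFun (B : Set M) (T : Bool → ℝ × ℂ → M) (ζ : M → ℂ) (i : Bool) (p : M → ℂ) (x : M) :
    ℂ :=
  open scoped Classical in
  if x ∈ B then (collarCoord (T i) x).1 else ‖ζ x‖ • p x

omit [TopologicalSpace M] [ChartedSpace (EuclideanSpace ℝ (Fin 3)) M] in
theorem extendPageFun_of_notMem {x : M} (hx : x ∉ B) :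
    extendPageFun B T ζ i p x = ‖ζ x‖ • p x :=
  if_neg hx

theorem IsDefiningFun.apply_binding (hζ : IsDefiningFun B π T ζ) (hT : IsCollars B π T) {x : M}
    (hx : x ∈ B) : ζ x = 0 := by
  obtain ⟨i, t, rfl⟩ := (hT.mem_binding x).1 hx
  exact hζ.apply_collar i t 0 (by simp)

theorem IsDefiningFun.eq_zero_iff (hζ : IsDefiningFun B π T ζ) (hT : IsCollars B π T) {x : M} :
    ζ x = 0 ↔ x ∈ B :=
  ⟨fun h => by_contra fun hx => hζ.ne_zero x hx h, hζ.apply_binding hT⟩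

theorem IsDefiningFun.coe_proj_eq (hζ : IsDefiningFun B π T ζ) {x : M} (hx : x ∉ B) :
    (π x : ℂ) = ‖ζ x‖⁻¹ • ζ x := by
  have h : ‖ζ x‖ ≠ 0 := norm_ne_zero_iff.2 (hζ.ne_zero x hx)
  rw [eq_inv_smul_iff₀ h, Complex.real_smul, ← hζ.eq_mul x hx]

theorem angle_coe_circle (θ : Circle) : angle (θ : ℂ) = θ := Circle.exp_arg θ

theorem IsDefiningFun.angle_eq (hζ : IsDefiningFun B π T ζ) {x : M} (hx : x ∉ B) :
    angle (ζ x) = π x := by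
  rw [hζ.eq_mul x hx, ← Complex.real_smul,
    angle_real_smul (norm_pos_iff.2 (hζ.ne_zero x hx)), angle_coe_circle]

namespace IsPageFun

theorem extend_collar (hp : IsPageFun B T i 1 ρ p) (hT : IsCollars B π T)
    (hζ : IsDefiningFun B π T ζ) (t : ℝ) {z : ℂ} (hz : ‖z‖ ≤ 1) :
    extendPageFun B T ζ i p (T i (t, z)) = Circle.exp t := by
  by_cases hz0 : z = 0
  · subst hz0
    rw [extendPageFun, if_pos ((hT.mem_binding _).2 ⟨i, t, rfl⟩), hT.coord_apply]
  · have hn : (‖z‖ : ℂ) ≠ 0 := by simpa using hz0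
    rw [extendPageFun_of_notMem (hT.not_mem_binding.2 hz0), hζ.apply_collar i t z hz,
      hp.apply_collar t z hz0 hz, Complex.real_smul, mul_div_cancel₀ _ hn]

theorem extend_collar_not (hp : IsPageFun B T i 1 ρ p) (hT : IsCollars B π T) (t : ℝ) {z : ℂ}
    (hz : ‖z‖ ≤ ρ) : extendPageFun B T ζ i p (T (!i) (t, z)) = 0 := by
  by_cases hz0 : z = 0
  · subst hz0
    rw [extendPageFun, if_pos ((hT.mem_binding _).2 ⟨!i, t, rfl⟩), collarCoord, dif_neg]
    · rfl
    · rintro ⟨⟨t', z'⟩, h⟩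
      have := ((hT.eq_iff _ _ _ _ _ _).1 h).1
      cases i <;> simp at this
  · rw [extendPageFun_of_notMem (hT.not_mem_binding.2 hz0), hp.apply_collar_not t z hz0 hz,
      smul_zero]

theorem contMDiff_extend [IsManifold (𝓡 3) ∞ M] (hp : IsPageFun B T i 1 ρ p)
    (hT : IsCollars B π T) (hB : IsClosed B) (hζ : IsDefiningFun B π T ζ) :
    ContMDiff (𝓡 3) 𝓘(ℝ, ℂ) ∞ (extendPageFun B T ζ i p) := by
  intro x
  by_cases hx : x ∈ B
  · obtain ⟨j, t, rfl⟩ := (hT.mem_binding x).1 hx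
    by_cases hj : j = i
    · subst hj
      have h1 : ContMDiff 𝓘(ℝ, ℂ × ℂ) 𝓘(ℝ, ℂ) ∞ (Prod.fst : ℂ × ℂ → ℂ) :=
        contDiff_fst.contMDiff
      refine ((h1.comp_contMDiffOn (hT.contMDiffOn_coord j)).contMDiffAt
        ((hT.isOpenMap j).isOpen_range.mem_nhds ⟨(t, 0), rfl⟩)).congr_of_eventuallyEq ?_
      filter_upwards [(hT.isOpen_image j 1).mem_nhds ⟨(t, 0), by simp, rfl⟩] with y hy
      obtain ⟨⟨t', z'⟩, hz', rfl⟩ := hy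
      rw [hp.extend_collar hT hζ t' (le_of_lt hz'), comp_apply, hT.coord_apply]
    · obtain rfl := Bool.eq_not_of_ne hj
      refine (contMDiffAt_const (c := (0 : ℂ))).congr_of_eventuallyEq ?_
      filter_upwards [(hT.isOpen_image (!i) ρ).mem_nhds
        ⟨(t, 0), by simpa using hp.radius_pos', rfl⟩] with y hy
      obtain ⟨⟨t', z'⟩, hz', rfl⟩ := hy
      exact hp.extend_collar_not hT t' (le_of_lt hz')
  · have h1 : ContMDiffOn (𝓡 3) 𝓘(ℝ, ℂ) ∞ (fun x => ‖ζ x‖ • p x) Bᶜ :=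
      ContMDiffOn.smul (f := fun x => ‖ζ x‖) hζ.contMDiffOn_norm hp.contMDiffOn
    refine (h1.contMDiffAt (hB.isOpen_compl.mem_nhds hx)).congr_of_eventuallyEq ?_
    filter_upwards [hB.isOpen_compl.mem_nhds hx] with y hy
    exact extendPageFun_of_notMem hy

end IsPageFun

/-- The map to `ℂ³` whose coordinates are `ζ` and the extensions of two page functions. -/
def bookMap (B : Set M) (T : Bool → ℝ × ℂ → M) (ζ : M → ℂ) (p : Bool → M → ℂ) (x : M) :
    ℂ × (Bool → ℂ) :=
  (ζ x, fun i => extendPageFun B T ζ i (p i) x)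

/-- The data of two page functions, at least one of which is good on each page. -/
structure IsPagePair (B : Set M) (π : M → Circle) (T : Bool → ℝ × ℂ → M) (ζ : M → ℂ)
    (p : Bool → M → ℂ) (ρ : Bool → ℝ) : Prop where
  collars : IsCollars B π T
  isClosed : IsClosed B
  contMDiffOn_proj : ContMDiffOn (𝓡 3) (𝓡 1) ∞ π Bᶜ
  definingFun : IsDefiningFun B π T ζ
  pageFun : ∀ i, IsPageFun B T i 1 (ρ i) (p i)
  good : ∀ θ, ∃ i, IsGood B π T i (p i) θ

namespace IsPagePair

variable {p : Bool → M → ℂ} {ρ : Bool → ℝ}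

/-- Off the binding ζ is nonzero, and on component `i` the coordinate `i` has modulus 1. -/
theorem bookMap_ne_zero (h : IsPagePair B π T ζ p ρ) (x : M) : bookMap B T ζ p x ≠ 0 := by
  intro h0
  by_cases hx : x ∈ B
  · obtain ⟨i, t, rfl⟩ := (h.collars.mem_binding x).1 hx
    have h1 := congrFun (congrArg Prod.snd h0) i
    have h2 := (h.pageFun i).extend_collar h.collars h.definingFun t (z := 0) (by simp)
    exact Circle.coe_ne_zero _ (h2.symm.trans h1)
  · exact h.definingFun.ne_zero x hx (congrArg Prod.fst h0)

theorem eq_inv_smul (h : IsPagePair B π T ζ p ρ) {x : M} (hx : x ∉ B) (i : Bool) :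
    p i x = ‖(bookMap B T ζ p x).1‖⁻¹ • (bookMap B T ζ p x).2 i := by
  have h1 : ‖ζ x‖ ≠ 0 := norm_ne_zero_iff.2 (h.definingFun.ne_zero x hx)
  change p i x = ‖ζ x‖⁻¹ • extendPageFun B T ζ i (p i) x
  rw [extendPageFun_of_notMem hx, inv_smul_smul₀ h1]

/-- The map `bookMap` is injective up to positive multiples. -/
theorem eq_of_bookMap_eq_smul (h : IsPagePair B π T ζ p ρ) {x y : M} {c : ℝ} (hc : 0 < c)
    (hxy : bookMap B T ζ p y = c • bookMap B T ζ p x) : x = y := by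
  have h1 : ζ y = c • ζ x := congrArg Prod.fst hxy
  have h2 : ∀ i, extendPageFun B T ζ i (p i) y = c • extendPageFun B T ζ i (p i) x :=
    fun i => congrFun (congrArg Prod.snd hxy) i
  have hT := h.collars
  have hζ := h.definingFun
  by_cases hx : x ∈ B
  · have hy : y ∈ B := by
      rw [← hζ.eq_zero_iff hT] at hx ⊢
      rw [h1, hx, smul_zero]
    obtain ⟨i, t, rfl⟩ := (hT.mem_binding x).1 hx
    obtain ⟨j, t', rfl⟩ := (hT.mem_binding y).1 hy
    have h3 := h2 i
    rw [(h.pageFun i).extend_collar hT hζ t (by simp)] at h3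
    by_cases hj : j = i
    · subst hj
      rw [(h.pageFun j).extend_collar hT hζ t' (by simp)] at h3
      have h4 := congrArg norm h3
      rw [norm_smul, Circle.norm_coe, Circle.norm_coe, mul_one, Real.norm_of_nonneg hc.le] at h4
      rw [← h4, one_smul] at h3
      exact hT.congr_exp j (Circle.coe_injective h3.symm) 0
    · obtain rfl := Bool.eq_not_of_ne hj
      rw [(h.pageFun i).extend_collar_not hT t' (by simpa using (h.pageFun i).radius_pos'.le)] at h3
      exact (smul_ne_zero hc.ne' (Circle.coe_ne_zero _) h3.symm).elim
  · have hy : y ∉ B := by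
      rw [← hζ.eq_zero_iff hT] at hx ⊢
      rw [h1]
      exact smul_ne_zero hc.ne' hx
    -- The argument of ζ and the quotients by ‖ζ‖ do not change under positive scaling, so x and y
    -- lie on the same page with equal values of both page functions.
    have hπ : π x = π y := by
      rw [← hζ.angle_eq hx, ← hζ.angle_eq hy, h1, angle_real_smul hc]
    have hp : ∀ i, p i x = p i y := by
      intro i
      rw [h.eq_inv_smul hx, h.eq_inv_smul hy, hxy]
      change _ = ‖c • (bookMap B T ζ p x).1‖⁻¹ • (c • (bookMap B T ζ p x).2 i)
      rw [norm_smul, Real.norm_of_nonneg hc.le, smul_smul, mul_inv, mul_right_comm,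
        inv_mul_cancel₀ hc.ne', one_mul]
    obtain ⟨i, hi⟩ := h.good (π x)
    -- At a common zero of the good function both points lie in the unit collar of the other
    -- component, where the other function is standard and separates them.
    by_cases h0 : p i x = 0
    · obtain ⟨t, z, hz, rfl⟩ := hi.zero x hx rfl h0
      obtain ⟨t', z', hz', rfl⟩ := hi.zero y hy hπ.symm (hp i ▸ h0)
      exact (h.pageFun (!i)).inj_collar hT (hT.not_mem_binding.1 hx) (hT.not_mem_binding.1 hy)
        hz.le hz'.le hπ (hp _)
    · exact hi.inj x hx y hy rfl hπ.symm (hp i) h0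

variable [IsManifold (𝓡 3) ∞ M]

theorem contMDiff_bookMap (h : IsPagePair B π T ζ p ρ) :
    ContMDiff (𝓡 3) 𝓘(ℝ, ℂ × (Bool → ℂ)) ∞ (bookMap B T ζ p) :=
  h.definingFun.contMDiff.prodMk_space (contMDiff_pi_space.2 fun i =>
    (h.pageFun i).contMDiff_extend h.collars h.isClosed h.definingFun)

/-- A smooth map which is a positive multiple of `bookMap` is an immersion. -/
theorem eq_zero_of_mfderiv_eq_zero (h : IsPagePair B π T ζ p ρ) {F : M → ℂ × (Bool → ℂ)}
    {s : M → ℝ} (hs : ∀ x, 0 < s x) (hF : ∀ x, F x = s x • bookMap B T ζ p x) {x : M}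
    (hFx : MDifferentiableAt (𝓡 3) 𝓘(ℝ, ℂ × (Bool → ℂ)) F x) {v : TangentSpace (𝓡 3) x}
    (hv : mfderiv (𝓡 3) 𝓘(ℝ, ℂ × (Bool → ℂ)) F x v = 0) : v = 0 := by
  have hne : (∞ : WithTop ℕ∞) ≠ 0 := by simp
  have hT := h.collars
  have hζ := h.definingFun
  have hsn : ∀ (y : M) (w u : ℂ), ‖s y • w‖⁻¹ • (s y • u) = ‖w‖⁻¹ • u := by
    intro y w u
    rw [norm_smul, Real.norm_of_nonneg (hs y).le, smul_smul, mul_inv, mul_right_comm,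
      inv_mul_cancel₀ (hs y).ne', one_mul]
  by_cases hx : x ∈ B
  · obtain ⟨i, t, rfl⟩ := (hT.mem_binding x).1 hx
    have hval : ∀ t' z', ‖z'‖ < 1 → (F (T i (t', z'))).2 i = s (T i (t', z')) • (Circle.exp t' : ℂ) ∧
        (F (T i (t', z'))).1 = s (T i (t', z')) • z' := by
      intro t' z' hz'
      rw [hF, ← (h.pageFun i).extend_collar hT hζ t' hz'.le]
      exact ⟨rfl, congrArg (s (T i (t', z')) • ·) (hζ.apply_collar i t' z' hz'.le)⟩
    have h0 : (F (T i (t, 0))).2 i ≠ 0 := by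
      rw [(hval t 0 (by simp)).1]
      exact smul_ne_zero (hs _).ne' (Circle.coe_ne_zero _)
    have hc := (((hT.contMDiffOn_coord i).contMDiffAt
      ((hT.isOpenMap i).isOpen_range.mem_nhds ⟨(t, 0), rfl⟩)).mdifferentiableAt hne).hasMFDerivAt
    have hpr : ContDiff ℝ ∞ (fun u : ℂ × (Bool → ℂ) => u.2 i) := by fun_prop
    have hN : DifferentiableAt ℝ (fun u : ℂ × (Bool → ℂ) => ‖u.2 i‖⁻¹) (F (T i (t, 0))) :=
      ((hpr.contDiffAt.norm ℝ h0).inv (norm_ne_zero_iff.2 h0)).differentiableAt hne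
    have hG : DifferentiableAt ℝ
        (fun u : ℂ × (Bool → ℂ) => (‖u.2 i‖⁻¹ • u.2 i, ‖u.2 i‖⁻¹ • u.1)) (F (T i (t, 0))) :=
      (hN.smul (hpr.differentiable hne _)).prodMk (hN.smul differentiableAt_fst)
    -- In the collar, F is a positive multiple of a vector with first entry z and entry `i` equal to
    -- exp(it). Dividing by the modulus of that entry restores the collar coordinates, whatever the
    -- scaling factor.
    have h1 := hc.apply_eq_zero_of_comp hFx.hasMFDerivAt hG.mdifferentiableAt (by
      filter_upwards [(hT.isOpen_image i 1).mem_nhds ⟨(t, 0), by simp, rfl⟩] with y hy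
      obtain ⟨⟨t', z'⟩, hz', rfl⟩ := hy
      rw [hT.coord_apply]
      change _ = (‖(F (T i (t', z'))).2 i‖⁻¹ • (F (T i (t', z'))).2 i,
        ‖(F (T i (t', z'))).2 i‖⁻¹ • (F (T i (t', z'))).1)
      rw [(hval t' z' hz').1, (hval t' z' hz').2, hsn, hsn, Circle.norm_coe, inv_one, one_smul, one_smul]) hv
    exact hT.injective_mfderiv_coord i (t, 0) (h1.trans (map_zero _).symm)
  · have hFne : (F x).1 ≠ 0 := by
      rw [hF]
      exact smul_ne_zero (hs x).ne' (hζ.ne_zero x hx)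
    have hN : DifferentiableAt ℝ (fun u : ℂ × (Bool → ℂ) => ‖u.1‖⁻¹) (F x) :=
      ((contDiffAt_fst.norm ℝ hFne).inv (norm_ne_zero_iff.2 hFne)).differentiableAt hne
    have hGπ : DifferentiableAt ℝ (fun u : ℂ × (Bool → ℂ) => ‖u.1‖⁻¹ • u.1) (F x) :=
      hN.smul differentiableAt_fst
    have hnhds := h.isClosed.isOpen_compl.mem_nhds hx
    have hπv := (((contMDiffOn_coe_proj h.contMDiffOn_proj).contMDiffAt
      hnhds).mdifferentiableAt hne).hasMFDerivAt.apply_eq_zero_of_comp hFx.hasMFDerivAt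
      hGπ.mdifferentiableAt (by
        filter_upwards [hnhds] with y hy
        rw [hζ.coe_proj_eq hy, comp_apply, hF, ← hsn y (ζ y) (ζ y)]
        rfl) hv
    have hpv : ∀ i, mfderiv (𝓡 3) 𝓘(ℝ, ℂ) (p i) x v = 0 := by
      intro i
      have hG : DifferentiableAt ℝ (fun u : ℂ × (Bool → ℂ) => ‖u.1‖⁻¹ • u.2 i) (F x) :=
        hN.smul (by fun_prop)
      exact (((h.pageFun i).contMDiffOn.contMDiffAt
        hnhds).mdifferentiableAt hne).hasMFDerivAt.apply_eq_zero_of_comp hFx.hasMFDerivAt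
        hG.mdifferentiableAt (by
          filter_upwards [hnhds] with y hy
          rw [h.eq_inv_smul hy, comp_apply, hF]
          exact (hsn y (ζ y) _).symm) hv
    obtain ⟨i, hi⟩ := h.good (π x)
    by_cases h0 : p i x = 0
    · obtain ⟨t, z, hz, rfl⟩ := hi.zero x hx rfl h0
      exact (h.pageFun (!i)).imm_collar hT h.isClosed h.contMDiffOn_proj
        (hT.not_mem_binding.1 hx) hz v hπv (hpv _)
    · exact hi.imm x hx rfl h0 v hπv (hpv i)

end IsPagePair

end

/-! ### Projection to the sphere -/

section

/-- The identification of `ℂ³` with `ℝ⁶`. -/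
def complexTripleEquiv : (ℂ × (Bool → ℂ)) ≃ₗ[ℝ] EuclideanSpace ℝ (Fin 6) where
  toFun u := !₂[u.1.re, u.1.im, (u.2 true).re, (u.2 true).im, (u.2 false).re, (u.2 false).im]
  map_add' u w := by
    ext i
    fin_cases i <;> simp
  map_smul' c u := by
    ext i
    fin_cases i <;> simp
  invFun x := (⟨x 0, x 1⟩, fun i => if i then ⟨x 2, x 3⟩ else ⟨x 4, x 5⟩)
  left_inv u := by
    refine Prod.ext rfl (funext fun i => ?_)
    cases i <;> rfl
  right_inv x := by
    ext i
    fin_cases i <;> rfl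

/-- The identification of `ℂ³` with `ℝ⁶`. -/
def complexTripleCLE : (ℂ × (Bool → ℂ)) ≃L[ℝ] EuclideanSpace ℝ (Fin 6) :=
  complexTripleEquiv.toContinuousLinearEquiv

theorem S5.z_eq (x : S5) : x.z = (complexTripleCLE.symm x.1).1 := rfl

variable {M : Type*} [TopologicalSpace M] [ChartedSpace (EuclideanSpace ℝ (Fin 3)) M]
  {B : Set M} {π : M → Circle} {T : Bool → ℝ × ℂ → M} {ζ : M → ℂ} {p : Bool → M → ℂ}
  {ρ : Bool → ℝ}

/-- Radial projection rescales `bookMap` by a positive factor, which preserves the argument of ζ and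
its zero set as well as injectivity and immersivity; compactness of `M` turns the injective
immersion into an embedding. -/
theorem IsPagePair.exists_isOpenBookEmbedding [IsManifold (𝓡 3) ∞ M] [T2Space M] [CompactSpace M]
    (h : IsPagePair B π T ζ p ρ) :
    ∃ f : M → S5, IsOpenBookEmbedding (𝓡 3) (𝓡 5) B π trivialBinding trivialProj f := by
  have hne : (∞ : WithTop ℕ∞) ≠ 0 := by simp
  have : Fact (finrank ℝ (EuclideanSpace ℝ (Fin 6)) = 5 + 1) := ⟨by simp⟩
  let e := complexTripleCLE
  let Φ : M → EuclideanSpace ℝ (Fin 6) := fun x => e (bookMap B T ζ p x)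
  have hΦ0 : ∀ x, Φ x ≠ 0 := fun x =>
    (map_ne_zero_iff e e.injective).2 (h.bookMap_ne_zero x)
  have hΦs : ContMDiff (𝓡 3) 𝓘(ℝ, EuclideanSpace ℝ (Fin 6)) ∞ Φ :=
    e.contDiff.contMDiff.comp h.contMDiff_bookMap
  let s : M → ℝ := fun x => ‖Φ x‖⁻¹
  have hs : ∀ x, 0 < s x := fun x => inv_pos.2 (norm_pos_iff.2 (hΦ0 x))
  have hunit : ∀ x, s x • Φ x ∈ Metric.sphere (0 : EuclideanSpace ℝ (Fin 6)) 1 := by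
    intro x
    rw [mem_sphere_zero_iff_norm, norm_smul, norm_inv, norm_norm,
      inv_mul_cancel₀ (norm_ne_zero_iff.2 (hΦ0 x))]
  have hsm : ContMDiff (𝓡 3) 𝓘(ℝ, EuclideanSpace ℝ (Fin 6)) ∞ (fun x => s x • Φ x) := by
    intro x
    have h1 : ContDiffAt ℝ ∞ (fun u : EuclideanSpace ℝ (Fin 6) => ‖u‖⁻¹ • u) (Φ x) :=
      ((contDiffAt_norm ℝ (hΦ0 x)).inv (norm_ne_zero_iff.2 (hΦ0 x))).smul contDiffAt_id
    exact h1.contMDiffAt.comp x (hΦs x)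
  let f : M → S5 := codRestrict _ _ hunit
  have hfs : ContMDiff (𝓡 3) (𝓡 5) ∞ f := hsm.codRestrict_sphere hunit
  have hFe : ∀ x, e.symm (f x).1 = s x • bookMap B T ζ p x := by
    intro x
    change e.symm (s x • e (bookMap B T ζ p x)) = _
    rw [map_smul, e.symm_apply_apply]
  have hz : ∀ x, (f x).z = s x • ζ x := fun x => by
    rw [S5.z_eq]
    exact congrArg Prod.fst (hFe x)
  have hinj : Injective f := by
    intro x y hxy
    have h1 : s x • bookMap B T ζ p x = s y • bookMap B T ζ p y := by
      rw [← hFe, ← hFe, hxy]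
    refine h.eq_of_bookMap_eq_smul (c := (s y)⁻¹ * s x) (mul_pos (inv_pos.2 (hs y)) (hs x)) ?_
    rw [mul_smul, h1, inv_smul_smul₀ (hs y).ne']
  have hG : ContMDiff (𝓡 5) 𝓘(ℝ, ℂ × (Bool → ℂ)) ∞ (fun u : S5 => e.symm u.1) :=
    e.symm.contDiff.contMDiff.comp contMDiff_coe_sphere
  have himm : ∀ x, Injective (mfderiv (𝓡 3) (𝓡 5) f x) := by
    intro x
    refine (injective_iff_map_eq_zero _).2 fun v hv => ?_
    have hFd : MDifferentiableAt (𝓡 3) 𝓘(ℝ, ℂ × (Bool → ℂ)) (fun x => e.symm (f x).1) x :=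
      (hG.comp hfs).mdifferentiable hne x
    refine h.eq_zero_of_mfderiv_eq_zero hs hFe hFd ?_
    exact hFd.hasMFDerivAt.apply_eq_zero_of_comp (hfs.mdifferentiable hne x).hasMFDerivAt
      (hG.mdifferentiable hne _) EventuallyEq.rfl hv
  -- The normal space of the immersion has dimension 5 − 3 = 2.
  refine ⟨f, ⟨⟨EuclideanSpace ℝ (Fin 2), inferInstance, inferInstance, fun x =>
    isImmersionAtOfComplement_of_injective_mfderiv (by simp) hfs (himm x)⟩,
    (hfs.continuous.isClosedEmbedding hinj).isEmbedding⟩, ?_, ?_, ?_⟩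
  · intro x hx
    change (f x).z = 0
    rw [hz, h.definingFun.apply_binding h.collars hx, smul_zero]
  · intro x hx hx'
    have h1 : (f x).z = 0 := hx'
    rw [hz] at h1
    exact smul_ne_zero (hs x).ne' (h.definingFun.ne_zero x hx) h1
  · intro x hx
    change angle (f x).z = π x
    rw [hz, angle_real_smul (hs x), h.definingFun.angle_eq hx]

theorem IsOpenBook3.exists_isOpenBookEmbedding [IsManifold (𝓡 3) ∞ M] [T2Space M] [CompactSpace M]
    (hπ : IsOpenBook3 annulusModel Annulus B π) :
    ∃ f : M → S5, IsOpenBookEmbedding (𝓡 3) (𝓡 5) B π trivialBinding trivialProj f := by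
  obtain ⟨T, hT⟩ := hπ.exists_isCollars
  obtain ⟨ζ, hζ⟩ := hT.exists_isDefiningFun hπ.contMDiffOn_proj
  obtain ⟨p, ρ, hp, hg⟩ := hT.exists_isPageFun_pair hπ
  exact IsPagePair.exists_isOpenBookEmbedding
    ⟨hT, hπ.isClosed_binding, hπ.contMDiffOn_proj, hζ, hp, hg⟩

end

end

theorem mainTheorem4 {M : Type*} [TopologicalSpace M] [T2Space M] [CompactSpace M]
    [ChartedSpace (EuclideanSpace ℝ (Fin 3)) M] [IsManifold (𝓡 3) ∞ M]
    (hM : IsOrientable3 M) (B : Set M) (π : M → Circle)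
    (hπ : IsOpenBook3 annulusModel Annulus B π) :
    ∃ f : M → S5,
      IsOpenBookEmbedding (𝓡 3) (𝓡 5) B π trivialBinding trivialProj f :=
  hπ.exists_isOpenBookEmbedding
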